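/- Let $N\ge 1$ and let $r_1^+>r_1^->r_2^+>r_2^->\dots>r_N^+>r_N^->0$. Put $D_j=\{x\in\mathbb R^3: r_j^-<|x|<r_j^+\}$, $D=\bigcup_{j=1}^N D_j$, $\Gamma_j^\pm=\{|x|=r_j^\pm\}$, with unit normal $\nu=x/|x|$ on all these spheres, and $|D_j|=\frac{4\pi}{3}\big((r_j^+)^3-(r_j^-)^3\big)$ (the volume of $D_j$). Let $v,v_{\mathrm r}>0$ be fixed, $\omega\in\mathbb C$, $\delta\in\mathbb R$, $k=\omega/v$. **Dirichlet-to-Neumann map.** For $k$ near $0$ and $f=(f_j^\pm)\in\mathbb C^{2N}$ let $v_f$ be the solution of $\Delta v_f+k^2v_f=0$ in $\mathbb R^3\setminus\overline D$ with $v_f=f_j^\pm$ on $\Gamma_j^\pm$ that is outgoing, i.e. outside a large ball equal to a potential $\int G_k(x-y)\,d\mu(y)$, $G_k(x)=-\frac{e^{\mathrm i k|x|}}{4\pi|x|}$, of a compactly supported complex measure $\mu$ (for $\operatorname{Im}k\ge0$, $k\ne0$, this is Sommerfeld's radiation condition; for $k=0$ it is decay at infinity). Set $\mathcal T^k[f]_j^\pm=\partial_\nu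 v_f|_{\Gamma_j^\pm}$ (taken from $\mathbb R^3\setminus\overline D$); this is constant on each sphere. **Auxiliary solutions.** For $u\in H^1(D)$ whose trace on each $\Gamma_i^\pm$ is constant and $w\in H^1(D)$ let $$a_{\omega,\delta}(u,w)=\sum_{i=1}^N\int_{D_i}\Big(\nabla u\cdot\nabla\overline w-\frac{\omega^2}{v_{\mathrm r}^2}u\overline w\Big)dx-\delta\sum_{i=1}^N\Big(\int_{\Gamma_i^+}\overline w\,\mathcal T^k[u]_i^+d\sigma-\int_{\Gamma_i^-}\overline w\,\mathcal T^k[u]_i^-d\sigma\Big)+\sum_{i=1}^N\int_{D_i}u\,dx\int_{D_i}\overline w\,dx .$$ For $(\omega,\delta)$ in a neighbourhood of $0$ in $\mathbb C\times\mathbb R$ and $j=1,\dots,N$ there is exactly one such $u=u_j(\omega,\delta)$ with $a_{\omega,\delta}(u_j,w)=\int_{D_j}\overline w\,dx$ for all $w\in H^1(D)$. **Expansion of $u_j$.** Put $p_j=\frac{r_{j-1}^-r_j^+}{r_{j-1}^--r_j^+}$ for $j\ge2$, $p_1=r_1^+$; $q_j=\frac{r_j^-r_{j+1}^+}{r_j^--r_{j+1}^+}$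 for $j\le N-1$, $q_N=0$. There are $\widetilde u_{j,0,1},\widetilde u_{j,1,1}\in H^1(D)$, independent of $\omega,\delta$, with $\int_{D_i}\widetilde u_{j,0,1}\,dx=\int_{D_i}\widetilde u_{j,1,1}\,dx=0$ for all $i$, such that, in $H^1(D)$, as $(\omega,\delta)\to0$, $$u_j(\omega,\delta)=\Big(\frac1{|D_j|}+\frac{\omega^2}{v_{\mathrm r}^2|D_j|^2}\Big)\chi_{D_j}+\delta\Big[\frac{4\pi p_j}{|D_{j-1}|^2|D_j|}\chi_{D_{j-1}}-\frac{4\pi(p_j+q_j)}{|D_j|^3}\chi_{D_j}+\frac{4\pi q_j}{|D_{j+1}|^2|D_j|}\chi_{D_{j+1}}+\widetilde u_{j,0,1}\Big]+\omega\delta\Big[\frac{4\pi(r_j^+)^2\mathrm i}{|D_j|^3v}\delta_{1,j}\chi_{D_j}+\widetilde u_{j,1,1}\Big]+O\big((|\omega|^2+|\delta|)^2\big),$$ where the terms with $\chi_{D_0}$ and $\chi_{D_{N+1}}$ are absent. **Expansion of $\boldsymbol U$.** Let $\boldsymbol U(\omega,\delta)=\big(\int_{D_i}u_j(\omega,\delta)\,dx\big)_{1\le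 i,j\le N}$, $\boldsymbol V=\operatorname{diag}(|D_1|,\dots,|D_N|)$, $\boldsymbol E_1=\operatorname{diag}(1,0,\dots,0)$, and let $\mathcal C_{ij}=-\big(\int_{\Gamma_i^+}\partial_\nu V_j\,d\sigma-\int_{\Gamma_i^-}\partial_\nu V_j\,d\sigma\big)$ be the capacitance matrix, where $V_j$ is harmonic in $\mathbb R^3\setminus\overline D$, $V_j=\delta_{ij}$ on $\Gamma_i^\pm$, $V_j=O(|x|^{-1})$ at infinity, and $\partial_\nu$ is taken from $\mathbb R^3\setminus\overline D$. Then, as $(\omega,\delta)\to0$, $$\boldsymbol U(\omega,\delta)=\boldsymbol I+\frac{\omega^2}{v_{\mathrm r}^2}\boldsymbol V^{-1}-\delta\,\boldsymbol V^{-1}\mathcal C\boldsymbol V^{-1}+4\pi(r_1^+)^2\frac{\mathrm i\omega\delta}{v}\boldsymbol V^{-1}\boldsymbol E_1\boldsymbol V^{-1}+O\big((|\omega|^2+|\delta|)^2\big).$$ -/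

import Mathlib

open MeasureTheory Filter Topology Asymptotics
open scoped ComplexConjugate

noncomputable section

/-- Physical space `ℝ³` with its Euclidean norm. -/
abbrev Space : Type := EuclideanSpace ℝ (Fin 3)

/-- The two boundary spheres of a spherical shell: `plus` is the outer one, `minus` the inner one. -/
inductive Side : Type
  | plus
  | minus

/-- `N` nested concentric spherical shells, numbered from the outermost (index `0`) to the
innermost one (index `N - 1`). The `i`-th shell lies between the spheres of radii
`rminus i < rplus i`, and consecutive shells are separated by a gap. -/
structure NestedShells (N : ℕ) where
  rplus : Fin N → ℝ
  rminus : Fin N → ℝ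
  rminus_pos : ∀ i, 0 < rminus i
  rminus_lt_rplus : ∀ i, rminus i < rplus i
  nested : ∀ i j, i < j → rplus j < rminus i

/-- The weak partial derivatives of `u` on the open set `Ω` are the components of `G`. -/
def IsWeakGradient (Ω : Set Space) (u : Space → ℂ) (G : Space → EuclideanSpace ℂ (Fin 3)) : Prop :=
  ∀ φ : Space → ℂ, ContDiff ℝ (⊤ : ℕ∞) φ → HasCompactSupport φ → tsupport φ ⊆ Ω → ∀ k : Fin 3,
    ∫ x in Ω, u x * fderiv ℝ φ x (EuclideanSpace.single k 1) = -∫ x in Ω, G x k * φ x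

lemma integrable_mul_test {Ω : Set Space} {f g : Space → ℂ} (hf : MemLp f 2 (volume.restrict Ω))
    (hg : Continuous g) (hc : HasCompactSupport g) : Integrable (fun x => f x * g x)
      (volume.restrict Ω) :=
  MemLp.integrable_mul (q := 2) hf (hg.memLp_of_hasCompactSupport hc)

lemma continuous_partial {φ : Space → ℂ} (hφ : ContDiff ℝ (⊤ : ℕ∞) φ) (e : Space) :
    Continuous fun x => fderiv ℝ φ x e :=
  (hφ.continuous_fderiv (by simp)).clm_apply continuous_const

lemma hasCompactSupport_partial {φ : Space → ℂ} (hφ : HasCompactSupport φ) (e : Space) :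
    HasCompactSupport fun x => fderiv ℝ φ x e :=
  (hφ.fderiv ℝ).comp_left (g := fun L : Space →L[ℝ] ℂ => L e) (by simp)

lemma memLp_component {Ω : Set Space} {G : Space → EuclideanSpace ℂ (Fin 3)}
    (hG : MemLp G 2 (volume.restrict Ω)) (k : Fin 3) :
    MemLp (fun x => G x k) 2 (volume.restrict Ω) :=
  hG.continuousLinearMap_comp (EuclideanSpace.proj (𝕜 := ℂ) k)

/-- The Sobolev space `H¹(Ω)` of complex-valued functions on an open set `Ω ⊆ ℝ³`. Its elements
are pairs formed by a function in `L²(Ω)` and its weak gradient in `L²(Ω)`; the norm inherited from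
the `ℓ²`-product is `(‖u‖²_{L²} + ‖∇u‖²_{L²})^{1/2}`. -/
def SobolevH1 (Ω : Set Space) : Submodule ℂ (WithLp 2
    (Lp ℂ 2 (volume.restrict Ω) × Lp (EuclideanSpace ℂ (Fin 3)) 2 (volume.restrict Ω))) where
  carrier := {p | IsWeakGradient Ω p.fst p.snd}
  zero_mem' := by
    intro φ hφ hc hs k
    have h1 : (((0 : WithLp 2 (Lp ℂ 2 (volume.restrict Ω) ×
        Lp (EuclideanSpace ℂ (Fin 3)) 2 (volume.restrict Ω))).fst : Space → ℂ))
        =ᵐ[volume.restrict Ω] 0 := Lp.coeFn_zero _ _ _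
    have h2 : (((0 : WithLp 2 (Lp ℂ 2 (volume.restrict Ω) ×
        Lp (EuclideanSpace ℂ (Fin 3)) 2 (volume.restrict Ω))).snd :
          Space → EuclideanSpace ℂ (Fin 3)))
        =ᵐ[volume.restrict Ω] 0 := Lp.coeFn_zero _ _ _
    rw [integral_eq_zero_of_ae, integral_eq_zero_of_ae, neg_zero]
    · filter_upwards [h2] with x hx
      rw [hx]
      simp
    · filter_upwards [h1] with x hx
      rw [hx]
      simp
  add_mem' := by
    intro p q hp hq φ hφ hc hs k
    have h1 := Lp.coeFn_add p.fst q.fst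
    have h2 := Lp.coeFn_add p.snd q.snd
    have e1 : ∫ x in Ω, (p + q).fst x * fderiv ℝ φ x (EuclideanSpace.single k 1)
        = ∫ x in Ω, (p.fst x * fderiv ℝ φ x (EuclideanSpace.single k 1)
          + q.fst x * fderiv ℝ φ x (EuclideanSpace.single k 1)) := by
      apply integral_congr_ae
      filter_upwards [h1] with x hx
      rw [WithLp.add_fst, hx, Pi.add_apply, add_mul]
    have e2 : ∫ x in Ω, (p + q).snd x k * φ x
        = ∫ x in Ω, (p.snd x k * φ x + q.snd x k * φ x) := by
      apply integral_congr_ae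
      filter_upwards [h2] with x hx
      rw [WithLp.add_snd, hx, Pi.add_apply, PiLp.add_apply, add_mul]
    have c1 := continuous_partial hφ (EuclideanSpace.single k 1)
    have s1 := hasCompactSupport_partial hc (EuclideanSpace.single k 1)
    rw [e1, e2, integral_add (integrable_mul_test (Lp.memLp _) c1 s1)
      (integrable_mul_test (Lp.memLp _) c1 s1),
      integral_add (integrable_mul_test (memLp_component (Lp.memLp p.snd) k) hφ.continuous hc)
        (integrable_mul_test (memLp_component (Lp.memLp q.snd) k) hφ.continuous hc),
      hp φ hφ hc hs k, hq φ hφ hc hs k, neg_add]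
  smul_mem' := by
    intro c p hp φ hφ hc hs k
    have h1 := Lp.coeFn_smul c p.fst
    have h2 := Lp.coeFn_smul c p.snd
    have e1 : ∫ x in Ω, (c • p).fst x * fderiv ℝ φ x (EuclideanSpace.single k 1)
        = ∫ x in Ω, c * (p.fst x * fderiv ℝ φ x (EuclideanSpace.single k 1)) := by
      apply integral_congr_ae
      filter_upwards [h1] with x hx
      rw [WithLp.smul_fst, hx, Pi.smul_apply, smul_eq_mul, mul_assoc]
    have e2 : ∫ x in Ω, (c • p).snd x k * φ x = ∫ x in Ω, c * (p.snd x k * φ x) := by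
      apply integral_congr_ae
      filter_upwards [h2] with x hx
      rw [WithLp.smul_snd, hx, Pi.smul_apply, PiLp.smul_apply, smul_eq_mul, mul_assoc]
    rw [e1, e2, integral_const_mul, integral_const_mul, hp φ hφ hc hs k, mul_neg]

/-- The integral over the sphere of radius `R` centred at the origin, with respect to surface area,
of the function whose value at the point `R • θ` is `h θ`. -/
def sphereIntegral {F : Type*} [NormedAddCommGroup F] [NormedSpace ℝ F]
    (R : ℝ) (h : Metric.sphere (0 : Space) 1 → F) : F :=
  R ^ 2 • ∫ θ, h θ ∂((volume : Measure Space).toSphere)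

/-- The outgoing fundamental solution of `Δ + k²` in `ℝ³`. -/
def outgoingGreen (k : ℂ) (x : Space) : ℂ :=
  -Complex.exp (Complex.I * k * (‖x‖ : ℂ)) / (4 * Real.pi * (‖x‖ : ℂ))

/-- `w` is outgoing with wave number `k`: far away from the origin it is the potential
`G_k * (g μ)` of a compactly supported source. For `Im k ≥ 0`, `k ≠ 0`, this is the Sommerfeld
radiation condition for solutions of the Helmholtz equation; for `k = 0` it is decay at infinity of
harmonic functions; and it is the usual continuation of these to all complex wave numbers. -/
def IsOutgoing (k : ℂ) (w : Space → ℂ) : Prop :=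
  ∃ (ρ : ℝ) (μ : Measure Space) (g : Space → ℂ), IsFiniteMeasure μ ∧ Integrable g μ ∧
    μ (Metric.closedBall 0 ρ)ᶜ = 0 ∧
    ∀ x, ρ < ‖x‖ → w x = ∫ y, outgoingGreen k (x - y) * g y ∂μ

namespace NestedShells

variable {N : ℕ} (S : NestedShells N)

/-- The radius of the boundary sphere `Γ_i^±`. -/
def radius (i : Fin N) : Side → ℝ
  | Side.plus => S.rplus i
  | Side.minus => S.rminus i

/-- The `i`-th resonator `D_i` (taken open; the boundary spheres have measure zero). -/
def shell (i : Fin N) : Set Space := {x | S.rminus i < ‖x‖ ∧ ‖x‖ < S.rplus i}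

/-- The union `D` of all resonators. -/
def resonators : Set Space := ⋃ i, S.shell i

/-- The open host region: the complement of the closed shells. -/
def host : Set Space := {x | ∀ i, ‖x‖ < S.rminus i ∨ S.rplus i < ‖x‖}

/-- The volume `|D_i|`. -/
def vol (i : Fin N) : ℝ := volume.real (S.shell i)

/-- The boundary values of `w` on `Γ_i^±`, taken from the host region, are the constants `f_i^±`. -/
def HasBoundaryValues {F : Type*} [TopologicalSpace F] (w : Space → F)
    (f : Fin N → Side → F) : Prop :=
  ∀ i s (θ : Metric.sphere (0 : Space) 1),
    Tendsto w (𝓝[S.host] (S.radius i s • (θ : Space))) (𝓝 (f i s))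

/-- The normal derivatives of `w` on `Γ_i^±`, taken from the host region, are `q_i^±`. The normal
points away from the origin on all the spheres. -/
def HasNormalDerivatives {F : Type*} [NormedAddCommGroup F] [NormedSpace ℝ F] (w : Space → F)
    (q : Fin N → Side → Metric.sphere (0 : Space) 1 → F) : Prop :=
  ∀ i s (θ : Metric.sphere (0 : Space) 1),
    Tendsto (fun x => fderiv ℝ w x (‖x‖⁻¹ • x)) (𝓝[S.host] (S.radius i s • (θ : Space)))
      (𝓝 (q i s θ))

/-- `w` solves the exterior Dirichlet problem for the Helmholtz equation with wave number `k` in the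
host region, with boundary data `f` constant on every sphere. -/
def IsExteriorSolution (k : ℂ) (f : Fin N → Side → ℂ) (w : Space → ℂ) : Prop :=
  ContDiffOn ℝ 2 w S.host ∧
  (∀ x ∈ S.host, Laplacian.laplacian w x + k ^ 2 * w x = 0) ∧
  S.HasBoundaryValues w f ∧
  IsOutgoing k w

/-- The Dirichlet-to-Neumann map `𝒯^k : ℂ^{2N} → ℂ^{2N}`: it maps `f` to the normal derivatives of
the solution of the exterior Dirichlet problem with data `f`. -/
def dtn (k : ℂ) (f : Fin N → Side → ℂ) : Fin N → Side → ℂ :=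
  Classical.epsilon fun g => ∃ w, S.IsExteriorSolution k f w ∧
    S.HasNormalDerivatives w fun i s _ => g i s

/-- The space `H¹(D)`. -/
abbrev H1 : Submodule ℂ (WithLp 2 (Lp ℂ 2 (volume.restrict S.resonators) ×
    Lp (EuclideanSpace ℂ (Fin 3)) 2 (volume.restrict S.resonators))) :=
  SobolevH1 S.resonators

/-- The function underlying an element of `H¹(D)`. -/
def fn (u : S.H1) : Space → ℂ := u.1.fst

/-- The weak gradient of an element of `H¹(D)`. -/
def grad (u : S.H1) : Space → EuclideanSpace ℂ (Fin 3) := u.1.snd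

/-- `g` is the trace of `u ∈ H¹(D)` on the boundary spheres: `g_i^±` is the element of `L²(Γ_i^±)`
for which Green's formula holds in each shell against all smooth functions. -/
def IsTrace (u : S.H1) (g : Fin N → Side → Metric.sphere (0 : Space) 1 → ℂ) : Prop :=
  (∀ i s, MemLp (g i s) 2 (volume : Measure Space).toSphere) ∧
  ∀ (i : Fin N) (φ : Space → ℂ), ContDiff ℝ (⊤ : ℕ∞) φ → ∀ k : Fin 3,
    ∫ x in S.shell i, (S.fn u x * fderiv ℝ φ x (EuclideanSpace.single k 1) + S.grad u x k * φ x)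
      = sphereIntegral (S.rplus i)
          (fun θ => g i Side.plus θ * φ (S.rplus i • (θ : Space)) * ((θ : Space) k : ℂ))
        - sphereIntegral (S.rminus i)
          (fun θ => g i Side.minus θ * φ (S.rminus i • (θ : Space)) * ((θ : Space) k : ℂ))

/-- The sesquilinear form `a(u, w)`, where `u` has the constant traces `f` and `w` has the
trace `g`. Here `v` and `vr` are the wave speeds in the host and in the resonators. -/
def form (v vr : ℝ) (ω : ℂ) (δ : ℝ) (u : S.H1) (f : Fin N → Side → ℂ)
    (w : S.H1) (g : Fin N → Side → Metric.sphere (0 : Space) 1 → ℂ) : ℂ :=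
  (∑ i, ∫ x in S.shell i, (inner ℂ (S.grad w x) (S.grad u x)
      - ω ^ 2 / (vr : ℂ) ^ 2 * (S.fn u x * conj (S.fn w x))))
  - δ * ∑ i,
    (sphereIntegral (S.rplus i)
        (fun θ => conj (g i Side.plus θ) * S.dtn (ω / v) f i Side.plus)
      - sphereIntegral (S.rminus i)
        (fun θ => conj (g i Side.minus θ) * S.dtn (ω / v) f i Side.minus))

/-- The modified form `a_{ω,δ}(u, w) = a(u, w) + ∑ᵢ ∫_{D_i} u ∫_{D_i} w̄`. -/
def modifiedForm (v vr : ℝ) (ω : ℂ) (δ : ℝ) (u : S.H1) (f : Fin N → Side → ℂ)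
    (w : S.H1) (g : Fin N → Side → Metric.sphere (0 : Space) 1 → ℂ) : ℂ :=
  S.form v vr ω δ u f w g
    + ∑ i, (∫ x in S.shell i, S.fn u x) * ∫ x in S.shell i, conj (S.fn w x)

/-- `u ∈ H¹(D)` solves `a_{ω,δ}(u, w) = ∫_{D_j} w̄` for all `w ∈ H¹(D)`. As the
Dirichlet-to-Neumann map acts on data that are constant on each sphere, `u` has such traces. -/
def IsAuxiliarySolution (v vr : ℝ) (ω : ℂ) (δ : ℝ) (j : Fin N) (u : S.H1) : Prop :=
  ∃ f : Fin N → Side → ℂ, S.IsTrace u (fun i s _ => f i s) ∧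
    ∀ (w : S.H1) (g : Fin N → Side → Metric.sphere (0 : Space) 1 → ℂ), S.IsTrace w g →
      S.modifiedForm v vr ω δ u f w g = ∫ x in S.shell j, conj (S.fn w x)

/-- The matrix `U` with entries `U_ij = ∫_{D_i} u_j`. -/
def momentMatrix (u : Fin N → S.H1) : Matrix (Fin N) (Fin N) ℂ :=
  Matrix.of fun i j => ∫ x in S.shell i, S.fn (u j) x

lemma isOpen_shell (i : Fin N) : IsOpen (S.shell i) :=
  (isOpen_lt continuous_const continuous_norm).inter (isOpen_lt continuous_norm continuous_const)

lemma shell_subset (i : Fin N) : S.shell i ⊆ S.resonators :=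
  Set.subset_iUnion _ i

lemma volume_shell_ne_top (i : Fin N) : volume (S.shell i) ≠ ⊤ := by
  refine ((measure_mono (t := Metric.ball 0 (S.rplus i)) ?_).trans_lt measure_ball_lt_top).ne
  intro x hx
  simpa using hx.2

lemma disjoint_shell {i j : Fin N} (h : i ≠ j) : Disjoint (S.shell i) (S.shell j) := by
  rw [Set.disjoint_left]
  rintro x ⟨h1, h2⟩ ⟨h3, h4⟩
  rcases lt_or_gt_of_ne h with h | h
  · have := S.nested _ _ h
    linarith
  · have := S.nested _ _ h
    linarith

lemma isOpen_resonators : IsOpen S.resonators := isOpen_iUnion S.isOpen_shell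

lemma integral_partial_shell (i : Fin N) {φ : Space → ℂ} (hφ : ContDiff ℝ (⊤ : ℕ∞) φ)
    (hc : HasCompactSupport φ) (hs : tsupport φ ⊆ S.resonators) (e : Space) :
    ∫ x in S.shell i, fderiv ℝ φ x e = 0 := by
  set ψ : Space → ℂ := (S.shell i).indicator φ with hψ
  have hK : IsClosed (S.shell i ∩ tsupport φ) := by
    have : S.shell i ∩ tsupport φ = tsupport φ ∩ (⋃ j ∈ {j | j ≠ i}, S.shell j)ᶜ := by
      ext x
      constructor
      · rintro ⟨h1, h2⟩
        refine ⟨h2, ?_⟩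
        simp only [Set.mem_compl_iff, Set.mem_iUnion, not_exists]
        intro j hj hx
        exact Set.disjoint_left.1 (S.disjoint_shell hj) hx h1
      · rintro ⟨h1, h2⟩
        refine ⟨?_, h1⟩
        obtain ⟨j, hj⟩ := Set.mem_iUnion.1 (hs h1)
        by_cases hji : j = i
        · exact hji ▸ hj
        · exact absurd (Set.mem_biUnion (show j ∈ {j | j ≠ i} from hji) hj) h2
    rw [this]
    exact (isClosed_tsupport φ).inter
      (isOpen_biUnion fun j _ => S.isOpen_shell j).isClosed_compl
  have hder : ∀ x, HasFDerivAt ψ ((S.shell i).indicator (fderiv ℝ φ) x) x := by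
    intro x
    by_cases hx : x ∈ S.shell i
    · rw [Set.indicator_of_mem hx]
      refine ((hφ.differentiable (by simp)) x).hasFDerivAt.congr_of_eventuallyEq ?_
      filter_upwards [(S.isOpen_shell i).mem_nhds hx] with y hy
      rw [hψ, Set.indicator_of_mem hy]
    · rw [Set.indicator_of_notMem hx]
      refine (hasFDerivAt_const (0 : ℂ) x).congr_of_eventuallyEq ?_
      filter_upwards [hK.isOpen_compl.mem_nhds (fun h => hx h.1)] with y hy
      by_cases hyi : y ∈ S.shell i
      · rw [hψ, Set.indicator_of_mem hyi]
        exact image_eq_zero_of_notMem_tsupport fun h => hy ⟨hyi, h⟩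
      · rw [hψ, Set.indicator_of_notMem hyi]
  have hfd : (fun x => fderiv ℝ ψ x e) = (S.shell i).indicator fun x => fderiv ℝ φ x e := by
    funext x
    rw [(hder x).fderiv]
    by_cases hx : x ∈ S.shell i <;> simp [hx]
  have hint : Integrable (fun x => fderiv ℝ ψ x e) := by
    rw [hfd]
    exact ((continuous_partial hφ e).integrable_of_hasCompactSupport
      (hasCompactSupport_partial hc e)).indicator (S.isOpen_shell i).measurableSet
  have hψi : Integrable ψ :=
    (hφ.continuous.integrable_of_hasCompactSupport hc).indicator (S.isOpen_shell i).measurableSet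
  have key := integral_mul_fderiv_eq_neg_fderiv_mul_of_integrable (𝕜 := ℂ) (μ := volume)
    (f := fun _ : Space => (1 : ℂ)) (g := ψ) (v := e) (by simp) (by simpa using hint)
    (by simpa using hψi) (fun x _ => differentiableAt_const _)
    (fun x _ => (hder x).differentiableAt)
  simp only [one_mul] at key
  rw [hfd, integral_indicator (S.isOpen_shell i).measurableSet] at key
  simpa using key

/-- The indicator function `χ_{D_i}` as an element of `H¹(D)`; its gradient is zero. -/
def chi (i : Fin N) : S.H1 :=
  ⟨WithLp.toLp 2 (indicatorConstLp 2 (μ := volume.restrict S.resonators)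
      (S.isOpen_shell i).measurableSet
      (((Measure.restrict_apply_le _ _).trans_lt (S.volume_shell_ne_top i).lt_top).ne) (1 : ℂ), 0), by
    intro φ hφ hc hs k
    have h1 := indicatorConstLp_coeFn (p := 2) (μ := volume.restrict S.resonators)
      (hs := (S.isOpen_shell i).measurableSet)
      (hμs := (((Measure.restrict_apply_le _ _).trans_lt (S.volume_shell_ne_top i).lt_top).ne))
      (c := (1 : ℂ))
    have h2 := Lp.coeFn_zero (EuclideanSpace ℂ (Fin 3)) 2 (volume.restrict S.resonators)
    have e2 : ∫ x in S.resonators,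
        ((0 : Lp (EuclideanSpace ℂ (Fin 3)) 2 (volume.restrict S.resonators)) x) k * φ x = 0 := by
      apply integral_eq_zero_of_ae
      filter_upwards [h2] with x hx
      rw [hx]
      simp
    have e1 : ∫ x in S.resonators, (indicatorConstLp 2 (μ := volume.restrict S.resonators)
        (S.isOpen_shell i).measurableSet
        (((Measure.restrict_apply_le _ _).trans_lt (S.volume_shell_ne_top i).lt_top).ne) (1 : ℂ)) x
          * fderiv ℝ φ x (EuclideanSpace.single k 1) = 0 := by
      rw [← S.integral_partial_shell i hφ hc hs (EuclideanSpace.single k 1)]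
      have : ∫ x in S.shell i, fderiv ℝ φ x (EuclideanSpace.single k 1)
          = ∫ x in S.resonators, (S.shell i).indicator
            (fun x => fderiv ℝ φ x (EuclideanSpace.single k 1)) x := by
        rw [setIntegral_indicator (S.isOpen_shell i).measurableSet,
          Set.inter_eq_self_of_subset_right (S.shell_subset i)]
      rw [this]
      apply integral_congr_ae
      filter_upwards [h1] with x hx
      rw [hx]
      by_cases hxi : x ∈ S.shell i <;> simp [hxi]
    exact e1.trans (by rw [← neg_zero]; exact congrArg Neg.neg e2.symm)⟩

/-- `V` is the capacitary potential of the `j`-th resonator: harmonic in the host region, equal to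
`1` on the boundary of `D_j` and to `0` on the boundaries of the other resonators, and
`O(|x|⁻¹)` at infinity. -/
def IsCapacitaryPotential (j : Fin N) (V : Space → ℝ) : Prop :=
  ContDiffOn ℝ 2 V S.host ∧
  (∀ x ∈ S.host, Laplacian.laplacian V x = 0) ∧
  S.HasBoundaryValues V (fun i _ => if i = j then 1 else 0) ∧
  V =O[Bornology.cobounded Space] fun x => ‖x‖⁻¹

/-- The capacitance matrix `𝒞_ij = -(∫_{Γ_i^+} ∂V_j/∂ν dσ - ∫_{Γ_i^-} ∂V_j/∂ν dσ)`, where `V_j` is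
the capacitary potential of the `j`-th resonator. -/
def capacitance : Matrix (Fin N) (Fin N) ℝ := Matrix.of fun i j =>
  Classical.epsilon fun c => ∃ V q, S.IsCapacitaryPotential j V ∧ S.HasNormalDerivatives V q ∧
    c = -(sphereIntegral (S.rplus i) (q i Side.plus) - sphereIntegral (S.rminus i) (q i Side.minus))

/-- `r_{j-1}^- r_j^+ / (r_{j-1}^- - r_j^+)`, which is read as `r_j^+` for the outermost shell
(that is, `r_0^- = ∞`). -/
def outerCoupling (j : Fin N) : ℝ :=
  if h : 0 < j.val then
    S.rminus ⟨j.val - 1, by omega⟩ * S.rplus j / (S.rminus ⟨j.val - 1, by omega⟩ - S.rplus j)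
  else S.rplus j

/-- `r_j^- r_{j+1}^+ / (r_j^- - r_{j+1}^+)`, which is read as `0` for the innermost shell
(that is, `r_{N+1}^+ = 0`). -/
def innerCoupling (j : Fin N) : ℝ :=
  if h : j.val + 1 < N then
    S.rminus j * S.rplus ⟨j.val + 1, h⟩ / (S.rminus j - S.rplus ⟨j.val + 1, h⟩)
  else 0

/-- The coefficient of `χ_{D_i}` in the term of order `δ` of the expansion of `u_j`. -/
def deltaCoeff (i j : Fin N) : ℝ :=
  if i.val + 1 = j.val then 4 * Real.pi * S.outerCoupling j / (S.vol i ^ 2 * S.vol j)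
  else if i = j then
    -(4 * Real.pi * S.outerCoupling j / S.vol j ^ 3 + 4 * Real.pi * S.innerCoupling j / S.vol j ^ 3)
  else if i.val = j.val + 1 then 4 * Real.pi * S.innerCoupling j / (S.vol i ^ 2 * S.vol j)
  else 0

/-- The expansion of `u_j(ω, δ)` without its remainder, with zero-mean correctors
`c01` (order `δ`) and `c11` (order `ω δ`). -/
def auxExpansion (v vr : ℝ) (j : Fin N) (c01 c11 : S.H1) (ω : ℂ) (δ : ℝ) : S.H1 :=
  (1 / (S.vol j : ℂ) + ω ^ 2 / ((vr : ℂ) ^ 2 * (S.vol j : ℂ) ^ 2)) • S.chi j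
  + (δ : ℂ) • ((∑ i, (S.deltaCoeff i j : ℂ) • S.chi i) + c01)
  + (ω * δ) • ((if j.val = 0 then
      4 * Real.pi * (S.rplus j : ℂ) ^ 2 * Complex.I / ((S.vol j : ℂ) ^ 3 * v) else 0) • S.chi j
      + c11)

/-- The diagonal matrix `V` of the volumes of the resonators. -/
def volMatrix : Matrix (Fin N) (Fin N) ℂ := Matrix.diagonal fun i => (S.vol i : ℂ)

/-- `𝐈 + ω²/v_r² V⁻¹ - δ V⁻¹ 𝒞 V⁻¹ + 4π (r_1^+)² iωδ/v V⁻¹ E₁ V⁻¹` with `E₁ = diag(1, 0, …, 0)`. -/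
def momentExpansion [NeZero N] (v vr : ℝ) (ω : ℂ) (δ : ℝ) : Matrix (Fin N) (Fin N) ℂ :=
  1 + (ω ^ 2 / (vr : ℂ) ^ 2) • S.volMatrix⁻¹
  - (δ : ℂ) • (S.volMatrix⁻¹ * S.capacitance.map (fun c : ℝ => (c : ℂ)) * S.volMatrix⁻¹)
  + (4 * Real.pi * (S.rplus 0 : ℂ) ^ 2 * (Complex.I * ω * δ / v)) •
      (S.volMatrix⁻¹ * Matrix.diagonal (Pi.single 0 1) * S.volMatrix⁻¹)

end NestedShells

end

noncomputable section

/-! ### Generalized trigonometric functions -/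

/-! All boundary data are constant on spheres, so the problem reduces to ordinary differential
equations in the radius and to a linear system for 2N boundary values.

If Δw + k²w = 0 and ψ(r) is r times the integral of w(rθ) over unit vectors θ, then ψ'' = -k²ψ
(`hasDerivAt_sphereMean_add`). In each component of the host region the Wronskian of ψ with a
suitable explicit solution is constant, and this expresses the integrated normal derivatives through
the boundary values. In the exterior the outgoing condition makes ψ a multiple of exp(ikr) far away
(`exists_mul_sphereMean_of_isOutgoing`). Together with an explicit solution this yields the
Dirichlet-to-Neumann map in closed form (`dtn_eq_dtnMap`). The bounded components enter through k²
only, so the sole term of first order in ω is the ik on the outermost sphere (`dtnMap_isNear`). For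
k = 0 the same formulas give the tridiagonal capacitance matrix (`capacitance_eq`,
`flux_shellData`).

With z = ω²/v_r², the variational equation says that Δu + zu = n_i in D_i, where n_i = ∫_{D_i} u -
δ_ij, with normal derivatives δ 𝒯^k[u]. Such a u is radial in each shell: subtract the radial
solution with the same Cauchy data on the inner sphere. The difference is orthogonal to (Δ + z)φ for
all smooth φ. Plane waves are eigenfunctions of Δ + z, so its Fourier transform vanishes off a
single sphere of frequencies (`ae_eq_zero_of_integral_helmholtz`, `radial_of_isAuxiliarySolution`).
Consequently u = χ_{D_j}/(|D_j| - z) + δe, where e solves Δe + ze = ∫e with normal derivatives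
𝒯^k[f], and the boundary values f of u satisfy f = g + δKf; here g is 1/(|D_j| - z) on the boundary
of D_j and 0 elsewhere, and K is bounded near (ω, δ) = 0 (`isAuxiliarySolution_iff`). For small δ
this system is uniquely solvable, and f is |D_j|⁻¹ on the boundary of D_j and 0 elsewhere, up to
O(|ω|² + |δ|) (`isNear_of_fixed`).

Therefore e = e₀ + ωe₁ + O(|ω|² + |δ|) in H¹(D) (`neumannElement_isNear`). The factor δ in front of
e makes this error quadratic, and 1/(|D_j| - z) is expanded to first order in z. At z = 0 the
integral of e over D_i is the flux of its Neumann data divided by |D_i|; this produces the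
coefficients of the indicator functions, and the correctors are what remains of e₀ and e₁ once these
means are removed. Integration over D_i is bounded on H¹(D) and annihilates the correctors, so it
turns the expansion of u_j into that of the matrix U. -/

/-- The entire function `∑ₙ (-1)ⁿ tⁿ / (2n + m)!`. -/
def trigSeries (m : ℕ) (t : ℂ) : ℂ := ∑' n : ℕ, (-t) ^ n / ((2 * n + m).factorial : ℂ)

/-- `∑ₙ (-t)ⁿ x^(2n+m) / (2n + m)!`; for `t = k²` these are `cos (k x)`, `sin (k x) / k` and their
iterated primitives in `x`. -/
def genTrig (m : ℕ) (t : ℂ) (x : ℝ) : ℂ := (x : ℂ) ^ m * trigSeries m (t * (x : ℂ) ^ 2)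

lemma trigSeries_term_bound (m n : ℕ) (t : ℂ) :
    ‖(-t) ^ n / ((2 * n + m).factorial : ℂ)‖ ≤ ‖t‖ ^ n / (n.factorial : ℝ) := by
  rw [norm_div, norm_pow, norm_neg, Complex.norm_natCast]
  gcongr
  omega

lemma summable_trigSeries (m : ℕ) (t : ℂ) :
    Summable fun n : ℕ => (-t) ^ n / ((2 * n + m).factorial : ℂ) :=
  Summable.of_norm_bounded (Real.summable_pow_div_factorial ‖t‖)
    fun n => trigSeries_term_bound m n t

/-- Domination by the exponential series on every ball gives locally uniform convergence, hence
holomorphy. -/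
lemma differentiable_trigSeries (m : ℕ) : Differentiable ℂ (trigSeries m) := by
  intro t
  have h : DifferentiableOn ℂ (trigSeries m) (Metric.ball 0 (‖t‖ + 1)) := by
    refine Complex.differentiableOn_tsum_of_summable_norm
      (Real.summable_pow_div_factorial (‖t‖ + 1)) (fun n => by fun_prop) Metric.isOpen_ball ?_
    intro n w hw
    refine (trigSeries_term_bound m n w).trans ?_
    have : ‖w‖ ≤ ‖t‖ + 1 := (mem_ball_zero_iff.1 hw).le
    gcongr
  exact h.differentiableAt (Metric.isOpen_ball.mem_nhds (by simp))

lemma contDiff_trigSeries (m : ℕ) {n : WithTop ℕ∞} : ContDiff ℂ n (trigSeries m) :=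
  (differentiable_trigSeries m).contDiff

lemma trigSeries_zero (m : ℕ) : trigSeries m 0 = 1 / (m.factorial : ℂ) := by
  unfold trigSeries
  rw [tsum_eq_single 0]
  · simp
  · intro n hn
    simp [hn]

lemma trigSeries_recurrence (m : ℕ) (t : ℂ) :
    trigSeries m t = 1 / (m.factorial : ℂ) - t * trigSeries (m + 2) t := by
  have h := (summable_trigSeries m t).tsum_eq_zero_add
  unfold trigSeries
  rw [h, ← tsum_mul_left, sub_eq_add_neg, ← tsum_neg]
  congr 1
  · simp
  · congr 1
    funext n
    rw [show 2 * (n + 1) + m = 2 * n + (m + 2) by ring]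
    ring

/-- The orders m and m + 2 differ by a factor -t and a Taylor monomial. Nearly all later identities
between profiles, slopes and moments are linear combinations of instances of this relation. -/
lemma genTrig_recurrence (m : ℕ) (t : ℂ) (x : ℝ) :
    genTrig m t x = (x : ℂ) ^ m / (m.factorial : ℂ) - t * genTrig (m + 2) t x := by
  unfold genTrig
  rw [trigSeries_recurrence]
  ring

lemma genTrig_zero_left (m : ℕ) (x : ℝ) : genTrig m 0 x = (x : ℂ) ^ m / (m.factorial : ℂ) := by
  simp [genTrig, trigSeries_zero, div_eq_mul_inv]

lemma genTrig_zero_right (t : ℂ) : genTrig 0 t 0 = 1 := by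
  simp [genTrig, trigSeries_zero]

lemma genTrig_succ_zero_right (m : ℕ) (t : ℂ) : genTrig (m + 1) t 0 = 0 := by
  simp [genTrig]

lemma genTrig_zero_sq (k : ℂ) (x : ℝ) : genTrig 0 (k ^ 2) x = Complex.cos (k * x) := by
  have h := (Complex.hasSum_cos (k * x)).tsum_eq
  rw [← h]
  simp only [genTrig, trigSeries, pow_zero, one_mul, add_zero]
  congr 1
  funext n
  rw [show -(k ^ 2 * (x : ℂ) ^ 2) = (-1) * (k * x) ^ 2 by ring, mul_pow, ← pow_mul]

lemma mul_genTrig_one_sq (k : ℂ) (x : ℝ) : k * genTrig 1 (k ^ 2) x = Complex.sin (k * x) := by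
  have h := (Complex.hasSum_sin (k * x)).tsum_eq
  rw [← h]
  simp only [genTrig, trigSeries]
  rw [← tsum_mul_left, ← tsum_mul_left]
  congr 1
  funext n
  rw [show -(k ^ 2 * (x : ℂ) ^ 2) = (-1) * (k * x) ^ 2 by ring, mul_pow, ← pow_mul]
  ring

lemma contDiff_genTrig (m : ℕ) {n : WithTop ℕ∞} :
    ContDiff ℝ n fun p : ℂ × ℝ => genTrig m p.1 p.2 := by
  have h : ContDiff ℝ n (trigSeries m) := (contDiff_trigSeries m).restrict_scalars ℝ
  have hx : ContDiff ℝ n fun p : ℂ × ℝ => (p.2 : ℂ) := Complex.ofRealCLM.contDiff.comp contDiff_snd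
  unfold genTrig
  exact (hx.pow m).mul (h.comp (contDiff_fst.mul (hx.pow 2)))

lemma contDiff_genTrig_right (m : ℕ) (t : ℂ) {n : WithTop ℕ∞} : ContDiff ℝ n (genTrig m t) :=
  (contDiff_genTrig m).comp (contDiff_const.prodMk contDiff_id)

lemma differentiable_genTrig_left (m : ℕ) (x : ℝ) : Differentiable ℂ fun t => genTrig m t x := by
  unfold genTrig
  exact ((differentiable_trigSeries m).comp (differentiable_id.mul_const _)).const_mul _

/-- In terms of a square root k of t the two functions are cos(kx) and sin(kx)/k; only the division
by k requires k = 0 to be treated apart. -/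
lemma hasDerivAt_genTrig_zero_one (t : ℂ) (x : ℝ) :
    HasDerivAt (genTrig 0 t) (-t * genTrig 1 t x) x ∧ HasDerivAt (genTrig 1 t) (genTrig 0 t x) x := by
  obtain ⟨k, rfl⟩ : ∃ k : ℂ, t = k ^ 2 := ⟨t ^ (1 / 2 : ℂ), by
    rw [← Complex.cpow_nat_mul]; simp⟩
  have hlin : HasDerivAt (fun y : ℝ => k * (y : ℂ)) k x := by
    simpa using (Complex.ofRealCLM.hasDerivAt (x := x)).const_mul k
  constructor
  · have h := (Complex.hasDerivAt_cos (k * x)).comp x hlin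
    have e : genTrig 0 (k ^ 2) = Complex.cos ∘ fun y : ℝ => k * (y : ℂ) := by
      funext y; simp [genTrig_zero_sq]
    rw [e]
    refine h.congr_deriv ?_
    rw [← mul_genTrig_one_sq]; ring
  · by_cases hk : k = 0
    · subst hk
      have e : genTrig 1 ((0 : ℂ) ^ 2) = fun y : ℝ => (y : ℂ) := by
        funext y; simp [genTrig_zero_left]
      rw [e]
      refine (Complex.ofRealCLM.hasDerivAt (x := x)).congr_deriv ?_
      simp [genTrig_zero_left]
    · have h := ((Complex.hasDerivAt_sin (k * x)).comp x hlin).div_const k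
      have e : genTrig 1 (k ^ 2) = fun y : ℝ => (Complex.sin ∘ fun y : ℝ => k * (y : ℂ)) y / k := by
        funext y; simp [← mul_genTrig_one_sq, hk]
      rw [e]
      refine h.congr_deriv ?_
      rw [← genTrig_zero_sq]; field_simp

lemma hasDerivAt_genTrig_zero (t : ℂ) (x : ℝ) :
    HasDerivAt (genTrig 0 t) (-t * genTrig 1 t x) x := (hasDerivAt_genTrig_zero_one t x).1

lemma hasDerivAt_ofReal_pow_div_factorial (m : ℕ) (x : ℝ) :
    HasDerivAt (fun y : ℝ => (y : ℂ) ^ (m + 1) / ((m + 1).factorial : ℂ))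
      ((x : ℂ) ^ m / (m.factorial : ℂ)) x := by
  have h := ((Complex.ofRealCLM.hasDerivAt (x := x)).pow (m + 1)).div_const ((m + 1).factorial : ℂ)
  refine h.congr_deriv ?_
  have : ((m : ℂ) + 1) ≠ 0 := by exact_mod_cast Nat.succ_ne_zero m
  have h2 : (m.factorial : ℂ) ≠ 0 := by exact_mod_cast m.factorial_ne_zero
  simp [Nat.factorial_succ]
  field_simp

/-- For t ≠ 0 the recurrence expresses order m + 2 through order m, so a two-step induction starts
from the cosine and the sine. For t = 0 only monomials are left. -/
lemma hasDerivAt_genTrig_succ (m : ℕ) (t : ℂ) (x : ℝ) :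
    HasDerivAt (genTrig (m + 1) t) (genTrig m t x) x := by
  by_cases ht : t = 0
  · subst ht
    have e : genTrig (m + 1) 0 = fun y : ℝ => (y : ℂ) ^ (m + 1) / ((m + 1).factorial : ℂ) := by
      funext y; exact genTrig_zero_left _ _
    rw [e, genTrig_zero_left]
    exact hasDerivAt_ofReal_pow_div_factorial m x
  · have e : ∀ m, genTrig (m + 2) t
        = fun y : ℝ => ((y : ℂ) ^ m / (m.factorial : ℂ) - genTrig m t y) / t := by
      intro m; funext y; rw [genTrig_recurrence m]; field_simp; ring
    induction m using Nat.twoStepInduction with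
    | zero => exact (hasDerivAt_genTrig_zero_one t x).2
    | one =>
      rw [e 0]
      have h := (((hasDerivAt_const x (1 : ℂ))).sub (hasDerivAt_genTrig_zero t x)).div_const t
      have h2 : (fun y : ℝ => ((y : ℂ) ^ 0 / (Nat.factorial 0 : ℂ) - genTrig 0 t y) / t)
          = fun y : ℝ => ((1 : ℂ) - genTrig 0 t y) / t := by
        funext y; simp
      rw [h2]
      refine h.congr_deriv ?_
      field_simp; ring
    | more m ih _ =>
      rw [e (m + 1)]
      have h := ((hasDerivAt_ofReal_pow_div_factorial m x).sub ih).div_const t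
      refine h.congr_deriv ?_
      rw [e m]

/-! ### Polar coordinates and the divergence theorem on spheres -/

/-- The unit sphere of `ℝ³`. -/
abbrev UnitSphere : Type := Metric.sphere (0 : Space) 1

/-- The surface measure of the unit sphere. -/
abbrev surfaceMeasure : Measure UnitSphere := (volume : Measure Space).toSphere

/-- The open spherical shell with radii `a` and `b`. -/
def annulus (a b : ℝ) : Set Space := {x | a < ‖x‖ ∧ ‖x‖ < b}

lemma isOpen_annulus (a b : ℝ) : IsOpen (annulus a b) :=
  (isOpen_lt continuous_const continuous_norm).inter (isOpen_lt continuous_norm continuous_const)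

lemma norm_unitSphere (θ : UnitSphere) : ‖(θ : Space)‖ = 1 := by
  simp

lemma norm_smul_unitSphere {r : ℝ} (hr : 0 ≤ r) (θ : UnitSphere) : ‖r • (θ : Space)‖ = r := by
  rw [norm_smul, norm_unitSphere, mul_one, Real.norm_of_nonneg hr]

lemma smul_mem_annulus {a b r : ℝ} (ha : 0 ≤ a) (hr : r ∈ Set.Ioo a b) (θ : UnitSphere) :
    r • (θ : Space) ∈ annulus a b := by
  have : ‖r • (θ : Space)‖ = r := norm_smul_unitSphere (ha.trans hr.1.le) θ
  exact ⟨by rw [this]; exact hr.1, by rw [this]; exact hr.2⟩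

lemma surfaceMeasure_real_univ : surfaceMeasure.real Set.univ = 4 * Real.pi := by
  rw [Measure.toSphere_real_apply_univ, measureReal_def, EuclideanSpace.volume_ball_fin_three]
  have : (0 : ℝ) ≤ Real.pi * 4 / 3 := by positivity
  simp only [one_pow, finrank_euclideanSpace, Fintype.card_fin, ENNReal.ofReal_one, one_mul,
    ENNReal.toReal_ofReal this]
  push_cast
  ring

lemma integral_surfaceMeasure_const (c : ℂ) : ∫ _, c ∂surfaceMeasure = 4 * Real.pi * c := by
  rw [integral_const, surfaceMeasure_real_univ, Complex.real_smul]
  push_cast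
  ring

/-- The homeomorphism of the punctured space with the product of sphere and half-line carries volume
to surface measure times r² dr, and the origin is a null set. -/
lemma integral_polar {F : Space → ℂ} (hF : Integrable F) :
    ∫ x, F x = ∫ r in Set.Ioi (0 : ℝ), ((r ^ 2 : ℝ) : ℂ) * ∫ θ : UnitSphere, F (r • (θ : Space))
      ∂surfaceMeasure := by
  have hmp := (volume : Measure Space).measurePreserving_homeomorphUnitSphereProd
  have hdim : Module.finrank ℝ Space - 1 = 2 := by simp
  rw [hdim] at hmp
  have e1 : ∫ x, F x = ∫ x : ({(0)}ᶜ : Set Space), F x.1 ∂((volume : Measure Space).comap (↑)) := by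
    rw [integral_subtype_comap (measurableSet_singleton _).compl F, restrict_compl_singleton]
  have e2 : ∫ x : ({(0)}ᶜ : Set Space), F x.1 ∂((volume : Measure Space).comap (↑))
      = ∫ q : UnitSphere × Set.Ioi (0 : ℝ), F (q.2.1 • (q.1 : Space))
        ∂(surfaceMeasure.prod (Measure.volumeIoiPow 2)) := by
    rw [← hmp.integral_comp (Homeomorph.measurableEmbedding _)
      (fun q : UnitSphere × Set.Ioi (0 : ℝ) => F (q.2.1 • (q.1 : Space)))]
    refine integral_congr_ae (Eventually.of_forall fun x => ?_)
    simp only [homeomorphUnitSphereProd_apply_snd_coe, homeomorphUnitSphereProd_apply_fst_coe]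
    rw [smul_smul, mul_inv_cancel₀ (norm_ne_zero_iff.2 x.2), one_smul]
  have hint : Integrable (fun q : UnitSphere × Set.Ioi (0 : ℝ) => F (q.2.1 • (q.1 : Space)))
      (surfaceMeasure.prod (Measure.volumeIoiPow 2)) := by
    rw [← hmp.integrable_comp_emb (Homeomorph.measurableEmbedding _)]
    have : ((fun q : UnitSphere × Set.Ioi (0 : ℝ) => F (q.2.1 • (q.1 : Space)))
        ∘ homeomorphUnitSphereProd Space) = F ∘ Subtype.val := by
      funext x
      simp only [Function.comp, homeomorphUnitSphereProd_apply_snd_coe,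
        homeomorphUnitSphereProd_apply_fst_coe]
      rw [smul_smul, mul_inv_cancel₀ (norm_ne_zero_iff.2 x.2), one_smul]
    rw [this, ← integrableOn_iff_comap_subtypeVal (measurableSet_singleton _).compl]
    exact hF.integrableOn
  rw [e1, e2, integral_prod_symm _ hint]
  simp only [Measure.volumeIoiPow, ENNReal.ofReal]
  rw [integral_withDensity_eq_integral_smul,
    integral_subtype_comap measurableSet_Ioi fun a : ℝ => Real.toNNReal (a ^ 2) •
      ∫ θ : UnitSphere, F (a • (θ : Space)) ∂surfaceMeasure]
  · refine setIntegral_congr_fun measurableSet_Ioi fun x hx => ?_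
    simp only [NNReal.smul_def]
    rw [Real.coe_toNNReal _ (sq_nonneg _), Complex.real_smul]
  · exact (measurable_subtype_coe.pow_const _).real_toNNReal

lemma integral_annulus {a b : ℝ} (ha : 0 ≤ a) {F : Space → ℂ} (hF : IntegrableOn F (annulus a b)) :
    ∫ x in annulus a b, F x = ∫ r in Set.Ioo a b, ((r ^ 2 : ℝ) : ℂ) *
      ∫ θ : UnitSphere, F (r • (θ : Space)) ∂surfaceMeasure := by
  have hm := (isOpen_annulus a b).measurableSet
  rw [← integral_indicator hm, integral_polar (hF.integrable_indicator hm)]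
  have hsub : Set.Ioo a b = Set.Ioi 0 ∩ Set.Ioo a b := by
    ext r
    simp only [Set.mem_Ioo, Set.mem_inter_iff, Set.mem_Ioi]
    exact ⟨fun h => ⟨ha.trans_lt h.1, h⟩, fun h => h.2⟩
  rw [hsub, ← setIntegral_indicator measurableSet_Ioo]
  refine setIntegral_congr_fun measurableSet_Ioi fun r hr => ?_
  have hn : ∀ θ : UnitSphere, ‖r • (θ : Space)‖ = r := norm_smul_unitSphere (le_of_lt hr)
  by_cases h : r ∈ Set.Ioo a b
  · simp only [Set.indicator_of_mem h]
    congr 2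
    funext θ
    exact Set.indicator_of_mem (smul_mem_annulus ha h θ) _
  · simp only [Set.indicator_of_notMem h]
    rw [integral_eq_zero_of_ae, mul_zero]
    refine Eventually.of_forall fun θ => Set.indicator_of_notMem (fun hm => h ?_) _
    exact ⟨by simpa [hn θ] using hm.1, by simpa [hn θ] using hm.2⟩

lemma hasFDerivAt_norm_sub {x c : Space} (h : x ≠ c) :
    HasFDerivAt (fun y : Space => ‖y - c‖) (‖x - c‖⁻¹ • innerSL ℝ (x - c)) x := by
  have h0 : x - c ≠ 0 := sub_ne_zero.2 h
  have h1 : HasFDerivAt (fun y : Space => ‖y - c‖ ^ 2) (2 • innerSL ℝ (x - c)) x := by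
    have := (hasStrictFDerivAt_norm_sq (x - c)).hasFDerivAt.comp x
      ((hasFDerivAt_id x).sub_const c)
    simpa using! this
  have h2 := h1.sqrt (pow_ne_zero 2 (norm_ne_zero_iff.2 h0))
  have e : (fun y : Space => √(‖y - c‖ ^ 2)) = fun y => ‖y - c‖ := by
    funext y
    exact Real.sqrt_sq (norm_nonneg _)
  rw [e, Real.sqrt_sq (norm_nonneg _)] at h2
  refine h2.congr_fderiv ?_
  ext v
  simp only [smul_apply, smul_eq_mul, nsmul_eq_mul]
  have := norm_ne_zero_iff.2 h0
  push_cast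
  field_simp

lemma inner_single (x : Space) (k : Fin 3) : inner ℝ x (EuclideanSpace.single k 1) = x k := by
  rw [EuclideanSpace.inner_single_right]
  simp

/-- Compactness of the sphere makes the bound uniform in the angle while local in the radius; this
is the domination needed under the angular integral. -/
lemma exists_local_bound {a b : ℝ} {H : ℝ × UnitSphere → ℂ}
    (hH : ContinuousOn H (Set.Ioo a b ×ˢ Set.univ)) {r : ℝ} (hr : r ∈ Set.Ioo a b) :
    ∃ C : ℝ, ∃ s ∈ 𝓝 r, s ⊆ Set.Ioo a b ∧ ∀ y ∈ s, ∀ θ, ‖H (y, θ)‖ ≤ C := by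
  obtain ⟨ε, hε, hsub⟩ := Metric.nhds_basis_closedBall.mem_iff.1 (isOpen_Ioo.mem_nhds hr)
  have hK : IsCompact (Metric.closedBall r ε ×ˢ (Set.univ : Set UnitSphere)) :=
    (isCompact_closedBall r ε).prod isCompact_univ
  obtain ⟨C, hC⟩ := hK.exists_bound_of_continuousOn
    (hH.mono (Set.prod_mono hsub (Set.Subset.refl _)))
  exact ⟨C, _, Metric.closedBall_mem_nhds r hε, hsub, fun y hy θ => hC (y, θ) ⟨hy, trivial⟩⟩

lemma continuous_slice {a b : ℝ} {H : ℝ × UnitSphere → ℂ}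
    (hH : ContinuousOn H (Set.Ioo a b ×ˢ Set.univ)) {r : ℝ} (hr : r ∈ Set.Ioo a b) :
    Continuous fun θ => H (r, θ) :=
  hH.comp_continuous (by fun_prop) fun θ => ⟨hr, trivial⟩

lemma integrable_sphere_of_continuous {h : UnitSphere → ℂ} (hh : Continuous h) :
    Integrable h surfaceMeasure := by
  obtain ⟨C, hC⟩ := isCompact_univ.exists_bound_of_continuousOn hh.continuousOn
  exact Integrable.of_bound hh.aestronglyMeasurable C
    (Eventually.of_forall fun θ => hC θ trivial)

lemma continuousOn_sphere_integral {a b : ℝ} {H : ℝ × UnitSphere → ℂ}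
    (hH : ContinuousOn H (Set.Ioo a b ×ˢ Set.univ)) :
    ContinuousOn (fun r => ∫ θ, H (r, θ) ∂surfaceMeasure) (Set.Ioo a b) := by
  intro r hr
  obtain ⟨C, s, hs, hsub, hC⟩ := exists_local_bound hH hr
  refine (continuousAt_of_dominated (bound := fun _ => C) ?_ ?_ (integrable_const _)
    (Eventually.of_forall fun θ => ?_)).continuousWithinAt
  · filter_upwards [hs] with y hy
    exact (continuous_slice hH (hsub hy)).aestronglyMeasurable
  · filter_upwards [hs] with y hy
    exact Eventually.of_forall fun θ => hC y hy θ
  · have h1 : ContinuousAt H (r, θ) := hH.continuousAt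
      ((isOpen_Ioo.prod isOpen_univ).mem_nhds ⟨hr, trivial⟩)
    exact ContinuousAt.comp (f := fun y : ℝ => (y, θ)) h1 (by fun_prop)

lemma hasDerivAt_sphere_integral {a b : ℝ} {H H' : ℝ × UnitSphere → ℂ}
    (hH : ContinuousOn H (Set.Ioo a b ×ˢ Set.univ))
    (hH' : ContinuousOn H' (Set.Ioo a b ×ˢ Set.univ))
    (hd : ∀ r ∈ Set.Ioo a b, ∀ θ, HasDerivAt (fun y => H (y, θ)) (H' (r, θ)) r)
    {r : ℝ} (hr : r ∈ Set.Ioo a b) :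
    HasDerivAt (fun r => ∫ θ, H (r, θ) ∂surfaceMeasure) (∫ θ, H' (r, θ) ∂surfaceMeasure) r := by
  obtain ⟨C, s, hs, hsub, hC⟩ := exists_local_bound hH' hr
  refine (hasDerivAt_integral_of_dominated_loc_of_deriv_le (bound := fun _ => C)
    (F := fun r θ => H (r, θ)) (F' := fun r θ => H' (r, θ)) hs ?_ ?_ ?_ ?_
    (integrable_const _) ?_).2
  · filter_upwards [hs] with y hy
    exact (continuous_slice hH (hsub hy)).aestronglyMeasurable
  · exact integrable_sphere_of_continuous (continuous_slice hH hr)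
  · exact (continuous_slice hH' hr).aestronglyMeasurable
  · exact Eventually.of_forall fun θ y hy => hC y hy θ
  · exact Eventually.of_forall fun θ y hy => hd y (hsub hy) θ

lemma continuousOn_smul_sphere {a b : ℝ} (ha : 0 ≤ a) {E : Type*} [TopologicalSpace E]
    {F : Space → E} (hF : ContinuousOn F (annulus a b)) :
    ContinuousOn (fun q : ℝ × UnitSphere => F (q.1 • (q.2 : Space))) (Set.Ioo a b ×ˢ Set.univ) :=
  hF.comp (by fun_prop) fun q hq => smul_mem_annulus ha hq.1 q.2

lemma hasDerivAt_comp_ray {F : Space → ℂ} {r : ℝ} {θ : UnitSphere}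
    (hF : DifferentiableAt ℝ F (r • (θ : Space))) :
    HasDerivAt (fun y : ℝ => F (y • (θ : Space))) (fderiv ℝ F (r • (θ : Space)) θ) r := by
  have h1 : HasDerivAt (fun y : ℝ => y • (θ : Space)) (θ : Space) r := by
    simpa using (hasDerivAt_id r).smul_const (θ : Space)
  exact hF.hasFDerivAt.comp_hasDerivAt r h1

lemma hasDerivAt_spherical_integral {a b : ℝ} (ha : 0 ≤ a) {F : Space → ℂ}
    (hF : ContDiffOn ℝ 1 F (annulus a b)) {κ : UnitSphere → ℂ} (hκ : Continuous κ)
    {r : ℝ} (hr : r ∈ Set.Ioo a b) :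
    HasDerivAt (fun r : ℝ => ∫ θ : UnitSphere, F (r • (θ : Space)) * κ θ ∂surfaceMeasure)
      (∫ θ : UnitSphere, fderiv ℝ F (r • (θ : Space)) θ * κ θ ∂surfaceMeasure) r := by
  have hD := hF.continuousOn_fderiv_of_isOpen (isOpen_annulus a b) le_rfl
  refine hasDerivAt_sphere_integral (a := a) (b := b)
    (H := fun q => F (q.1 • (q.2 : Space)) * κ q.2)
    (H' := fun q => fderiv ℝ F (q.1 • (q.2 : Space)) q.2 * κ q.2) ?_ ?_ ?_ hr
  · exact (continuousOn_smul_sphere ha hF.continuousOn).mul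
      (hκ.comp continuous_snd).continuousOn
  · refine ContinuousOn.mul ?_ (hκ.comp continuous_snd).continuousOn
    exact (continuousOn_smul_sphere ha hD).clm_apply
      (continuous_subtype_val.comp continuous_snd).continuousOn
  · intro y hy θ
    refine HasDerivAt.mul_const (hasDerivAt_comp_ray (F := F) ?_) (κ θ)
    exact (hF.contDiffAt ((isOpen_annulus a b).mem_nhds (smul_mem_annulus ha hy θ))).differentiableAt
      one_ne_zero

/-- The divergence theorem for a vector field `F eₖ`, in differential form: the derivative in `r` of
the flux through the sphere of radius `r` is the integral of the divergence over that sphere. -/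
lemma hasDerivAt_flux {a b : ℝ} (ha : 0 ≤ a) {F : Space → ℂ}
    (hF : ContDiffOn ℝ 1 F (annulus a b)) (k : Fin 3) {r : ℝ} (hr : r ∈ Set.Ioo a b) :
    HasDerivAt (fun r : ℝ => ((r ^ 2 : ℝ) : ℂ) *
        ∫ θ : UnitSphere, F (r • (θ : Space)) * ((θ : Space) k : ℂ) ∂surfaceMeasure)
      (((r ^ 2 : ℝ) : ℂ) * ∫ θ : UnitSphere,
        fderiv ℝ F (r • (θ : Space)) (EuclideanSpace.single k 1) ∂surfaceMeasure) r := by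
  have hκ : Continuous fun θ : UnitSphere => ((θ : Space) k : ℂ) := by fun_prop
  have hD := hF.continuousOn_fderiv_of_isOpen (isOpen_annulus a b) le_rfl
  set M : ℝ → ℂ := fun r => ((r ^ 2 : ℝ) : ℂ) *
        ∫ θ : UnitSphere, F (r • (θ : Space)) * ((θ : Space) k : ℂ) ∂surfaceMeasure with hM
  set M' : ℝ → ℂ := fun r => ((2 * r : ℝ) : ℂ) *
        (∫ θ : UnitSphere, F (r • (θ : Space)) * ((θ : Space) k : ℂ) ∂surfaceMeasure)
        + ((r ^ 2 : ℝ) : ℂ) * (∫ θ : UnitSphere, fderiv ℝ F (r • (θ : Space)) θ *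
          ((θ : Space) k : ℂ) ∂surfaceMeasure) with hM'
  set P : ℝ → ℂ := fun r => ((r ^ 2 : ℝ) : ℂ) * ∫ θ : UnitSphere,
        fderiv ℝ F (r • (θ : Space)) (EuclideanSpace.single k 1) ∂surfaceMeasure with hP
  have hder : ∀ y ∈ Set.Ioo a b, HasDerivAt M (M' y) y := by
    intro y hy
    have h1 : HasDerivAt (fun y : ℝ => ((y ^ 2 : ℝ) : ℂ)) ((2 * y : ℝ) : ℂ) y := by
      have := (hasDerivAt_pow 2 y).ofReal_comp
      simpa using this
    exact h1.mul (hasDerivAt_spherical_integral ha hF hκ hy)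
  have hMc : ContinuousOn M (Set.Ioo a b) := fun y hy => (hder y hy).continuousAt.continuousWithinAt
  have hM'c : ContinuousOn M' (Set.Ioo a b) := by
    refine ContinuousOn.add (ContinuousOn.mul (by fun_prop) ?_) (ContinuousOn.mul (by fun_prop) ?_)
    · exact continuousOn_sphere_integral
        (H := fun q => F (q.1 • (q.2 : Space)) * ((q.2 : Space) k : ℂ))
        ((continuousOn_smul_sphere ha hF.continuousOn).mul (hκ.comp continuous_snd).continuousOn)
    · exact continuousOn_sphere_integral
        (H := fun q => fderiv ℝ F (q.1 • (q.2 : Space)) q.2 * ((q.2 : Space) k : ℂ))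
        (((continuousOn_smul_sphere ha hD).clm_apply
      (continuous_subtype_val.comp continuous_snd).continuousOn).mul
        (hκ.comp continuous_snd).continuousOn)
  have hPc : ContinuousOn P (Set.Ioo a b) := by
    refine ContinuousOn.mul (by fun_prop) ?_
    exact continuousOn_sphere_integral
        (H := fun q => fderiv ℝ F (q.1 • (q.2 : Space)) (EuclideanSpace.single k 1))
        ((continuousOn_smul_sphere ha hD).clm_apply continuousOn_const)
  -- The identity `M' = P` is first proved weakly: against a radial bump g, both ∫(g'M + gM') and
  -- ∫(g'M + gP) vanish. This derives the surface formula from polar coordinates and integration by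
  -- parts in space alone.
  have hweak : ∀ g : ℝ → ℝ, ContDiff ℝ (⊤ : ℕ∞) g → HasCompactSupport g →
      tsupport g ⊆ Set.Ioo a b → ∫ y, g y • (M' y - P y) = 0 := by
    intro g hg hgc hgs
    have hg0 : ∀ y, y ∉ Set.Ioo a b → g y = 0 := fun y hy =>
      image_eq_zero_of_notMem_tsupport fun h => hy (hgs h)
    have hg'0 : ∀ y, y ∉ Set.Ioo a b → deriv g y = 0 := fun y hy =>
      image_eq_zero_of_notMem_tsupport fun h => hy (hgs (tsupport_deriv_subset h))
    have hgd : ∀ y, HasDerivAt g (deriv g y) y := fun y =>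
      (hg.differentiable (by simp) y).hasDerivAt
    have hg'c : Continuous (deriv g) := hg.continuous_deriv (by simp)
    have hint : ∀ {h : ℝ → ℝ} {Q : ℝ → ℂ}, Continuous h → tsupport h ⊆ tsupport g →
        ContinuousOn Q (Set.Ioo a b) → Integrable fun y => (h y : ℂ) * Q y := by
      intro h Q hh hs hQ
      have hc : HasCompactSupport h := hgc.of_isClosed_subset (isClosed_tsupport h) hs
      have hcont : Continuous fun y => (h y : ℂ) * Q y := by
        rw [continuous_iff_continuousAt]
        intro y
        by_cases hy : y ∈ tsupport h
        · exact (Complex.continuous_ofReal.comp hh).continuousAt.mul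
            (hQ.continuousAt (isOpen_Ioo.mem_nhds (hgs (hs hy))))
        · have : (fun y => (h y : ℂ) * Q y) =ᶠ[𝓝 y] fun _ => 0 := by
            filter_upwards [(isClosed_tsupport h).isOpen_compl.mem_nhds hy] with x hx
            rw [image_eq_zero_of_notMem_tsupport hx]
            simp
          exact (continuousAt_const).congr this.symm
      refine hcont.integrable_of_hasCompactSupport (hc.mono' ?_)
      intro y hy
      refine subset_tsupport h ?_
      rw [Function.mem_support] at hy ⊢
      rintro h0
      simp [h0] at hy
    have hgt : tsupport g ⊆ tsupport g := le_rfl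
    have hg't : tsupport (deriv g) ⊆ tsupport g := tsupport_deriv_subset
    have i1 := hint hg'c hg't hMc
    have i2 := hint hg.continuous hgt hM'c
    have i3 := hint hg.continuous hgt hPc
    have z1 : ∫ y, (((deriv g y : ℝ) : ℂ) * M y + (g y : ℂ) * M' y) = 0 := by
      refine integral_eq_zero_of_hasDerivAt_of_integrable (f := fun y => (g y : ℂ) * M y) ?_
        (i1.add i2) (hint hg.continuous hgt hMc)
      intro y
      by_cases hy : y ∈ Set.Ioo a b
      · exact (hgd y).ofReal_comp.mul (hder y hy)
      · have hyt : y ∉ tsupport g := fun h => hy (hgs h)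
        have : (fun y => (g y : ℂ) * M y) =ᶠ[𝓝 y] fun _ => 0 := by
          filter_upwards [(isClosed_tsupport g).isOpen_compl.mem_nhds hyt] with x hx
          rw [image_eq_zero_of_notMem_tsupport hx]
          simp
        rw [hg0 y hy, hg'0 y hy]
        simpa using (hasDerivAt_const y (0 : ℂ)).congr_of_eventuallyEq this
    -- This is the integral over space of the k-th partial derivative of g(‖x‖)F(x), which vanishes
    -- by compact support. In polar coordinates the product rule yields g'M, because ∂ₖ‖x‖ = θₖ, and
    -- gP.
    have z2 : ∫ y, (((deriv g y : ℝ) : ℂ) * M y + (g y : ℂ) * P y) = 0 := by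
      set Φ : Space → ℂ := fun x => (g ‖x‖ : ℂ) * F x with hΦ
      have hloc : ∀ x : Space, ‖x‖ ∉ Set.Ioo a b → Φ =ᶠ[𝓝 x] fun _ => 0 := by
        intro x hx
        have hxt : x ∉ (fun x : Space => ‖x‖) ⁻¹' tsupport g := fun h => hx (hgs h)
        filter_upwards [((isClosed_tsupport g).preimage continuous_norm).isOpen_compl.mem_nhds hxt]
          with y hy
        have : g ‖y‖ = 0 := image_eq_zero_of_notMem_tsupport hy
        simp [hΦ, this]
      have hnorm : ∀ x : Space, ‖x‖ ∈ Set.Ioo a b → ContDiffAt ℝ (⊤ : ℕ∞) (fun y : Space => ‖y‖) x :=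
        fun x hx => contDiffAt_norm ℝ (norm_pos_iff.1 (ha.trans_lt hx.1))
      have hΦc : ContDiff ℝ 1 Φ := by
        rw [contDiff_iff_contDiffAt]
        intro x
        by_cases hx : ‖x‖ ∈ Set.Ioo a b
        · have h1 : ContDiffAt ℝ 1 (fun y : Space => (g ‖y‖ : ℂ)) x :=
            Complex.ofRealCLM.contDiff.contDiffAt.comp x
              ((hg.of_le (by exact_mod_cast le_top)).contDiffAt.comp x
                ((hnorm x hx).of_le (by exact_mod_cast le_top)))
          exact h1.mul (hF.contDiffAt ((isOpen_annulus a b).mem_nhds hx))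
        · exact contDiffAt_const.congr_of_eventuallyEq (hloc x hx)
      have hΦs : HasCompactSupport Φ := by
        refine HasCompactSupport.of_support_subset_isCompact (isCompact_closedBall (0 : Space) b) ?_
        intro x hx
        by_contra h
        have : ‖x‖ ∉ Set.Ioo a b := fun h' => h (by simpa using h'.2.le)
        exact hx (by simp [hΦ, hg0 _ this])
      have hΦ'c : Continuous fun x => fderiv ℝ Φ x (EuclideanSpace.single k 1) :=
        (hΦc.continuous_fderiv one_ne_zero).clm_apply continuous_const
      have hΦ'i : Integrable fun x => fderiv ℝ Φ x (EuclideanSpace.single k 1) :=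
        hΦ'c.integrable_of_hasCompactSupport ((hΦs.fderiv ℝ).comp_left
          (g := fun L : Space →L[ℝ] ℂ => L (EuclideanSpace.single k 1)) (by simp))
      have key := integral_mul_fderiv_eq_neg_fderiv_mul_of_integrable (𝕜 := ℂ) (μ := volume)
        (f := fun _ : Space => (1 : ℂ)) (g := Φ) (v := EuclideanSpace.single k 1) (by simp)
        (by simpa using hΦ'i)
        (by simpa using hΦc.continuous.integrable_of_hasCompactSupport hΦs)
        (fun x _ => differentiableAt_const _)
        (fun x _ => hΦc.differentiable one_ne_zero x)
      simp only [one_mul, fderiv_fun_const, Pi.zero_apply, zero_apply, zero_mul,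
        integral_zero, neg_zero] at key
      rw [integral_polar hΦ'i] at key
      rw [← key, ← setIntegral_eq_integral_of_forall_compl_eq_zero (s := Set.Ioi 0)]
      · refine setIntegral_congr_fun measurableSet_Ioi fun y hy => ?_
        have hn : ∀ θ : UnitSphere, ‖y • (θ : Space)‖ = y := norm_smul_unitSphere (le_of_lt hy)
        by_cases hyI : y ∈ Set.Ioo a b
        · have hfd : ∀ θ : UnitSphere, fderiv ℝ Φ (y • (θ : Space)) (EuclideanSpace.single k 1)
              = ((deriv g y : ℝ) : ℂ) * (F (y • (θ : Space)) * ((θ : Space) k : ℂ))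
                + (g y : ℂ) * fderiv ℝ F (y • (θ : Space)) (EuclideanSpace.single k 1) := by
            intro θ
            have hx : ‖y • (θ : Space)‖ ∈ Set.Ioo a b := by rw [hn]; exact hyI
            have hx0 : y • (θ : Space) ≠ 0 := norm_pos_iff.1 (ha.trans_lt hx.1)
            have d1 : HasFDerivAt (fun x : Space => ‖x‖) (fderiv ℝ (fun x : Space => ‖x‖)
              (y • (θ : Space))) (y • (θ : Space)) :=
              ((hnorm _ hx).differentiableAt (by simp)).hasFDerivAt
            have d2 := Complex.ofRealCLM.hasFDerivAt.comp _ ((hgd ‖y • (θ : Space)‖).comp_hasFDerivAt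
              (y • (θ : Space)) d1)
            have d3 := ((hF.contDiffAt ((isOpen_annulus a b).mem_nhds hx)).differentiableAt
              one_ne_zero).hasFDerivAt
            have d4 : fderiv ℝ (fun x : Space => ‖x‖) (y • (θ : Space)) (EuclideanSpace.single k 1)
                = (θ : Space) k := by
              have := (hasFDerivAt_norm_sub (c := 0) hx0).fderiv
              simp only [sub_zero] at this
              rw [this, hn, smul_apply, innerSL_apply_apply, inner_single]
              have hy0 : y ≠ 0 := ne_of_gt hy
              simp [hy0]
            have d5 : HasFDerivAt Φ _ (y • (θ : Space)) := d2.mul d3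
            rw [d5.fderiv]
            simp only [add_apply, smul_apply,
              ContinuousLinearMap.comp_apply, d4, smul_eq_mul, Function.comp, hn]
            simp
            ring
          simp only [hfd]
          rw [integral_add, integral_const_mul, integral_const_mul, hM, hP]
          · ring
          · exact ((integrable_sphere_of_continuous (continuous_slice
              ((continuousOn_smul_sphere ha hF.continuousOn).mul
                (hκ.comp continuous_snd).continuousOn) hyI))).const_mul _
          · exact ((integrable_sphere_of_continuous (continuous_slice
              ((continuousOn_smul_sphere ha hD).clm_apply continuousOn_const) hyI))).const_mul _
        · have : ∀ θ : UnitSphere, fderiv ℝ Φ (y • (θ : Space)) = 0 := by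
            intro θ
            rw [(hloc _ (by rw [hn]; exact hyI)).fderiv_eq]
            simp
          simp [this, hg0 y hyI, hg'0 y hyI]
      · intro y hy
        have : y ∉ Set.Ioo a b := fun h => hy (ha.trans_lt h.1)
        simp [hg0 y this, hg'0 y this]
    have e : (fun y => g y • (M' y - P y)) = fun y => (((deriv g y : ℝ) : ℂ) * M y + (g y : ℂ) * M' y)
        - (((deriv g y : ℝ) : ℂ) * M y + (g y : ℂ) * P y) := by
      funext y
      rw [Complex.real_smul]
      ring
    have i12 : Integrable fun y => ((deriv g y : ℝ) : ℂ) * M y + (g y : ℂ) * M' y := i1.add i2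
    have i13 : Integrable fun y => ((deriv g y : ℝ) : ℂ) * M y + (g y : ℂ) * P y := i1.add i3
    rw [e, integral_sub i12 i13, z1, z2, sub_zero]
  -- The fundamental lemma of the calculus of variations gives equality almost everywhere;
  -- continuity of both sides upgrades it to every radius.
  have hae := isOpen_Ioo.ae_eq_zero_of_integral_contDiff_smul_eq_zero (μ := volume)
    ((hM'c.sub hPc).locallyIntegrableOn measurableSet_Ioo) hweak
  have heq : Set.EqOn (fun y => M' y - P y) (fun _ => 0) (Set.Ioo a b) := by
    refine Measure.eqOn_open_of_ae_eq (μ := volume) ?_ isOpen_Ioo (hM'c.sub hPc) continuousOn_const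
    rw [Filter.EventuallyEq, ae_restrict_iff' measurableSet_Ioo]
    exact hae
  have := hder r hr
  rwa [sub_eq_zero.1 (heq hr)] at this

/-- This is the derivative of the flux, integrated from a to b. It later identifies the traces of
smooth functions. -/
lemma integral_partial_annulus {a b : ℝ} (ha : 0 < a) (hab : a < b) {F : Space → ℂ}
    (hF : ContDiff ℝ 1 F) (k : Fin 3) :
    ∫ x in annulus a b, fderiv ℝ F x (EuclideanSpace.single k 1)
      = sphereIntegral b (fun θ => F (b • (θ : Space)) * ((θ : Space) k : ℂ))
        - sphereIntegral a (fun θ => F (a • (θ : Space)) * ((θ : Space) k : ℂ)) := by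
  have hc : Continuous fun x => fderiv ℝ F x (EuclideanSpace.single k 1) :=
    (hF.continuous_fderiv one_ne_zero).clm_apply continuous_const
  have hint : IntegrableOn (fun x => fderiv ℝ F x (EuclideanSpace.single k 1)) (annulus a b) := by
    refine (hc.continuousOn.integrableOn_compact (isCompact_closedBall (0 : Space) b)).mono_set ?_
    intro x hx
    simpa using hx.2.le
  rw [integral_annulus ha.le hint, ← integral_Ioc_eq_integral_Ioo,
    ← intervalIntegral.integral_of_le hab.le]
  -- A larger shell makes both end radii interior points, so the fundamental theorem applies on the
  -- closed interval.
  have hFo : ContDiffOn ℝ 1 F (annulus 0 (b + 1)) := hF.contDiffOn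
  have hsub : Set.uIcc a b ⊆ Set.Ioo 0 (b + 1) := by
    rw [Set.uIcc_of_le hab.le]
    intro y hy
    exact ⟨ha.trans_le hy.1, by linarith [hy.2]⟩
  rw [intervalIntegral.integral_eq_sub_of_hasDerivAt
    (fun y hy => hasDerivAt_flux le_rfl hFo k (hsub hy))]
  · simp only [sphereIntegral, Complex.real_smul]
  · refine ContinuousOn.intervalIntegrable (ContinuousOn.mono ?_ hsub)
    refine ContinuousOn.mul (by fun_prop) ?_
    exact continuousOn_sphere_integral
      (H := fun q => fderiv ℝ F (q.1 • (q.2 : Space)) (EuclideanSpace.single k 1))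
      (continuousOn_smul_sphere le_rfl hc.continuousOn)

/-! ### The Laplacian in coordinates and spherical means of Helmholtz solutions -/

lemma laplacian_eq_sum {w : Space → ℂ} {x : Space} (hw : ContDiffAt ℝ 2 w x) :
    Laplacian.laplacian w x = ∑ k : Fin 3, fderiv ℝ (fun y => fderiv ℝ w y (EuclideanSpace.single k 1))
      x (EuclideanSpace.single k 1) := by
  rw [InnerProductSpace.laplacian_eq_iteratedFDeriv_orthonormalBasis w
    (EuclideanSpace.basisFun (Fin 3) ℝ)]
  refine Finset.sum_congr rfl fun k _ => ?_
  have hd : DifferentiableAt ℝ (fderiv ℝ w) x :=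
    (hw.fderiv_right (m := 1) (by norm_num)).differentiableAt one_ne_zero
  rw [iteratedFDeriv_two_apply, fderiv_clm_apply hd (differentiableAt_const _)]
  simp

lemma sum_coord_smul_single (x : Space) : ∑ k : Fin 3, x k • EuclideanSpace.single k (1 : ℝ) = x := by
  have := (EuclideanSpace.basisFun (Fin 3) ℝ).sum_repr x
  simpa using this

lemma fderiv_apply_eq_sum (L : Space →L[ℝ] ℂ) (x : Space) :
    L x = ∑ k : Fin 3, L (EuclideanSpace.single k 1) * (x k : ℂ) := by
  conv_lhs => rw [← sum_coord_smul_single x]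
  rw [map_sum]
  refine Finset.sum_congr rfl fun k _ => ?_
  rw [map_smul, Complex.real_smul, mul_comm]

/-- The integral of `w` over the sphere of radius `r`, with respect to the normalized variable. -/
def sphereMean (w : Space → ℂ) (r : ℝ) : ℂ := ∫ θ : UnitSphere, w (r • (θ : Space)) ∂surfaceMeasure

/-- The integral of the radial derivative of `w` over the sphere of radius `r`. -/
def sphereMeanDeriv (w : Space → ℂ) (r : ℝ) : ℂ :=
  ∫ θ : UnitSphere, fderiv ℝ w (r • (θ : Space)) θ ∂surfaceMeasure

lemma hasDerivAt_sphereMean {a b : ℝ} (ha : 0 ≤ a) {w : Space → ℂ}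
    (hw : ContDiffOn ℝ 1 w (annulus a b)) {r : ℝ} (hr : r ∈ Set.Ioo a b) :
    HasDerivAt (sphereMean w) (sphereMeanDeriv w r) r := by
  have := hasDerivAt_spherical_integral ha hw (κ := fun _ => 1) continuous_const hr
  simpa [sphereMean, sphereMeanDeriv] using! this

/-- The differentiated quantity is the flux of ∇w through the sphere of radius r. The flux formula
for the three components of the gradient has the divergence Δw = -tw on the right. -/
lemma hasDerivAt_sq_mul_sphereMeanDeriv {a b : ℝ} (ha : 0 ≤ a) {w : Space → ℂ} {t : ℂ}
    (hw : ContDiffOn ℝ 2 w (annulus a b))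
    (hlap : ∀ x ∈ annulus a b, Laplacian.laplacian w x + t * w x = 0) {r : ℝ}
    (hr : r ∈ Set.Ioo a b) :
    HasDerivAt (fun r => ((r ^ 2 : ℝ) : ℂ) * sphereMeanDeriv w r)
      (-t * ((r ^ 2 : ℝ) : ℂ) * sphereMean w r) r := by
  have ho := isOpen_annulus a b
  have hF : ∀ k : Fin 3, ContDiffOn ℝ 1 (fun y => fderiv ℝ w y (EuclideanSpace.single k 1))
      (annulus a b) := fun k =>
    (hw.fderiv_of_isOpen ho (by norm_num)).clm_apply contDiffOn_const
  have hsum := HasDerivAt.fun_sum (u := Finset.univ) fun k _ => hasDerivAt_flux ha (hF k) k hr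
  have hDc : ContinuousOn (fderiv ℝ w) (annulus a b) :=
    hw.continuousOn_fderiv_of_isOpen ho (by norm_num)
  have e1 : ∀ y ∈ Set.Ioo a b, ((y ^ 2 : ℝ) : ℂ) * sphereMeanDeriv w y
      = ∑ k : Fin 3, ((y ^ 2 : ℝ) : ℂ) * ∫ θ : UnitSphere,
        fderiv ℝ w (y • (θ : Space)) (EuclideanSpace.single k 1) * ((θ : Space) k : ℂ)
          ∂surfaceMeasure := by
    intro y hy
    rw [← Finset.mul_sum, ← integral_finsetSum]
    · simp only [sphereMeanDeriv, ← fderiv_apply_eq_sum]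
    · intro k _
      refine integrable_sphere_of_continuous (Continuous.mul ?_ (by fun_prop))
      exact continuous_slice (H := fun q : ℝ × UnitSphere =>
        fderiv ℝ w (q.1 • (q.2 : Space)) (EuclideanSpace.single k 1))
        ((continuousOn_smul_sphere ha hDc).clm_apply continuousOn_const) hy
  refine (hsum.congr_of_eventuallyEq ?_).congr_deriv ?_
  · filter_upwards [isOpen_Ioo.mem_nhds hr] with y hy
    exact e1 y hy
  · rw [← Finset.mul_sum, ← integral_finsetSum]
    · have e2 : ∀ θ : UnitSphere, ∑ k : Fin 3, fderiv ℝ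
          (fun y => fderiv ℝ w y (EuclideanSpace.single k 1)) (r • (θ : Space))
            (EuclideanSpace.single k 1) = -t * w (r • (θ : Space)) := by
        intro θ
        have hm := smul_mem_annulus ha hr θ
        rw [← laplacian_eq_sum (hw.contDiffAt (ho.mem_nhds hm)), neg_mul]
        exact eq_neg_of_add_eq_zero_left (hlap _ hm)
      simp only [e2]
      rw [integral_const_mul, sphereMean]
      ring
    · intro k _
      have hDD := (hF k).continuousOn_fderiv_of_isOpen ho le_rfl
      exact integrable_sphere_of_continuous (continuous_slice (H := fun q : ℝ × UnitSphere =>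
        fderiv ℝ (fun y => fderiv ℝ w y (EuclideanSpace.single k 1)) (q.1 • (q.2 : Space))
          (EuclideanSpace.single k 1))
        ((continuousOn_smul_sphere ha hDD).clm_apply continuousOn_const) hr)

lemma hasDerivAt_mul_sphereMean {a b : ℝ} (ha : 0 ≤ a) {w : Space → ℂ}
    (hw : ContDiffOn ℝ 1 w (annulus a b)) {r : ℝ} (hr : r ∈ Set.Ioo a b) :
    HasDerivAt (fun r : ℝ => (r : ℂ) * sphereMean w r)
      (sphereMean w r + r * sphereMeanDeriv w r) r := by
  have := (Complex.ofRealCLM.hasDerivAt (x := r)).mul (hasDerivAt_sphereMean ha hw hr)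
  refine this.congr_deriv ?_
  simp

/-- With ψ equal to r times the spherical mean, the differentiated function is ψ', so this is the
equation ψ'' = -tψ. It follows on writing the second summand as the gradient flux divided by r. -/
lemma hasDerivAt_sphereMean_add {a b : ℝ} (ha : 0 ≤ a) {w : Space → ℂ} {t : ℂ}
    (hw : ContDiffOn ℝ 2 w (annulus a b))
    (hlap : ∀ x ∈ annulus a b, Laplacian.laplacian w x + t * w x = 0) {r : ℝ}
    (hr : r ∈ Set.Ioo a b) :
    HasDerivAt (fun r : ℝ => sphereMean w r + r * sphereMeanDeriv w r)
      (-t * ((r : ℂ) * sphereMean w r)) r := by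
  have hr0 : 0 < r := ha.trans_lt hr.1
  have hrc : (r : ℂ) ≠ 0 := by exact_mod_cast hr0.ne'
  have h1 := hasDerivAt_sphereMean ha (hw.of_le (by norm_num)) hr
  have h2 := (hasDerivAt_sq_mul_sphereMeanDeriv ha hw hlap hr).div
    (Complex.ofRealCLM.hasDerivAt (x := r)) (by simpa using hr0.ne')
  have h3 := h1.add h2
  refine (h3.congr_of_eventuallyEq ?_).congr_deriv ?_
  · filter_upwards [isOpen_Ioo.mem_nhds hr] with y hy
    have hyc : (y : ℂ) ≠ 0 := by exact_mod_cast (ha.trans_lt hy.1).ne'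
    simp
    field_simp
  · simp
    field_simp
    ring

/-! ### Radial functions -/

lemma contDiffAt_radial {p : ℝ → ℂ} {n : WithTop ℕ∞} (hp : ContDiffOn ℝ n p (Set.Ioi 0))
    {x c : Space} (h : x ≠ c) : ContDiffAt ℝ n (fun y : Space => p ‖y - c‖) x := by
  have h0 : x - c ≠ 0 := sub_ne_zero.2 h
  have h1 : ContDiffAt ℝ n (fun y : Space => ‖y - c‖) x :=
    (contDiffAt_id.sub contDiffAt_const).norm ℝ h0
  exact (hp.contDiffAt (isOpen_Ioi.mem_nhds (norm_pos_iff.2 h0))).comp x h1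

lemma hasFDerivAt_radial {p : ℝ → ℂ} {p' : ℂ} {x c : Space} (h : x ≠ c)
    (hp : HasDerivAt p p' ‖x - c‖) :
    HasFDerivAt (fun y : Space => p ‖y - c‖)
      ((‖x - c‖⁻¹ • innerSL ℝ (x - c)).smulRight p') x := by
  have := HasFDerivAt.comp (g := p) (f := fun y : Space => ‖y - c‖) x hp.hasFDerivAt
    (hasFDerivAt_norm_sub h)
  refine this.congr_fderiv ?_
  ext v
  simp
  ring

lemma fderiv_radial_single {p : ℝ → ℂ} {p' : ℂ} {x c : Space} (h : x ≠ c)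
    (hp : HasDerivAt p p' ‖x - c‖) (k : Fin 3) :
    fderiv ℝ (fun y : Space => p ‖y - c‖) x (EuclideanSpace.single k 1)
      = p' * ((x - c) k : ℂ) / (‖x - c‖ : ℂ) := by
  rw [(hasFDerivAt_radial h hp).fderiv, ContinuousLinearMap.smulRight_apply, smul_apply,
    innerSL_apply_apply, inner_single, Complex.real_smul]
  push_cast
  simp only [smul_eq_mul]
  push_cast
  ring

lemma fderiv_radial_self {p : ℝ → ℂ} {p' : ℂ} {x : Space} (h : x ≠ 0)
    (hp : HasDerivAt p p' ‖x‖) :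
    fderiv ℝ (fun y : Space => p ‖y‖) x (‖x‖⁻¹ • x) = p' := by
  have hp' : HasDerivAt p p' ‖x - 0‖ := by simpa using hp
  have := (hasFDerivAt_radial h hp').fderiv
  simp only [sub_zero] at this
  have hx : ‖x‖ ≠ 0 := norm_ne_zero_iff.2 h
  rw [this, ContinuousLinearMap.smulRight_apply, smul_apply, innerSL_apply_apply, inner_smul_right,
    real_inner_self_eq_norm_sq, smul_eq_mul]
  have : ‖x‖⁻¹ * (‖x‖⁻¹ * ‖x‖ ^ 2) = 1 := by field_simp
  rw [this, one_smul]

lemma sum_coord_sq (x : Space) : ∑ k : Fin 3, ((x k : ℂ)) ^ 2 = (‖x‖ : ℂ) ^ 2 := by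
  have := EuclideanSpace.real_norm_sq_eq x
  rw [← Complex.ofReal_pow, this]
  push_cast
  rfl

lemma hasDerivAt_div_ofReal {ψ : ℝ → ℂ} {ψ' : ℂ} {r : ℝ} (hr : 0 < r) (h : HasDerivAt ψ ψ' r) :
    HasDerivAt (fun r : ℝ => ψ r / (r : ℂ)) (ψ' / r - ψ r / (r : ℂ) ^ 2) r := by
  have hrc : (r : ℂ) ≠ 0 := by exact_mod_cast hr.ne'
  have := h.div (Complex.ofRealCLM.hasDerivAt (x := r)) (by simpa using hr.ne')
  refine this.congr_deriv ?_
  simp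
  field_simp

/-- The Laplacian of the radial function `ψ(r) / r` is `ψ''(r) / r`. -/
lemma laplacian_radial_div {ψ ψ₁ : ℝ → ℂ} {ψ₂ : ℂ} {x c : Space} (h : x ≠ c)
    (hψ : ContDiffOn ℝ 2 ψ (Set.Ioi 0)) (h1 : ∀ r, 0 < r → HasDerivAt ψ (ψ₁ r) r)
    (h2 : HasDerivAt ψ₁ ψ₂ ‖x - c‖) :
    Laplacian.laplacian (fun y : Space => ψ ‖y - c‖ / (‖y - c‖ : ℂ)) x = ψ₂ / (‖x - c‖ : ℂ) := by
  have hr : 0 < ‖x - c‖ := norm_pos_iff.2 (sub_ne_zero.2 h)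
  have hrc : (‖x - c‖ : ℂ) ≠ 0 := by exact_mod_cast hr.ne'
  have hid : ContDiffOn ℝ 2 (fun r : ℝ => (r : ℂ)) (Set.Ioi 0) := Complex.ofRealCLM.contDiff.contDiffOn
  have hsm : ContDiffOn ℝ 2 (fun r : ℝ => ψ r / (r : ℂ)) (Set.Ioi 0) := by
    simp only [div_eq_mul_inv]
    exact hψ.mul (hid.inv fun r hr => by exact_mod_cast (ne_of_gt hr))
  rw [laplacian_eq_sum (contDiffAt_radial hsm h)]
  -- Here q is (ψ/r)'/r, so each partial derivative of the radial function is q times a coordinate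
  -- of x - c. Summing the second derivatives gives 3q + rq', which simplifies to ψ''/r.
  set q : ℝ → ℂ := fun r => (ψ₁ r / r - ψ r / (r : ℂ) ^ 2) / r with hq
  set q' : ℂ := ψ₂ / (‖x - c‖ : ℂ) ^ 2 - 3 * ψ₁ ‖x - c‖ / (‖x - c‖ : ℂ) ^ 3
    + 3 * ψ ‖x - c‖ / (‖x - c‖ : ℂ) ^ 4 with hq'
  have hqd : HasDerivAt q q' ‖x - c‖ := by
    have d1 := hasDerivAt_div_ofReal hr h2
    have d2 := hasDerivAt_div_ofReal hr (hasDerivAt_div_ofReal hr (h1 _ hr))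
    have d3 := hasDerivAt_div_ofReal hr d1
    have d4 := hasDerivAt_div_ofReal hr d2
    have e : q =ᶠ[𝓝 ‖x - c‖] fun r : ℝ => ψ₁ r / r / r - ψ r / (r : ℂ) / (r : ℂ) / (r : ℂ) := by
      filter_upwards [isOpen_Ioi.mem_nhds hr] with r hr
      have : (r : ℂ) ≠ 0 := by exact_mod_cast (ne_of_gt hr)
      simp only [hq]
      field_simp
    refine ((d3.sub d4).congr_of_eventuallyEq e).congr_deriv ?_
    rw [hq']
    field_simp
    ring
  have hk : ∀ k : Fin 3, fderiv ℝ (fun y => fderiv ℝ (fun y : Space => ψ ‖y - c‖ / (‖y - c‖ : ℂ)) y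
      (EuclideanSpace.single k 1)) x (EuclideanSpace.single k 1)
      = q ‖x - c‖ + q' / (‖x - c‖ : ℂ) * ((x - c) k : ℂ) ^ 2 := by
    intro k
    have e : (fun y => fderiv ℝ (fun y : Space => ψ ‖y - c‖ / (‖y - c‖ : ℂ)) y
        (EuclideanSpace.single k 1)) =ᶠ[𝓝 x] fun y => q ‖y - c‖ * ((y - c) k : ℂ) := by
      filter_upwards [isOpen_ne.mem_nhds h] with y hy
      have hry : 0 < ‖y - c‖ := norm_pos_iff.2 (sub_ne_zero.2 hy)
      rw [fderiv_radial_single (p := fun r : ℝ => ψ r / (r : ℂ)) hy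
        (hasDerivAt_div_ofReal hry (h1 _ hry))]
      simp only [hq]
      ring
    rw [e.fderiv_eq]
    have d1 := hasFDerivAt_radial h hqd
    have d2 : HasFDerivAt (fun y : Space => (((y - c) k : ℝ) : ℂ))
        (Complex.ofRealCLM.comp (EuclideanSpace.proj (𝕜 := ℝ) k)) x := by
      have := (Complex.ofRealCLM.comp (EuclideanSpace.proj (𝕜 := ℝ) k : Space →L[ℝ] ℝ)).hasFDerivAt
        (x := x - c)
      exact this.comp x ((hasFDerivAt_id x).sub_const c)
    have d3 := (d1.mul d2).fderiv
    have d4 : fderiv ℝ (fun y : Space => q ‖y - c‖ * ((y - c) k : ℂ)) x = _ := d3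
    rw [d4]
    simp only [add_apply, smul_apply, ContinuousLinearMap.comp_apply,
      ContinuousLinearMap.smulRight_apply, innerSL_apply_apply, inner_single, smul_eq_mul,
      Complex.real_smul]
    simp
    ring
  simp only [hk]
  rw [Finset.sum_add_distrib, ← Finset.mul_sum, sum_coord_sq]
  simp only [Finset.sum_const, Finset.card_univ, Fintype.card_fin, nsmul_eq_mul, hq, hq']
  field_simp
  push_cast
  ring

/-- A radial function that is smooth away from the origin agrees outside of a given ball with a
smooth function. -/
lemma exists_contDiff_eq_radial {p : ℝ → ℂ} (hp : ContDiffOn ℝ (⊤ : ℕ∞) p (Set.Ioi 0)) {a : ℝ}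
    (ha : 0 < a) :
    ∃ φ : Space → ℂ, ContDiff ℝ (⊤ : ℕ∞) φ ∧ ∀ x, a < ‖x‖ → φ x = p ‖x‖ := by
  -- This cutoff vanishes for r ≤ a/2 and equals 1 for r ≥ a.
  set η : ℝ → ℝ := fun r => Real.smoothTransition (2 * r / a - 1) with hη
  have hηc : ContDiff ℝ (⊤ : ℕ∞) η :=
    Real.smoothTransition.contDiff.comp (by fun_prop)
  refine ⟨fun x => (η ‖x‖ : ℂ) * p ‖x‖, ?_, fun x hx => ?_⟩
  · rw [contDiff_iff_contDiffAt]
    intro x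
    by_cases hx : x = 0
    · have : (fun x : Space => (η ‖x‖ : ℂ) * p ‖x‖) =ᶠ[𝓝 x] fun _ => 0 := by
        have hb : Metric.ball (0 : Space) (a / 2) ∈ 𝓝 x := by
          rw [hx]; exact Metric.ball_mem_nhds _ (by positivity)
        filter_upwards [hb] with y hy
        have hy' : ‖y‖ < a / 2 := by simpa using hy
        have : η ‖y‖ = 0 := by
          refine Real.smoothTransition.zero_of_nonpos ?_
          rw [sub_nonpos, div_le_one ha]
          linarith
        simp [this]
      exact contDiffAt_const.congr_of_eventuallyEq this
    · have h1 := contDiffAt_radial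
        ((Complex.ofRealCLM.contDiff.comp hηc).contDiffOn.mul hp) (c := 0) hx
      simpa using! h1
  · have : η ‖x‖ = 1 := by
      refine Real.smoothTransition.one_of_one_le ?_
      rw [le_sub_iff_add_le, le_div_iff₀ ha]
      linarith
    simp [this]

/-! ### Limits of spherical means and the one-dimensional Helmholtz equation -/

/-- The limits are assumed for each θ separately, but along the full neighbourhood filter within Ω
and not only radially. This bounds G near each θ, compactness of the sphere makes the bound uniform,
and dominated convergence applies. -/
lemma tendsto_sphere_integral {Ω : Set Space} {G : Space → ℂ} (hG : ContinuousOn G Ω) {R : ℝ}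
    {q : UnitSphere → ℂ} (hq : ∀ θ : UnitSphere, Tendsto G (𝓝[Ω] (R • (θ : Space))) (𝓝 (q θ)))
    {l : Filter ℝ} [l.IsCountablyGenerated] (hl : l ≤ 𝓝 R)
    (hΩ : ∀ᶠ r in l, ∀ θ : UnitSphere, r • (θ : Space) ∈ Ω) :
    Tendsto (fun r : ℝ => ∫ θ : UnitSphere, G (r • (θ : Space)) ∂surfaceMeasure) l
      (𝓝 (∫ θ, q θ ∂surfaceMeasure)) := by
  have hprod : ∀ θ : UnitSphere, Tendsto (fun z : ℝ × UnitSphere => z.1 • (z.2 : Space))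
      (l ×ˢ 𝓝 θ) (𝓝[Ω] (R • (θ : Space))) := by
    intro θ
    refine tendsto_nhdsWithin_iff.2 ⟨?_, ?_⟩
    · have h1 : Tendsto (fun z : ℝ × UnitSphere => z.1 • (z.2 : Space)) (𝓝 (R, θ))
          (𝓝 (R • (θ : Space))) :=
        Continuous.tendsto (f := fun z : ℝ × UnitSphere => z.1 • (z.2 : Space)) (by fun_prop) (R, θ)
      rw [nhds_prod_eq] at h1
      exact h1.mono_left (Filter.prod_mono hl le_rfl)
    · have := hΩ.prod_inl (𝓝 θ)
      filter_upwards [this] with z hz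
      exact hz z.2
  have hbound : ∃ C : ℝ, ∀ᶠ r in l, ∀ θ ∈ (Set.univ : Set UnitSphere), ‖G (r • (θ : Space))‖ ≤ C := by
    refine isCompact_univ.induction_on (p := fun s : Set UnitSphere =>
      ∃ C : ℝ, ∀ᶠ r in l, ∀ θ ∈ s, ‖G (r • (θ : Space))‖ ≤ C) ⟨0, by simp⟩ ?_ ?_ ?_
    · rintro s t hst ⟨C, hC⟩
      exact ⟨C, hC.mono fun r hr θ hθ => hr θ (hst hθ)⟩
    · rintro s t ⟨C, hC⟩ ⟨C', hC'⟩
      refine ⟨max C C', ?_⟩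
      filter_upwards [hC, hC'] with r h1 h2 θ hθ
      rcases hθ with hθ | hθ
      · exact (h1 θ hθ).trans (le_max_left _ _)
      · exact (h2 θ hθ).trans (le_max_right _ _)
    · intro θ _
      have h1 : ∀ᶠ z in l ×ˢ 𝓝 θ, ‖G (z.1 • (z.2 : Space))‖ < ‖q θ‖ + 1 :=
        ((hq θ).comp (hprod θ)).norm.eventually (gt_mem_nhds (by linarith))
      obtain ⟨pa, ha, pb, hb, hab⟩ := Filter.eventually_prod_iff.1 h1
      refine ⟨{θ' | pb θ'}, mem_nhdsWithin_of_mem_nhds hb, ‖q θ‖ + 1, ?_⟩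
      filter_upwards [ha] with r hr θ' hθ'
      exact (hab hr hθ').le
  obtain ⟨C, hC⟩ := hbound
  refine tendsto_integral_filter_of_dominated_convergence (fun _ => C) ?_ ?_ (integrable_const _) ?_
  · filter_upwards [hΩ] with r hr
    exact (hG.comp_continuous (by fun_prop) hr).aestronglyMeasurable
  · filter_upwards [hC] with r hr
    exact Eventually.of_forall fun θ => hr θ trivial
  · refine Eventually.of_forall fun θ => ?_
    have h1 : Tendsto (fun r : ℝ => (r, θ)) l (l ×ˢ 𝓝 θ) := tendsto_id.prodMk tendsto_const_nhds
    exact (hq θ).comp ((hprod θ).comp h1)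

/-- The Wronskian of two solutions of `ψ'' = -t ψ` is constant. -/
lemma exists_wronskian_eq {a b : ℝ} {t : ℂ} {ψ ψ₁ s s₁ : ℝ → ℂ}
    (h1 : ∀ r ∈ Set.Ioo a b, HasDerivAt ψ (ψ₁ r) r)
    (h2 : ∀ r ∈ Set.Ioo a b, HasDerivAt ψ₁ (-t * ψ r) r)
    (h3 : ∀ r, HasDerivAt s (s₁ r) r) (h4 : ∀ r, HasDerivAt s₁ (-t * s r) r) :
    ∃ c, ∀ r ∈ Set.Ioo a b, ψ r * s₁ r - ψ₁ r * s r = c := by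
  have hd : ∀ r ∈ Set.Ioo a b, HasDerivAt (fun r => ψ r * s₁ r - ψ₁ r * s r) 0 r := by
    intro r hr
    refine (((h1 r hr).mul (h4 r)).sub ((h2 r hr).mul (h3 r))).congr_deriv ?_
    ring
  exact isOpen_Ioo.exists_is_const_of_deriv_eq_zero isPreconnected_Ioo
    (fun r hr => (hd r hr).differentiableAt.differentiableWithinAt) fun r hr => (hd r hr).deriv

/-- The Wronskian is constant, so its limits at the two ends agree. At a only the limit of the whole
Wronskian is required; this leaves room for the centre of a ball, where no boundary data are given.
-/
lemma wronskian_limits {a b : ℝ} (hab : a < b) {t : ℂ} {ψ ψ₁ s s₁ : ℝ → ℂ}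
    (h1 : ∀ r ∈ Set.Ioo a b, HasDerivAt ψ (ψ₁ r) r)
    (h2 : ∀ r ∈ Set.Ioo a b, HasDerivAt ψ₁ (-t * ψ r) r)
    (h3 : ∀ r, HasDerivAt s (s₁ r) r) (h4 : ∀ r, HasDerivAt s₁ (-t * s r) r)
    {va vb vb' : ℂ}
    (ha : Tendsto (fun r => ψ r * s₁ r - ψ₁ r * s r) (𝓝[>] a) (𝓝 va))
    (hb : Tendsto ψ (𝓝[<] b) (𝓝 vb)) (hb' : Tendsto ψ₁ (𝓝[<] b) (𝓝 vb')) :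
    va = vb * s₁ b - vb' * s b := by
  obtain ⟨c, hc⟩ := exists_wronskian_eq h1 h2 h3 h4
  have e1 : va = c := by
    refine tendsto_nhds_unique ha (tendsto_const_nhds.congr' ?_)
    filter_upwards [Ioo_mem_nhdsGT hab] with r hr
    exact (hc r hr).symm
  have cs : Tendsto s (𝓝[<] b) (𝓝 (s b)) := (h3 b).continuousAt.tendsto.mono_left nhdsWithin_le_nhds
  have cs₁ : Tendsto s₁ (𝓝[<] b) (𝓝 (s₁ b)) :=
    (h4 b).continuousAt.tendsto.mono_left nhdsWithin_le_nhds
  have e2 : vb * s₁ b - vb' * s b = c := by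
    refine tendsto_nhds_unique ((hb.mul cs₁).sub (hb'.mul cs)) (tendsto_const_nhds.congr' ?_)
    filter_upwards [Ioo_mem_nhdsLT hab] with r hr
    exact (hc r hr).symm
  rw [e1, e2]

/-! ### Boundary derivatives in a gap and the mean value property -/

/-- The derivative at the outer end of the gap `(a, b)` of the radial solution of the Helmholtz
equation `Δ w + t w = 0` with boundary values `fa` and `fb`. -/
def gapOuter (t : ℂ) (a b : ℝ) (fa fb : ℂ) : ℂ :=
  ((b * fb * genTrig 0 t (b - a) - a * fa) / genTrig 1 t (b - a) - fb) / b

/-- The derivative at the inner end of the gap `(a, b)` of the radial solution of the Helmholtz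
equation `Δ w + t w = 0` with boundary values `fa` and `fb`. -/
def gapInner (t : ℂ) (a b : ℝ) (fa fb : ℂ) : ℂ :=
  ((b * fb - a * fa * genTrig 0 t (b - a)) / genTrig 1 t (b - a) - fa) / a

lemma hasDerivAt_genTrig_shift (m : ℕ) (t : ℂ) (c r : ℝ) :
    HasDerivAt (fun r : ℝ => genTrig (m + 1) t (r - c)) (genTrig m t (r - c)) r :=
  (hasDerivAt_genTrig_succ m t (r - c)).comp_sub_const r c

lemma hasDerivAt_genTrig_zero_shift (t : ℂ) (c r : ℝ) :
    HasDerivAt (fun r : ℝ => genTrig 0 t (r - c)) (-t * genTrig 1 t (r - c)) r :=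
  (hasDerivAt_genTrig_zero t (r - c)).comp_sub_const r c

/-- The comparison solution `genTrig 1 t (r - a)` vanishes at a, which eliminates the unknown
derivative there; the Wronskian identity is then solved for q. The factors 4π appear because the
spherical means are not normalized. -/
lemma gapOuter_unique {a b : ℝ} (hab : a < b) (hb0 : 0 < b) {t fa fb q : ℂ}
    (hs : genTrig 1 t (b - a) ≠ 0) {ψ ψ₁ : ℝ → ℂ}
    (h1 : ∀ r ∈ Set.Ioo a b, HasDerivAt ψ (ψ₁ r) r)
    (h2 : ∀ r ∈ Set.Ioo a b, HasDerivAt ψ₁ (-t * ψ r) r)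
    (ha : Tendsto (fun r => ψ r * genTrig 0 t (r - a) - ψ₁ r * genTrig 1 t (r - a)) (𝓝[>] a)
      (𝓝 (4 * Real.pi * (a * fa))))
    (hb : Tendsto ψ (𝓝[<] b) (𝓝 (4 * Real.pi * (b * fb))))
    (hb' : Tendsto ψ₁ (𝓝[<] b) (𝓝 (4 * Real.pi * fb + b * q))) :
    q = 4 * Real.pi * gapOuter t a b fa fb := by
  have key := wronskian_limits hab h1 h2 (hasDerivAt_genTrig_shift 0 t a)
    (hasDerivAt_genTrig_zero_shift t a) ha hb hb'
  have hbc : (b : ℂ) ≠ 0 := by exact_mod_cast hb0.ne'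
  have e : 4 * Real.pi * gapOuter t a b fa fb * b * genTrig 1 t (b - a)
      = 4 * Real.pi * (b * fb * genTrig 0 t (b - a) - a * fa - fb * genTrig 1 t (b - a)) := by
    unfold gapOuter
    field_simp
  refine mul_right_cancel₀ hbc (mul_right_cancel₀ hs ?_)
  rw [e]
  linear_combination key

/-- Now the comparison solution vanishes at b, so the value of the derivative at b is irrelevant;
only the existence of its limit matters. -/
lemma gapInner_unique {a b : ℝ} (hab : a < b) (ha0 : 0 < a) {t fa fb q : ℂ} {vb' : ℂ}
    (hs : genTrig 1 t (b - a) ≠ 0) {ψ ψ₁ : ℝ → ℂ}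
    (h1 : ∀ r ∈ Set.Ioo a b, HasDerivAt ψ (ψ₁ r) r)
    (h2 : ∀ r ∈ Set.Ioo a b, HasDerivAt ψ₁ (-t * ψ r) r)
    (ha : Tendsto ψ (𝓝[>] a) (𝓝 (4 * Real.pi * (a * fa))))
    (ha' : Tendsto ψ₁ (𝓝[>] a) (𝓝 (4 * Real.pi * fa + a * q)))
    (hb : Tendsto ψ (𝓝[<] b) (𝓝 (4 * Real.pi * (b * fb))))
    (hb' : Tendsto ψ₁ (𝓝[<] b) (𝓝 vb')) :
    q = 4 * Real.pi * gapInner t a b fa fb := by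
  have c1 : Tendsto (fun r => genTrig 1 t (r - b)) (𝓝[>] a) (𝓝 (genTrig 1 t (a - b))) :=
    (hasDerivAt_genTrig_shift 0 t b a).continuousAt.tendsto.mono_left nhdsWithin_le_nhds
  have c0 : Tendsto (fun r => genTrig 0 t (r - b)) (𝓝[>] a) (𝓝 (genTrig 0 t (a - b))) :=
    (hasDerivAt_genTrig_zero_shift t b a).continuousAt.tendsto.mono_left nhdsWithin_le_nhds
  have key := wronskian_limits hab h1 h2 (hasDerivAt_genTrig_shift 0 t b)
    (hasDerivAt_genTrig_zero_shift t b) ((ha.mul c0).sub (ha'.mul c1)) hb hb'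
  have p0 : genTrig 0 t (a - b) = genTrig 0 t (b - a) := by
    rw [← neg_sub]; simp only [genTrig]; push_cast; ring_nf
  have p1 : genTrig 1 t (a - b) = -genTrig 1 t (b - a) := by
    rw [← neg_sub]; simp only [genTrig]; push_cast; ring_nf
  rw [sub_self, genTrig_zero_right, genTrig_succ_zero_right, p0, p1] at key
  have hac : (a : ℂ) ≠ 0 := by exact_mod_cast ha0.ne'
  have e : 4 * Real.pi * gapInner t a b fa fb * a * genTrig 1 t (b - a)
      = 4 * Real.pi * (b * fb - a * fa * genTrig 0 t (b - a) - fa * genTrig 1 t (b - a)) := by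
    unfold gapInner
    field_simp
  refine mul_right_cancel₀ hac (mul_right_cancel₀ hs ?_)
  rw [e]
  linear_combination key

/-- The mean value property for solutions of the Helmholtz equation in a ball. -/
lemma mul_sphereMean_eq_of_ball {b : ℝ} {t : ℂ} {w : Space → ℂ}
    (hw : ContDiffOn ℝ 2 w (Metric.ball 0 b))
    (hlap : ∀ x ∈ Metric.ball (0 : Space) b, Laplacian.laplacian w x + t * w x = 0) {r : ℝ}
    (hr : r ∈ Set.Ioo 0 b) :
    (r : ℂ) * sphereMean w r = 4 * Real.pi * w 0 * genTrig 1 t r := by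
  have hb : 0 < b := hr.1.trans hr.2
  have hsub : annulus 0 b ⊆ Metric.ball 0 b := fun x hx => by simpa using hx.2
  have hw' := hw.mono hsub
  have hc : ContinuousOn w (Metric.ball 0 b) := hw.continuousOn
  have hDc : ContinuousOn (fderiv ℝ w) (Metric.ball 0 b) :=
    hw.continuousOn_fderiv_of_isOpen Metric.isOpen_ball (by norm_num)
  have h0 : (0 : Space) ∈ Metric.ball (0 : Space) b := Metric.mem_ball_self hb
  have hΩ : ∀ᶠ r : ℝ in 𝓝[>] 0, ∀ θ : UnitSphere, r • (θ : Space) ∈ Metric.ball (0 : Space) b := by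
    filter_upwards [Ioo_mem_nhdsGT hb] with y hy θ
    exact hsub (smul_mem_annulus le_rfl hy θ)
  have l1 : Tendsto (sphereMean w) (𝓝[>] 0) (𝓝 (4 * Real.pi * w 0)) := by
    rw [← integral_surfaceMeasure_const]
    refine tendsto_sphere_integral hc (fun θ => ?_) nhdsWithin_le_nhds hΩ
    rw [zero_smul]
    exact hc 0 h0
  -- A bounded gradient near the origin makes r times the mean radial derivative tend to 0, so ψ'
  -- tends to 4πw(0).
  have hbd : ∀ᶠ y : ℝ in 𝓝[>] 0, ‖sphereMeanDeriv w y‖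
      ≤ (‖fderiv ℝ w 0‖ + 1) * surfaceMeasure.real Set.univ := by
    have h1 : ∀ᶠ x in 𝓝 (0 : Space), ‖fderiv ℝ w x‖ < ‖fderiv ℝ w 0‖ + 1 :=
      (hDc.continuousAt (Metric.isOpen_ball.mem_nhds h0)).norm.eventually
        (gt_mem_nhds (by linarith))
    obtain ⟨ε, hε, hball⟩ := Metric.eventually_nhds_iff.1 h1
    filter_upwards [Ioo_mem_nhdsGT hε] with y hy
    refine norm_integral_le_of_norm_le_const (Eventually.of_forall fun θ => ?_)
    refine (ContinuousLinearMap.le_opNorm _ _).trans ?_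
    rw [norm_unitSphere, mul_one]
    refine (hball ?_).le
    rw [dist_zero_right, norm_smul_unitSphere hy.1.le]
    exact hy.2
  have lid : Tendsto (fun y : ℝ => (y : ℂ)) (𝓝[>] 0) (𝓝 0) := by
    have := (Complex.continuous_ofReal.tendsto 0).mono_left (nhdsWithin_le_nhds (s := Set.Ioi 0))
    simpa using this
  have hψ : Tendsto (fun y : ℝ => (y : ℂ) * sphereMean w y) (𝓝[>] 0) (𝓝 0) := by
    simpa using lid.mul l1
  have hψ₁ : Tendsto (fun y : ℝ => sphereMean w y + (y : ℂ) * sphereMeanDeriv w y) (𝓝[>] 0)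
      (𝓝 (4 * Real.pi * w 0)) := by
    have l2 : Tendsto (fun y : ℝ => (y : ℂ) * sphereMeanDeriv w y) (𝓝[>] 0) (𝓝 0) :=
      lid.zero_mul_isBoundedUnder_le ⟨_, hbd⟩
    simpa using l1.add l2
  have d1 : ∀ y ∈ Set.Ioo 0 b, HasDerivAt (fun y : ℝ => (y : ℂ) * sphereMean w y)
      (sphereMean w y + (y : ℂ) * sphereMeanDeriv w y) y := fun y hy =>
    hasDerivAt_mul_sphereMean le_rfl (hw'.of_le (by norm_num)) hy
  have d2 : ∀ y ∈ Set.Ioo 0 b, HasDerivAt (fun y : ℝ => sphereMean w y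
      + (y : ℂ) * sphereMeanDeriv w y) (-t * ((y : ℂ) * sphereMean w y)) y := fun y hy =>
    hasDerivAt_sphereMean_add le_rfl hw' (fun x hx => hlap x (hsub hx)) hy
  have d1' := fun y (hy : y ∈ Set.Ioo 0 r) => d1 y ⟨hy.1, hy.2.trans hr.2⟩
  have d2' := fun y (hy : y ∈ Set.Ioo 0 r) => d2 y ⟨hy.1, hy.2.trans hr.2⟩
  have c1 : Tendsto (fun y => genTrig 1 t (y - r)) (𝓝[>] 0) (𝓝 (genTrig 1 t (0 - r))) :=
    (hasDerivAt_genTrig_shift 0 t r 0).continuousAt.tendsto.mono_left nhdsWithin_le_nhds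
  have c0 : Tendsto (fun y => genTrig 0 t (y - r)) (𝓝[>] 0) (𝓝 (genTrig 0 t (0 - r))) :=
    (hasDerivAt_genTrig_zero_shift t r 0).continuousAt.tendsto.mono_left nhdsWithin_le_nhds
  -- The comparison solution vanishes at r, so the Wronskian equals ψ(r) at the outer end, while at
  -- 0 only ψ' contributes.
  have key := wronskian_limits hr.1 d1' d2' (hasDerivAt_genTrig_shift 0 t r)
    (hasDerivAt_genTrig_zero_shift t r) ((hψ.mul c0).sub (hψ₁.mul c1))
    ((d1 r hr).continuousAt.tendsto.mono_left nhdsWithin_le_nhds)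
    ((d2 r hr).continuousAt.tendsto.mono_left nhdsWithin_le_nhds)
  have p1 : genTrig 1 t (0 - r) = -genTrig 1 t r := by
    rw [zero_sub]; simp only [genTrig]; push_cast; ring_nf
  rw [sub_self, genTrig_zero_right, genTrig_succ_zero_right, p1] at key
  linear_combination -key

namespace NestedShells

variable {N : ℕ} (S : NestedShells N)

/-! ### The Dirichlet-to-Neumann map: uniqueness -/

lemma rplus_pos (i : Fin N) : 0 < S.rplus i := (S.rminus_pos i).trans (S.rminus_lt_rplus i)

lemma rplus_le {i j : Fin N} (h : i ≤ j) : S.rplus j ≤ S.rplus i := by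
  rcases h.eq_or_lt with rfl | h
  · exact le_rfl
  · exact ((S.nested i j h).trans (S.rminus_lt_rplus i)).le

lemma rminus_le {i j : Fin N} (h : i ≤ j) : S.rminus j ≤ S.rminus i := by
  rcases h.eq_or_lt with rfl | h
  · exact le_rfl
  · exact ((S.rminus_lt_rplus j).trans (S.nested i j h)).le

/-- The outer radius of the shell inside of the `i`-th one, and zero for the innermost shell. -/
def below (i : Fin N) : ℝ := if h : i.val + 1 < N then S.rplus ⟨i.val + 1, h⟩ else 0

/-- The boundary value at the outer sphere of the shell inside of the `i`-th one. -/
def belowValue (f : Fin N → Side → ℂ) (i : Fin N) : ℂ :=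
  if h : i.val + 1 < N then f ⟨i.val + 1, h⟩ Side.plus else 0

lemma below_nonneg (i : Fin N) : 0 ≤ S.below i := by
  unfold below
  split_ifs
  · exact (S.rplus_pos _).le
  · exact le_rfl

lemma below_lt (i : Fin N) : S.below i < S.rminus i := by
  unfold below
  split_ifs with h
  · exact S.nested _ _ (by rw [Fin.lt_def]; simp)
  · exact S.rminus_pos i

lemma isOpen_host : IsOpen S.host := by
  have : S.host = ⋂ i, {x : Space | ‖x‖ < S.rminus i ∨ S.rplus i < ‖x‖} := by
    ext x
    simp [host]
  rw [this]
  exact isOpen_iInter_of_finite fun i => (isOpen_lt continuous_norm continuous_const).union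
    (isOpen_lt continuous_const continuous_norm)

lemma annulus_below_subset_host (i : Fin N) : annulus (S.below i) (S.rminus i) ⊆ S.host := by
  intro x hx j
  rcases le_or_gt j i with h | h
  · exact Or.inl (hx.2.trans_le (S.rminus_le h))
  · right
    have hi : i.val + 1 < N := by have := j.2; rw [Fin.lt_def] at h; omega
    have hb : S.below i = S.rplus ⟨i.val + 1, hi⟩ := by simp [below, hi]
    refine lt_of_le_of_lt (S.rplus_le ?_) (hb ▸ hx.1)
    rw [Fin.le_def]
    exact h

lemma ball_subset_host {i : Fin N} (hi : ¬ i.val + 1 < N) : Metric.ball 0 (S.rminus i) ⊆ S.host := by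
  intro x hx j
  have hx' : ‖x‖ < S.rminus i := by simpa using hx
  left
  refine hx'.trans_le (S.rminus_le ?_)
  rw [Fin.le_def]
  have := j.2
  omega

lemma exterior_subset_host [NeZero N] {x : Space} (hx : S.rplus 0 < ‖x‖) : x ∈ S.host :=
  fun j => Or.inr ((S.rplus_le (Fin.zero_le j)).trans_lt hx)

/-- Close to a boundary sphere only one component of the host region is visible: the radii beyond
the sphere belong to the shell itself. The same applies to the two lemmas on the outer spheres. -/
lemma eventually_minus (i : Fin N) (θ : UnitSphere) :
    ∀ᶠ x in 𝓝[S.host] (S.rminus i • (θ : Space)), x ∈ annulus (S.below i) (S.rminus i) := by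
  have hn : ‖S.rminus i • (θ : Space)‖ = S.rminus i := norm_smul_unitSphere (S.rminus_pos i).le θ
  have h1 : ∀ᶠ x in 𝓝 (S.rminus i • (θ : Space)), ‖x‖ ∈ Set.Ioo (S.below i) (S.rplus i) :=
    continuous_norm.continuousAt.eventually (isOpen_Ioo.mem_nhds
      (by beta_reduce; rw [hn]; exact ⟨S.below_lt i, S.rminus_lt_rplus i⟩))
  filter_upwards [nhdsWithin_le_nhds h1, self_mem_nhdsWithin] with x hx hxh
  refine ⟨hx.1, ?_⟩
  rcases hxh i with h | h
  · exact h
  · exact absurd hx.2 (not_lt.2 h.le)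

lemma eventually_plus_zero [NeZero N] (θ : UnitSphere) :
    ∀ᶠ x in 𝓝[S.host] (S.rplus 0 • (θ : Space)), S.rplus 0 < ‖x‖ := by
  have hn : ‖S.rplus 0 • (θ : Space)‖ = S.rplus 0 := norm_smul_unitSphere (S.rplus_pos 0).le θ
  have h1 : ∀ᶠ x in 𝓝 (S.rplus 0 • (θ : Space)), S.rminus 0 < ‖x‖ :=
    continuous_norm.continuousAt.eventually (isOpen_Ioi.mem_nhds
      (by beta_reduce; rw [hn]; exact S.rminus_lt_rplus 0))
  filter_upwards [nhdsWithin_le_nhds h1, self_mem_nhdsWithin] with x hx hxh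
  rcases hxh 0 with h | h
  · exact absurd hx (not_lt.2 h.le)
  · exact h

lemma eventually_plus_succ {i j : Fin N} (hij : j.val + 1 = i.val) (θ : UnitSphere) :
    ∀ᶠ x in 𝓝[S.host] (S.rplus i • (θ : Space)), x ∈ annulus (S.rplus i) (S.rminus j) := by
  have hn : ‖S.rplus i • (θ : Space)‖ = S.rplus i := norm_smul_unitSphere (S.rplus_pos i).le θ
  have hlt : j < i := by rw [Fin.lt_def]; omega
  have h1 : ∀ᶠ x in 𝓝 (S.rplus i • (θ : Space)), ‖x‖ ∈ Set.Ioo (S.rminus i) (S.rminus j) :=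
    continuous_norm.continuousAt.eventually (isOpen_Ioo.mem_nhds
      (by beta_reduce; rw [hn]; exact ⟨S.rminus_lt_rplus i, S.nested j i hlt⟩))
  filter_upwards [nhdsWithin_le_nhds h1, self_mem_nhdsWithin] with x hx hxh
  refine ⟨?_, hx.2⟩
  rcases hxh i with h | h
  · exact absurd hx.1 (not_lt.2 h.le)
  · exact h

lemma below_eq {i j : Fin N} (hij : j.val + 1 = i.val) : S.below j = S.rplus i := by
  have h : j.val + 1 < N := by have := i.2; omega
  simp only [below, h, dif_pos]
  congr 1
  exact Fin.ext hij

lemma belowValue_eq (f : Fin N → Side → ℂ) {i j : Fin N} (hij : j.val + 1 = i.val) :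
    belowValue f j = f i Side.plus := by
  have h : j.val + 1 < N := by have := i.2; omega
  simp only [belowValue, h, dif_pos]
  congr 1
  exact Fin.ext hij

/-- The explicit form of the Dirichlet-to-Neumann map. -/
def dtnMap (k : ℂ) (f : Fin N → Side → ℂ) (i : Fin N) : Side → ℂ
  | Side.plus => if h : 0 < i.val then
      gapInner (k ^ 2) (S.rplus i) (S.rminus ⟨i.val - 1, by omega⟩) (f i Side.plus)
        (f ⟨i.val - 1, by omega⟩ Side.minus)
    else (Complex.I * k - 1 / S.rplus i) * f i Side.plus
  | Side.minus => gapOuter (k ^ 2) (S.below i) (S.rminus i) (belowValue f i) (f i Side.minus)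

/-- The wave number `k` is not a resonance of any of the gaps. -/
def Nonresonant (k : ℂ) : Prop := ∀ i, genTrig 1 (k ^ 2) (S.rminus i - S.below i) ≠ 0

section Limits

variable {w : Space → ℂ} {f : Fin N → Side → ℂ} {q : Fin N → Side → UnitSphere → ℂ}

lemma tendsto_mul_sphereMean (hw : ContDiffOn ℝ 2 w S.host) (hbv : S.HasBoundaryValues w f)
    {i : Fin N} {s : Side} {l : Filter ℝ} [l.IsCountablyGenerated] (hl : l ≤ 𝓝 (S.radius i s))
    (hΩ : ∀ᶠ r in l, ∀ θ : UnitSphere, r • (θ : Space) ∈ S.host) :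
    Tendsto (fun r : ℝ => (r : ℂ) * sphereMean w r) l
      (𝓝 (4 * Real.pi * (S.radius i s * f i s))) := by
  have h1 : Tendsto (sphereMean w) l (𝓝 (4 * Real.pi * f i s)) := by
    rw [← integral_surfaceMeasure_const]
    exact tendsto_sphere_integral hw.continuousOn (fun θ => hbv i s θ) hl hΩ
  have h2 : Tendsto (fun r : ℝ => (r : ℂ)) l (𝓝 (S.radius i s : ℂ)) :=
    (Complex.continuous_ofReal.tendsto _).mono_left hl
  convert h2.mul h1 using 2
  ring

lemma tendsto_sphereMean_add (hw : ContDiffOn ℝ 2 w S.host) (hbv : S.HasBoundaryValues w f)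
    (hnd : S.HasNormalDerivatives w q)
    {i : Fin N} {s : Side} {l : Filter ℝ} [l.IsCountablyGenerated] (hl : l ≤ 𝓝 (S.radius i s))
    (hpos : 0 < S.radius i s)
    (hΩ : ∀ᶠ r in l, ∀ θ : UnitSphere, r • (θ : Space) ∈ S.host) :
    Tendsto (fun r : ℝ => sphereMean w r + (r : ℂ) * sphereMeanDeriv w r) l
      (𝓝 (4 * Real.pi * f i s + S.radius i s * ∫ θ, q i s θ ∂surfaceMeasure)) := by
  have h1 : Tendsto (sphereMean w) l (𝓝 (4 * Real.pi * f i s)) := by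
    rw [← integral_surfaceMeasure_const]
    exact tendsto_sphere_integral hw.continuousOn (fun θ => hbv i s θ) hl hΩ
  have h2 : Tendsto (fun r : ℝ => (r : ℂ)) l (𝓝 (S.radius i s : ℂ)) :=
    (Complex.continuous_ofReal.tendsto _).mono_left hl
  have hev : ∀ᶠ r in l, 0 < r := hl (isOpen_Ioi.mem_nhds hpos)
  have h3 : Tendsto (fun r : ℝ => ∫ θ : UnitSphere, fderiv ℝ w (r • (θ : Space))
      (‖r • (θ : Space)‖⁻¹ • (r • (θ : Space))) ∂surfaceMeasure) l
      (𝓝 (∫ θ, q i s θ ∂surfaceMeasure)) := by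
    -- The origin may belong to the host region, and the radial direction is discontinuous there.
    refine tendsto_sphere_integral (Ω := S.host \ {0}) (G := fun x => fderiv ℝ w x (‖x‖⁻¹ • x)) ?_
      (fun θ => (hnd i s θ).mono_left (nhdsWithin_mono _ Set.sdiff_subset)) hl ?_
    · have hD := (hw.continuousOn_fderiv_of_isOpen S.isOpen_host (by norm_num)).mono
        (Set.sdiff_subset (t := {0}))
      refine hD.clm_apply (ContinuousOn.smul (ContinuousOn.inv₀ continuous_norm.continuousOn ?_)
        continuousOn_id)
      intro x hx
      exact norm_ne_zero_iff.2 hx.2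
    · filter_upwards [hΩ, hev] with r hr hr0 θ
      refine ⟨hr θ, fun h => ?_⟩
      have := norm_smul_unitSphere hr0.le θ
      rw [Set.mem_singleton_iff.1 h, norm_zero] at this
      exact hr0.ne this
  have h4 : Tendsto (sphereMeanDeriv w) l (𝓝 (∫ θ, q i s θ ∂surfaceMeasure)) := by
    refine h3.congr' ?_
    filter_upwards [hev] with r hr
    unfold sphereMeanDeriv
    congr 1
    funext θ
    rw [norm_smul_unitSphere hr.le, smul_smul, inv_mul_cancel₀ hr.ne', one_smul]
  exact h1.add (h2.mul h4)

variable {k : ℂ}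

lemma hasDerivAt_mean {a b : ℝ} (ha : 0 ≤ a) (hsub : annulus a b ⊆ S.host)
    (hw : ContDiffOn ℝ 2 w S.host) {r : ℝ} (hr : r ∈ Set.Ioo a b) :
    HasDerivAt (fun r : ℝ => (r : ℂ) * sphereMean w r)
      (sphereMean w r + (r : ℂ) * sphereMeanDeriv w r) r :=
  hasDerivAt_mul_sphereMean ha ((hw.mono hsub).of_le (by norm_num)) hr

lemma hasDerivAt_mean_deriv {a b : ℝ} (ha : 0 ≤ a) (hsub : annulus a b ⊆ S.host)
    (hw : ContDiffOn ℝ 2 w S.host)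
    (hlap : ∀ x ∈ S.host, Laplacian.laplacian w x + k ^ 2 * w x = 0) {r : ℝ}
    (hr : r ∈ Set.Ioo a b) :
    HasDerivAt (fun r : ℝ => sphereMean w r + (r : ℂ) * sphereMeanDeriv w r)
      (-k ^ 2 * ((r : ℂ) * sphereMean w r)) r := by
  exact hasDerivAt_sphereMean_add ha (hw.mono hsub) (fun x hx => hlap x (hsub hx)) hr

/-- Only the integral of the normal derivative over the sphere is determined, with no claim about w
itself. This suffices for the Dirichlet-to-Neumann map, whose values are constant on each sphere,
and for the capacitance matrix, which consists of such integrals. -/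
lemma integral_normalDerivative_minus (hk : S.Nonresonant k) (hw : ContDiffOn ℝ 2 w S.host)
    (hlap : ∀ x ∈ S.host, Laplacian.laplacian w x + k ^ 2 * w x = 0)
    (hbv : S.HasBoundaryValues w f) (hnd : S.HasNormalDerivatives w q) (i : Fin N) :
    ∫ θ, q i Side.minus θ ∂surfaceMeasure = 4 * Real.pi * S.dtnMap k f i Side.minus := by
  have ha := S.below_nonneg i
  have hab := S.below_lt i
  have hsub := S.annulus_below_subset_host i
  have hΩ : ∀ r ∈ Set.Ioo (S.below i) (S.rminus i), ∀ θ : UnitSphere, r • (θ : Space) ∈ S.host :=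
    fun r hr θ => hsub (smul_mem_annulus ha hr θ)
  have hΩb : ∀ᶠ r in 𝓝[<] S.rminus i, ∀ θ : UnitSphere, r • (θ : Space) ∈ S.host := by
    filter_upwards [Ioo_mem_nhdsLT hab] using hΩ
  have hd1 := fun r (hr : r ∈ Set.Ioo (S.below i) (S.rminus i)) => S.hasDerivAt_mean ha hsub hw hr
  have hd2 := fun r (hr : r ∈ Set.Ioo (S.below i) (S.rminus i)) =>
    S.hasDerivAt_mean_deriv ha hsub hw hlap hr
  refine gapOuter_unique hab (S.rminus_pos i) (hk i) hd1 hd2 ?_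
    (S.tendsto_mul_sphereMean hw hbv (s := Side.minus) nhdsWithin_le_nhds hΩb)
    (S.tendsto_sphereMean_add hw hbv hnd (s := Side.minus) nhdsWithin_le_nhds (S.rminus_pos i) hΩb)
  by_cases hi : i.val + 1 < N
  · set j : Fin N := ⟨i.val + 1, hi⟩ with hj
    have hbj : S.below i = S.rplus j := S.below_eq rfl
    have hΩa : ∀ᶠ r in 𝓝[>] S.rplus j, ∀ θ : UnitSphere, r • (θ : Space) ∈ S.host := by
      rw [← hbj]
      filter_upwards [Ioo_mem_nhdsGT hab] using hΩ
    have t1 := S.tendsto_mul_sphereMean hw hbv (i := j) (s := Side.plus) nhdsWithin_le_nhds hΩa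
    have t2 := S.tendsto_sphereMean_add hw hbv hnd (i := j) (s := Side.plus) nhdsWithin_le_nhds
      (S.rplus_pos j) hΩa
    have c1 : Tendsto (fun r => genTrig 1 (k ^ 2) (r - S.rplus j)) (𝓝[>] S.rplus j) (𝓝 0) := by
      have := (hasDerivAt_genTrig_shift 0 (k ^ 2) (S.rplus j) (S.rplus j)).continuousAt.tendsto
      rw [sub_self, genTrig_succ_zero_right] at this
      exact this.mono_left nhdsWithin_le_nhds
    have c0 : Tendsto (fun r => genTrig 0 (k ^ 2) (r - S.rplus j)) (𝓝[>] S.rplus j) (𝓝 1) := by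
      have := (hasDerivAt_genTrig_zero_shift (k ^ 2) (S.rplus j) (S.rplus j)).continuousAt.tendsto
      rw [sub_self, genTrig_zero_right] at this
      exact this.mono_left nhdsWithin_le_nhds
    have t3 := (t1.mul c0).sub (t2.mul c1)
    rw [mul_one, mul_zero, sub_zero] at t3
    rw [hbj, belowValue_eq f (i := j) rfl]
    exact t3
  -- In the innermost ball ψ is a multiple of `genTrig 1 (k ^ 2)` by the mean value property, so the
  -- Wronskian vanishes identically. This is what the default values 0 of `below` and `belowValue`
  -- encode.
  · have hb : S.below i = 0 := by simp [below, hi]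
    have hv : belowValue f i = 0 := by simp [belowValue, hi]
    rw [hb] at hd1 hd2 hab ⊢
    have hball := S.ball_subset_host hi
    have hψ : ∀ r ∈ Set.Ioo 0 (S.rminus i), (r : ℂ) * sphereMean w r
        = 4 * Real.pi * w 0 * genTrig 1 (k ^ 2) r := fun r hr =>
      mul_sphereMean_eq_of_ball (hw.mono hball) (fun x hx => hlap x (hball hx)) hr
    have hψ₁ : ∀ r ∈ Set.Ioo 0 (S.rminus i), sphereMean w r + (r : ℂ) * sphereMeanDeriv w r
        = 4 * Real.pi * w 0 * genTrig 0 (k ^ 2) r := by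
      intro r hr
      refine (hd1 r hr).unique (((hasDerivAt_genTrig_succ 0 (k ^ 2) r).const_mul
        (4 * Real.pi * w 0)).congr_of_eventuallyEq ?_)
      filter_upwards [isOpen_Ioo.mem_nhds hr] with y hy
      exact hψ y hy
    rw [hv, mul_zero, mul_zero]
    refine tendsto_const_nhds.congr' ?_
    filter_upwards [Ioo_mem_nhdsGT hab] with r hr
    rw [hψ r hr, hψ₁ r hr, sub_zero]
    ring

/-- The condition at infinity enters only as ψ' = ikψ for large r. This form covers both the
outgoing condition and, for k = 0, decay like 1/‖x‖. -/
lemma integral_normalDerivative_plus [NeZero N] (hk : S.Nonresonant k)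
    (hw : ContDiffOn ℝ 2 w S.host)
    (hlap : ∀ x ∈ S.host, Laplacian.laplacian w x + k ^ 2 * w x = 0)
    (hbv : S.HasBoundaryValues w f) (hnd : S.HasNormalDerivatives w q)
    (hext : ∀ᶠ r : ℝ in atTop, sphereMean w r + (r : ℂ) * sphereMeanDeriv w r
      = Complex.I * k * ((r : ℂ) * sphereMean w r)) (i : Fin N) :
    ∫ θ, q i Side.plus θ ∂surfaceMeasure = 4 * Real.pi * S.dtnMap k f i Side.plus := by
  have ha : 0 < S.rplus i := S.rplus_pos i
  by_cases hi : 0 < i.val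
  · set j : Fin N := ⟨i.val - 1, by omega⟩ with hj
    have hji : j.val + 1 = i.val := by simp only [hj]; omega
    have hab : S.rplus i < S.rminus j := S.nested j i (by rw [Fin.lt_def]; omega)
    have hsub : annulus (S.rplus i) (S.rminus j) ⊆ S.host := by
      have := S.annulus_below_subset_host j
      rwa [S.below_eq hji] at this
    have hΩ : ∀ r ∈ Set.Ioo (S.rplus i) (S.rminus j), ∀ θ : UnitSphere, r • (θ : Space) ∈ S.host :=
      fun r hr θ => hsub (smul_mem_annulus ha.le hr θ)
    have hΩb : ∀ᶠ r in 𝓝[<] S.rminus j, ∀ θ : UnitSphere, r • (θ : Space) ∈ S.host := by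
      filter_upwards [Ioo_mem_nhdsLT hab] using hΩ
    have hΩa : ∀ᶠ r in 𝓝[>] S.rplus i, ∀ θ : UnitSphere, r • (θ : Space) ∈ S.host := by
      filter_upwards [Ioo_mem_nhdsGT hab] using hΩ
    have hkj := hk j
    rw [S.below_eq hji] at hkj
    simp only [dtnMap, hi, dif_pos]
    exact gapInner_unique hab ha hkj
      (fun r hr => S.hasDerivAt_mean ha.le hsub hw hr)
      (fun r hr => S.hasDerivAt_mean_deriv ha.le hsub hw hlap hr)
      (S.tendsto_mul_sphereMean hw hbv (s := Side.plus) nhdsWithin_le_nhds hΩa)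
      (S.tendsto_sphereMean_add hw hbv hnd (s := Side.plus) nhdsWithin_le_nhds ha hΩa)
      (S.tendsto_mul_sphereMean hw hbv (i := j) (s := Side.minus) nhdsWithin_le_nhds hΩb)
      (S.tendsto_sphereMean_add hw hbv hnd (i := j) (s := Side.minus) nhdsWithin_le_nhds
        (S.rminus_pos j) hΩb)
  · have h0 : ((0 : Fin N) : ℕ) = 0 := by simp
    obtain rfl : i = 0 := Fin.ext (by omega)
    -- A single radius with ψ' = ikψ is enough: there the Wronskian with exp(ikr) is 0, and being
    -- constant it is 0 down to the outermost sphere.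
    obtain ⟨ρ, hρ⟩ := (hext.and (eventually_gt_atTop (S.rplus 0))).exists
    have hsub : annulus (S.rplus 0) (ρ + 1) ⊆ S.host := fun x hx => S.exterior_subset_host hx.1
    have hab : S.rplus 0 < ρ + 1 := by linarith [hρ.2]
    have hΩa : ∀ᶠ r in 𝓝[>] S.rplus 0, ∀ θ : UnitSphere, r • (θ : Space) ∈ S.host := by
      filter_upwards [Ioo_mem_nhdsGT hab] with r hr θ
      exact hsub (smul_mem_annulus ha.le hr θ)
    have hs : ∀ r : ℝ, HasDerivAt (fun r : ℝ => Complex.exp (Complex.I * k * r))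
        (Complex.I * k * Complex.exp (Complex.I * k * r)) r := by
      intro r
      have h := (((Complex.ofRealCLM.hasDerivAt (x := r)).const_mul (Complex.I * k))).cexp
      refine h.congr_deriv ?_
      simp
      ring
    have hs₁ : ∀ r : ℝ, HasDerivAt (fun r : ℝ => Complex.I * k * Complex.exp (Complex.I * k * r))
        (-k ^ 2 * Complex.exp (Complex.I * k * r)) r := by
      intro r
      refine ((hs r).const_mul (Complex.I * k)).congr_deriv ?_
      linear_combination k ^ 2 * Complex.exp (Complex.I * k * r) * Complex.I_sq
    obtain ⟨c, hc⟩ := exists_wronskian_eq (fun r hr => S.hasDerivAt_mean ha.le hsub hw hr)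
      (fun r hr => S.hasDerivAt_mean_deriv ha.le hsub hw hlap hr) hs hs₁
    have hc0 : c = 0 := by
      rw [← hc ρ ⟨hρ.2, by linarith⟩, hρ.1]
      ring
    have cs := (hs (S.rplus 0)).continuousAt.tendsto.mono_left
      (nhdsWithin_le_nhds (s := Set.Ioi (S.rplus 0)))
    have t1 := S.tendsto_mul_sphereMean hw hbv (i := 0) (s := Side.plus)
      (l := 𝓝[>] S.rplus 0) nhdsWithin_le_nhds hΩa
    have t2 := S.tendsto_sphereMean_add hw hbv hnd (i := 0) (s := Side.plus)
      (l := 𝓝[>] S.rplus 0) nhdsWithin_le_nhds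
      ha hΩa
    have key := tendsto_nhds_unique ((t1.mul (cs.const_mul (Complex.I * k))).sub (t2.mul cs))
      (tendsto_const_nhds.congr' (by
        filter_upwards [Ioo_mem_nhdsGT hab] with r hr
        exact ((hc r hr).trans hc0).symm))
    simp only [dtnMap, hi, dif_neg, not_false_eq_true]
    have hR : S.radius 0 Side.plus = S.rplus 0 := rfl
    rw [hR] at key
    have hac : (S.rplus 0 : ℂ) ≠ 0 := by exact_mod_cast ha.ne'
    have key2 : 4 * Real.pi * (S.rplus 0 * f 0 Side.plus) * (Complex.I * k)
        - (4 * Real.pi * f 0 Side.plus + S.rplus 0 * ∫ θ, q 0 Side.plus θ ∂surfaceMeasure) = 0 := by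
      refine (mul_eq_zero.1 ?_).resolve_right (Complex.exp_ne_zero (Complex.I * k * S.rplus 0))
      linear_combination key
    refine mul_left_cancel₀ hac ?_
    field_simp
    linear_combination -key2

end Limits

end NestedShells

/-! ### Spherical means of outgoing functions -/

lemma hasDerivAt_exp_wave (k : ℂ) (c : ℂ) (r₀ r : ℝ) :
    HasDerivAt (fun r : ℝ => c * Complex.exp (Complex.I * k * (r - r₀ : ℝ)))
      (Complex.I * k * (c * Complex.exp (Complex.I * k * (r - r₀ : ℝ)))) r := by
  have h0 : HasDerivAt (fun r : ℝ => ((r - r₀ : ℝ) : ℂ)) 1 r := by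
    simpa using ((hasDerivAt_id r).sub_const r₀).ofReal_comp
  have h := ((h0.const_mul (Complex.I * k)).cexp).const_mul c
  refine h.congr_deriv ?_
  ring

lemma contDiff_exp_wave (k : ℂ) (c : ℂ) (r₀ : ℝ) {n : WithTop ℕ∞} :
    ContDiff ℝ n (fun r : ℝ => c * Complex.exp (Complex.I * k * (r - r₀ : ℝ))) := by
  have h0 : ContDiff ℝ n (fun r : ℝ => ((r - r₀ : ℝ) : ℂ)) :=
    Complex.ofRealCLM.contDiff.comp (contDiff_id.sub contDiff_const)
  exact contDiff_const.mul (contDiff_const.mul h0).cexp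

lemma contDiffOn_div_ofReal {ψ : ℝ → ℂ} {n : WithTop ℕ∞} (hψ : ContDiffOn ℝ n ψ (Set.Ioi 0)) :
    ContDiffOn ℝ n (fun r : ℝ => ψ r / (r : ℂ)) (Set.Ioi 0) := by
  have hid : ContDiffOn ℝ n (fun r : ℝ => (r : ℂ)) (Set.Ioi 0) :=
    Complex.ofRealCLM.contDiff.contDiffOn
  simp only [div_eq_mul_inv]
  exact hψ.mul (hid.inv fun r hr => by exact_mod_cast (ne_of_gt hr))

lemma laplacian_radial_wave {ψ ψ₁ : ℝ → ℂ} {t : ℂ} (hψ : ContDiff ℝ 2 ψ)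
    (h1 : ∀ r, HasDerivAt ψ (ψ₁ r) r) (h2 : ∀ r, HasDerivAt ψ₁ (-t * ψ r) r) {x c : Space}
    (h : x ≠ c) :
    Laplacian.laplacian (fun y : Space => ψ ‖y - c‖ / (‖y - c‖ : ℂ)) x
      + t * (ψ ‖x - c‖ / (‖x - c‖ : ℂ)) = 0 := by
  rw [laplacian_radial_div h hψ.contDiffOn (fun r _ => h1 r) (h2 _)]
  ring

lemma outgoingGreen_eq (k : ℂ) (x : Space) :
    outgoingGreen k x
      = -1 / (4 * Real.pi) * Complex.exp (Complex.I * k * ((‖x‖ - 0 : ℝ) : ℂ)) / (‖x‖ : ℂ) := by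
  unfold outgoingGreen
  rw [sub_zero]
  field_simp

/-- Both squared distances are r² + τ² - 2rτ⟨θ, e⟩. This lets source point and observation point
exchange their radii. -/
lemma norm_smul_sub_smul_comm (r τ : ℝ) (θ e : UnitSphere) :
    ‖r • (θ : Space) - τ • (e : Space)‖ = ‖r • (e : Space) - τ • (θ : Space)‖ := by
  rw [← sq_eq_sq₀ (norm_nonneg _) (norm_nonneg _), norm_sub_sq_real, norm_sub_sq_real]
  simp only [norm_smul, norm_unitSphere, inner_smul_left, inner_smul_right]
  rw [real_inner_comm]

/-- After the exchange of radii the integral runs over the sphere of radius ‖y‖, and the pole sits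
at distance r from the origin. The integrand is then a regular Helmholtz solution in the ball of
radius r, to which the mean value property applies. -/
lemma integral_outgoingGreen (k : ℂ) {r : ℝ} {y : Space} (hy : ‖y‖ < r) :
    ∫ θ : UnitSphere, outgoingGreen k (r • (θ : Space) - y) ∂surfaceMeasure
      = 4 * Real.pi * (-1 / (4 * Real.pi) * Complex.exp (Complex.I * k * r) / r)
        * trigSeries 1 (k ^ 2 * (‖y‖ : ℂ) ^ 2) := by
  have hr : 0 < r := (norm_nonneg y).trans_lt hy
  by_cases hy0 : y = 0
  · subst hy0
    have : ∀ θ : UnitSphere, outgoingGreen k (r • (θ : Space) - 0)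
        = -1 / (4 * Real.pi) * Complex.exp (Complex.I * k * r) / r := by
      intro θ
      rw [sub_zero, outgoingGreen_eq, norm_smul_unitSphere hr.le, sub_zero]
    simp only [this]
    rw [integral_surfaceMeasure_const]
    simp [trigSeries_zero]
  · have hτ : 0 < ‖y‖ := norm_pos_iff.2 hy0
    have hτc : (‖y‖ : ℂ) ≠ 0 := by exact_mod_cast hτ.ne'
    set e : UnitSphere := ⟨‖y‖⁻¹ • y, by simp [norm_smul, hτ.ne']⟩ with he
    have hye : y = ‖y‖ • (e : Space) := by
      simp [he, smul_smul, hτ.ne']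
    have e1 : ∀ θ : UnitSphere, outgoingGreen k (r • (θ : Space) - y)
        = outgoingGreen k (‖y‖ • (θ : Space) - r • (e : Space)) := by
      intro θ
      have : ‖r • (θ : Space) - y‖ = ‖‖y‖ • (θ : Space) - r • (e : Space)‖ := by
        conv_lhs => rw [hye]
        rw [norm_smul_sub_smul_comm, norm_sub_rev]
      unfold outgoingGreen
      rw [this]
    have hne : ∀ x ∈ Metric.ball (0 : Space) r, x ≠ r • (e : Space) := by
      rintro x hx rfl
      have : ‖r • (e : Space)‖ < r := by simpa using hx
      rw [norm_smul_unitSphere hr.le] at this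
      exact lt_irrefl _ this
    have hfun : (fun x : Space => outgoingGreen k (x - r • (e : Space)))
        = fun x => (fun s : ℝ => -1 / (4 * Real.pi) * Complex.exp (Complex.I * k * ((s - 0 : ℝ) : ℂ)))
          ‖x - r • (e : Space)‖ / (‖x - r • (e : Space)‖ : ℂ) := by
      funext x
      rw [outgoingGreen_eq]
    have h1 := hasDerivAt_exp_wave k (-1 / (4 * Real.pi)) 0
    have h2 : ∀ s : ℝ, HasDerivAt (fun s : ℝ => Complex.I * k * (-1 / (4 * Real.pi)
        * Complex.exp (Complex.I * k * ((s - 0 : ℝ) : ℂ))))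
        (-k ^ 2 * (-1 / (4 * Real.pi) * Complex.exp (Complex.I * k * ((s - 0 : ℝ) : ℂ)))) s := by
      intro s
      refine ((h1 s).const_mul (Complex.I * k)).congr_deriv ?_
      linear_combination k ^ 2 * (-1 / (4 * Real.pi)
        * Complex.exp (Complex.I * k * ((s - 0 : ℝ) : ℂ))) * Complex.I_sq
    have key := mul_sphereMean_eq_of_ball (b := r) (t := k ^ 2)
      (w := fun x => outgoingGreen k (x - r • (e : Space))) (r := ‖y‖) ?_ ?_ ⟨hτ, hy⟩
    · simp only [sphereMean] at key
      simp only [e1]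
      refine mul_left_cancel₀ hτc ?_
      rw [key, genTrig, outgoingGreen_eq, zero_sub, norm_neg, norm_smul_unitSphere hr.le, sub_zero]
      ring
    · rw [hfun]
      intro x hx
      exact (contDiffAt_radial (contDiffOn_div_ofReal (contDiff_exp_wave k _ 0).contDiffOn)
        (hne x hx)).contDiffWithinAt
    · intro x hx
      rw [hfun, outgoingGreen_eq]
      exact laplacian_radial_wave (contDiff_exp_wave k _ 0) h1 h2 (hne x hx)

lemma measurable_outgoingGreen (k : ℂ) : Measurable (outgoingGreen k) := by
  unfold outgoingGreen
  fun_prop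

lemma norm_outgoingGreen_le (k : ℂ) {x : Space} {a b : ℝ} (ha : 0 < a) (h1 : a ≤ ‖x‖)
    (h2 : ‖x‖ ≤ b) : ‖outgoingGreen k x‖ ≤ Real.exp (‖k‖ * b) / (4 * Real.pi * a) := by
  have hn : ‖(4 * Real.pi * (‖x‖ : ℂ))‖ = 4 * Real.pi * ‖x‖ := by
    simp [abs_of_pos Real.pi_pos]
  unfold outgoingGreen
  rw [norm_div, norm_neg, hn]
  have hexp : ‖Complex.exp (Complex.I * k * (‖x‖ : ℂ))‖ ≤ Real.exp (‖k‖ * b) := by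
    refine (Complex.norm_exp_le_exp_norm _).trans (Real.exp_le_exp.2 ?_)
    rw [norm_mul, norm_mul, Complex.norm_I, one_mul, Complex.norm_real, norm_norm]
    gcongr
  have := Real.pi_pos
  gcongr

/-- By Fubini the spherical mean of the potential is the superposition of the means of the kernels,
and all of these are multiples of exp(ikr)/r. No sign of Im k is involved. -/
lemma exists_mul_sphereMean_of_isOutgoing {k : ℂ} {w : Space → ℂ} (h : IsOutgoing k w) :
    ∃ c : ℂ, ∃ ρ : ℝ, ∀ r, ρ < r → (r : ℂ) * sphereMean w r = c * Complex.exp (Complex.I * k * r) := by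
  obtain ⟨ρ, μ, g, hμ, hg, hsupp, hw⟩ := h
  refine ⟨-∫ y, trigSeries 1 (k ^ 2 * (‖y‖ : ℂ) ^ 2) * g y ∂μ, max ρ 0, fun r hr => ?_⟩
  have hρr : ρ < r := (le_max_left _ _).trans_lt hr
  have hr0 : 0 < r := (le_max_right _ _).trans_lt hr
  have hrc : (r : ℂ) ≠ 0 := by exact_mod_cast hr0.ne'
  have hae : ∀ᵐ y ∂μ, ‖y‖ ≤ ρ := by
    rw [ae_iff]
    convert hsupp using 2
    ext y
    simp
  have e1 : sphereMean w r = ∫ θ : UnitSphere, ∫ y, outgoingGreen k (r • (θ : Space) - y) * g y ∂μ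
      ∂surfaceMeasure := by
    unfold sphereMean
    congr 1
    funext θ
    exact hw _ (by rw [norm_smul_unitSphere hr0.le]; exact hρr)
  have hint : Integrable (Function.uncurry fun (θ : UnitSphere) (y : Space) =>
      outgoingGreen k (r • (θ : Space) - y) * g y) (surfaceMeasure.prod μ) := by
    have h1 : Integrable (fun z : UnitSphere × Space => g z.2) (surfaceMeasure.prod μ) :=
      hg.comp_snd _
    -- On the support of the source the distance to a point of the sphere lies between r - ρ and r +
    -- ρ, so the kernel is bounded.
    refine h1.bdd_mul (c := Real.exp (‖k‖ * (r + ρ)) / (4 * Real.pi * (r - ρ)))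
      (f := fun z : UnitSphere × Space => outgoingGreen k (r • (z.1 : Space) - z.2)) ?_ ?_
    · exact ((measurable_outgoingGreen k).comp (by fun_prop)).aestronglyMeasurable
    · have := (Measure.quasiMeasurePreserving_snd (μ := surfaceMeasure) (ν := μ)).ae hae
      filter_upwards [this] with z hz
      have hn := norm_smul_unitSphere hr0.le z.1
      refine norm_outgoingGreen_le k (by linarith) ?_ ?_
      · have := norm_sub_norm_le (r • (z.1 : Space)) z.2
        rw [hn] at this
        linarith
      · have := norm_sub_le (r • (z.1 : Space)) z.2
        rw [hn] at this
        linarith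
  rw [e1, integral_integral_swap hint]
  have e2 : ∫ y, ∫ θ : UnitSphere, outgoingGreen k (r • (θ : Space) - y) * g y ∂surfaceMeasure ∂μ
      = ∫ y, (4 * Real.pi * (-1 / (4 * Real.pi) * Complex.exp (Complex.I * k * r) / r))
        * (trigSeries 1 (k ^ 2 * (‖y‖ : ℂ) ^ 2) * g y) ∂μ := by
    refine integral_congr_ae ?_
    filter_upwards [hae] with y hy
    rw [integral_mul_const, integral_outgoingGreen k (hy.trans_lt hρr)]
    ring
  rw [e2, integral_const_mul]
  have : (Real.pi : ℂ) ≠ 0 := by exact_mod_cast Real.pi_ne_zero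
  field_simp

lemma NestedShells.eventually_sphereMean_of_isOutgoing {N : ℕ} [NeZero N] (S : NestedShells N)
    {k : ℂ} {w : Space → ℂ} (hw : ContDiffOn ℝ 2 w S.host) (h : IsOutgoing k w) :
    ∀ᶠ r : ℝ in atTop, sphereMean w r + (r : ℂ) * sphereMeanDeriv w r
      = Complex.I * k * ((r : ℂ) * sphereMean w r) := by
  obtain ⟨c, ρ, hc⟩ := exists_mul_sphereMean_of_isOutgoing h
  filter_upwards [eventually_gt_atTop ρ, eventually_gt_atTop (S.rplus 0)] with r h1 h2
  have hd := S.hasDerivAt_mean (S.rplus_pos 0).le (b := r + 1)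
    (fun x hx => S.exterior_subset_host hx.1) hw (r := r) ⟨h2, by linarith⟩
  rw [hc r h1]
  have he := hasDerivAt_exp_wave k c 0 r
  simp only [sub_zero] at he
  refine hd.unique (he.congr_of_eventuallyEq ?_)
  filter_upwards [isOpen_Ioi.mem_nhds h1] with y hy
  exact hc y hy

/-! ### The Dirichlet-to-Neumann map: existence -/

/-- `r` times the radial solution of the Helmholtz equation in the gap `(a, b)`. -/
def gapProfile (t : ℂ) (a b : ℝ) (fa fb : ℂ) (r : ℝ) : ℂ :=
  (b * fb * genTrig 1 t (r - a) - a * fa * genTrig 1 t (r - b)) / genTrig 1 t (b - a)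

/-- The derivative of `gapProfile`. -/
def gapProfileDeriv (t : ℂ) (a b : ℝ) (fa fb : ℂ) (r : ℝ) : ℂ :=
  (b * fb * genTrig 0 t (r - a) - a * fa * genTrig 0 t (r - b)) / genTrig 1 t (b - a)

section GapProfile

variable (t : ℂ) (a b : ℝ) (fa fb : ℂ)

lemma hasDerivAt_gapProfile (r : ℝ) :
    HasDerivAt (gapProfile t a b fa fb) (gapProfileDeriv t a b fa fb r) r :=
  (((hasDerivAt_genTrig_shift 0 t a r).const_mul _).sub
    ((hasDerivAt_genTrig_shift 0 t b r).const_mul _)).div_const _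

lemma hasDerivAt_gapProfileDeriv (r : ℝ) :
    HasDerivAt (gapProfileDeriv t a b fa fb) (-t * gapProfile t a b fa fb r) r := by
  refine ((((hasDerivAt_genTrig_zero_shift t a r).const_mul _).sub
    ((hasDerivAt_genTrig_zero_shift t b r).const_mul _)).div_const _).congr_deriv ?_
  unfold gapProfile
  ring

lemma contDiff_gapProfile {n : WithTop ℕ∞} : ContDiff ℝ n (gapProfile t a b fa fb) := by
  have h : ∀ c : ℝ, ContDiff ℝ n fun r : ℝ => genTrig 1 t (r - c) := fun c =>
    (contDiff_genTrig_right 1 t).comp (contDiff_id.sub contDiff_const)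
  exact ((contDiff_const.mul (h a)).sub (contDiff_const.mul (h b))).div_const _

variable {t a b}

lemma genTrig_one_sub_comm : genTrig 1 t (a - b) = -genTrig 1 t (b - a) := by
  rw [← neg_sub]; simp only [genTrig]; push_cast; ring_nf

lemma genTrig_zero_sub_comm : genTrig 0 t (a - b) = genTrig 0 t (b - a) := by
  rw [← neg_sub]; simp only [genTrig]; push_cast; ring_nf

lemma gapProfile_outer (h : genTrig 1 t (b - a) ≠ 0) : gapProfile t a b fa fb b = b * fb := by
  unfold gapProfile
  rw [sub_self, genTrig_succ_zero_right]
  field_simp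
  ring

lemma gapProfile_inner (h : genTrig 1 t (b - a) ≠ 0) : gapProfile t a b fa fb a = a * fa := by
  unfold gapProfile
  rw [sub_self, genTrig_succ_zero_right, genTrig_one_sub_comm]
  field_simp
  ring

lemma gapProfileDeriv_outer :
    gapProfileDeriv t a b fa fb b = (b * fb * genTrig 0 t (b - a) - a * fa) / genTrig 1 t (b - a) := by
  unfold gapProfileDeriv
  rw [sub_self, genTrig_zero_right, mul_one]

lemma gapProfileDeriv_inner :
    gapProfileDeriv t a b fa fb a = (b * fb - a * fa * genTrig 0 t (b - a)) / genTrig 1 t (b - a) := by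
  unfold gapProfileDeriv
  rw [sub_self, genTrig_zero_right, mul_one, genTrig_zero_sub_comm]

end GapProfile

/-! ### The regular solution in the innermost ball -/

lemma contDiff_trigSeries_norm_sq (t : ℂ) {n : WithTop ℕ∞} :
    ContDiff ℝ n fun x : Space => trigSeries 1 (t * (‖x‖ : ℂ) ^ 2) := by
  have h : ContDiff ℝ n (trigSeries 1) := (contDiff_trigSeries 1).restrict_scalars ℝ
  have h2 : ContDiff ℝ n fun x : Space => ((‖x‖ ^ 2 : ℝ) : ℂ) :=
    Complex.ofRealCLM.contDiff.comp (contDiff_norm_sq ℝ)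
  push_cast at h2
  exact h.comp (contDiff_const.mul h2)

lemma continuous_laplacian {w : Space → ℂ} (hw : ContDiff ℝ 2 w) :
    Continuous (Laplacian.laplacian w) := by
  have e : Laplacian.laplacian w = fun x => ∑ k : Fin 3,
      fderiv ℝ (fun y => fderiv ℝ w y (EuclideanSpace.single k 1)) x (EuclideanSpace.single k 1) :=
    funext fun x => laplacian_eq_sum hw.contDiffAt
  rw [e]
  refine continuous_finsetSum _ fun k _ => ?_
  have h1 : ContDiff ℝ 1 fun y => fderiv ℝ w y (EuclideanSpace.single k 1) :=
    (hw.fderiv_right (by norm_num)).clm_apply contDiff_const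
  exact (h1.continuous_fderiv one_ne_zero).clm_apply continuous_const

/-- Away from the origin the function is sin(kr)/(kr) with k² = t, a radial wave. Both sides are
continuous, so density of the punctured space gives the equation at the origin. -/
lemma laplacian_trigSeries_norm_sq (t : ℂ) (x : Space) :
    Laplacian.laplacian (fun x : Space => trigSeries 1 (t * (‖x‖ : ℂ) ^ 2)) x
      + t * trigSeries 1 (t * (‖x‖ : ℂ) ^ 2) = 0 := by
  have hw : ContDiff ℝ 2 fun x : Space => trigSeries 1 (t * (‖x‖ : ℂ) ^ 2) :=
    contDiff_trigSeries_norm_sq t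
  have hcont : Continuous fun x : Space =>
      Laplacian.laplacian (fun x : Space => trigSeries 1 (t * (‖x‖ : ℂ) ^ 2)) x
        + t * trigSeries 1 (t * (‖x‖ : ℂ) ^ 2) :=
    (continuous_laplacian hw).add (continuous_const.mul hw.continuous)
  have hdense : Dense ({0}ᶜ : Set Space) := dense_compl_singleton 0
  have heq : Set.EqOn (fun x : Space =>
      Laplacian.laplacian (fun x : Space => trigSeries 1 (t * (‖x‖ : ℂ) ^ 2)) x
        + t * trigSeries 1 (t * (‖x‖ : ℂ) ^ 2)) (fun _ => 0) ({0}ᶜ : Set Space) := by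
    intro x hx
    have hx0 : x ≠ 0 := hx
    have key := laplacian_radial_wave (c := 0) (contDiff_genTrig_right 1 t)
      (hasDerivAt_genTrig_succ 0 t) (hasDerivAt_genTrig_zero t) hx0
    have e : ∀ y : Space, y ≠ 0 → genTrig 1 t ‖y - 0‖ / (‖y - 0‖ : ℂ)
        = trigSeries 1 (t * (‖y‖ : ℂ) ^ 2) := by
      intro y hy
      have : (‖y‖ : ℂ) ≠ 0 := by exact_mod_cast norm_ne_zero_iff.2 hy
      rw [sub_zero, genTrig]
      field_simp
    have hev : (fun y : Space => genTrig 1 t ‖y - 0‖ / (‖y - 0‖ : ℂ)) =ᶠ[𝓝 x]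
        fun y : Space => trigSeries 1 (t * (‖y‖ : ℂ) ^ 2) := by
      filter_upwards [isOpen_ne.mem_nhds hx0] with y hy
      exact e y hy
    rw [(InnerProductSpace.laplacian_congr_nhds hev).self_of_nhds, e x hx0] at key
    exact key
  exact congrFun (hcont.ext_on hdense continuous_const heq) x

namespace NestedShells

variable {N : ℕ} (S : NestedShells N)

/-! ### Gluing the explicit solutions over the components of the host region -/

/-- The connected components of the host region. -/
def region [NeZero N] : Option (Fin N) → Set Space
  | none => {x | S.rplus 0 < ‖x‖}
  | some i => if i.val + 1 < N then annulus (S.below i) (S.rminus i) else Metric.ball 0 (S.rminus i)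

/-- The solution of the exterior Dirichlet problem in a component of the host region. -/
def regionFun [NeZero N] (k : ℂ) (f : Fin N → Side → ℂ) : Option (Fin N) → Space → ℂ
  | none => fun x => (S.rplus 0 * f 0 Side.plus
      * Complex.exp (Complex.I * k * (‖x‖ - S.rplus 0 : ℝ))) / (‖x‖ : ℂ)
  | some i => if i.val + 1 < N then fun x =>
        gapProfile (k ^ 2) (S.below i) (S.rminus i) (belowValue f i) (f i Side.minus) ‖x‖ / (‖x‖ : ℂ)
      else fun x => S.rminus i * f i Side.minus / genTrig 1 (k ^ 2) (S.rminus i)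
        * trigSeries 1 (k ^ 2 * (‖x‖ : ℂ) ^ 2)

variable [NeZero N]

lemma isOpen_region (o : Option (Fin N)) : IsOpen (S.region o) := by
  cases o with
  | none => exact isOpen_lt continuous_const continuous_norm
  | some i =>
    simp only [region]
    split_ifs
    · exact isOpen_annulus _ _
    · exact Metric.isOpen_ball

lemma mem_region_some {i : Fin N} {x : Space} : x ∈ S.region (some i) ↔
    ‖x‖ < S.rminus i ∧ ∀ j, i < j → S.rplus j < ‖x‖ := by
  simp only [region]
  split_ifs with h
  · constructor
    · rintro ⟨h1, h2⟩
      refine ⟨h2, fun j hj => lt_of_le_of_lt (S.rplus_le ?_) (S.below_eq (i := ⟨i.val + 1, h⟩) rfl ▸ h1)⟩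
      rw [Fin.le_def]
      exact hj
    · rintro ⟨h1, h2⟩
      refine ⟨?_, h1⟩
      rw [S.below_eq (i := ⟨i.val + 1, h⟩) rfl]
      exact h2 _ (by rw [Fin.lt_def]; simp)
  · rw [mem_ball_zero_iff]
    refine ⟨fun h1 => ⟨h1, fun j hj => ?_⟩, fun h1 => h1.1⟩
    rw [Fin.lt_def] at hj
    have := j.2
    omega

lemma exists_mem_region {x : Space} (hx : x ∈ S.host) : ∃ o, x ∈ S.region o := by
  by_cases h : ∃ i, ‖x‖ < S.rminus i
  · set s : Finset (Fin N) := Finset.univ.filter fun i => ‖x‖ < S.rminus i with hs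
    have hne : s.Nonempty := by
      obtain ⟨i, hi⟩ := h
      exact ⟨i, by simp [hs, hi]⟩
    -- The component is indexed by the innermost shell that still encloses x; by maximality x lies
    -- outside all later shells.
    refine ⟨some (s.max' hne), S.mem_region_some.2 ⟨?_, fun j hj => ?_⟩⟩
    · have := s.max'_mem hne
      simpa [hs] using this
    · refine (hx j).resolve_left fun hlt => ?_
      have : j ≤ s.max' hne := s.le_max' j (by simp [hs, hlt])
      exact absurd hj (not_lt.2 this)
  · push Not at h
    exact ⟨none, (hx 0).resolve_left (not_lt.2 (h 0))⟩

lemma region_disjoint {o o' : Option (Fin N)} {x : Space} (h : x ∈ S.region o)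
    (h' : x ∈ S.region o') : o = o' := by
  have key : ∀ i, x ∈ S.region none → x ∈ S.region (some i) → False := by
    intro i h1 h2
    have h3 := (S.mem_region_some.1 h2).1
    have h4 : S.rplus 0 < ‖x‖ := h1
    have := S.rminus_le (Fin.zero_le i)
    linarith [S.rminus_lt_rplus 0]
  have key2 : ∀ i j, x ∈ S.region (some i) → x ∈ S.region (some j) → i < j → False := by
    intro i j h1 h2 hij
    have h3 := (S.mem_region_some.1 h1).2 j hij
    have h4 := (S.mem_region_some.1 h2).1
    linarith [S.rminus_lt_rplus j]
  cases o with
  | none =>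
    cases o' with
    | none => rfl
    | some j => exact (key j h h').elim
  | some i =>
    cases o' with
    | none => exact (key i h' h).elim
    | some j =>
      rcases lt_trichotomy i j with hij | hij | hij
      · exact (key2 i j h h' hij).elim
      · rw [hij]
      · exact (key2 j i h' h hij).elim

open Classical in
/-- The solution of the exterior Dirichlet problem. -/
def hostFun (k : ℂ) (f : Fin N → Side → ℂ) (x : Space) : ℂ :=
  if h : ∃ o, x ∈ S.region o then S.regionFun k f h.choose x else 0

variable {k : ℂ} {f : Fin N → Side → ℂ}

lemma hostFun_eq {o : Option (Fin N)} {x : Space} (hx : x ∈ S.region o) :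
    S.hostFun k f x = S.regionFun k f o x := by
  have h : ∃ o, x ∈ S.region o := ⟨o, hx⟩
  unfold hostFun
  rw [dif_pos h, S.region_disjoint h.choose_spec hx]

lemma hostFun_eventuallyEq {o : Option (Fin N)} {x : Space} (hx : x ∈ S.region o) :
    S.hostFun k f =ᶠ[𝓝 x] S.regionFun k f o := by
  filter_upwards [(S.isOpen_region o).mem_nhds hx] with y hy
  exact S.hostFun_eq hy

lemma hasDerivAt_wave_deriv (k c : ℂ) (r₀ r : ℝ) :
    HasDerivAt (fun r : ℝ => Complex.I * k * (c * Complex.exp (Complex.I * k * (r - r₀ : ℝ))))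
      (-k ^ 2 * (c * Complex.exp (Complex.I * k * (r - r₀ : ℝ)))) r := by
  refine ((hasDerivAt_exp_wave k c r₀ r).const_mul (Complex.I * k)).congr_deriv ?_
  linear_combination k ^ 2 * (c * Complex.exp (Complex.I * k * (r - r₀ : ℝ))) * Complex.I_sq

lemma regionFun_solution {o : Option (Fin N)} {x : Space} (hx : x ∈ S.region o) :
    ContDiffAt ℝ 2 (S.regionFun k f o) x ∧
      Laplacian.laplacian (S.regionFun k f o) x + k ^ 2 * S.regionFun k f o x = 0 := by
  have radial : ∀ {ψ ψ₁ : ℝ → ℂ}, ContDiff ℝ 2 ψ → (∀ r, HasDerivAt ψ (ψ₁ r) r) →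
      (∀ r, HasDerivAt ψ₁ (-k ^ 2 * ψ r) r) → x ≠ 0 →
      ContDiffAt ℝ 2 (fun y : Space => ψ ‖y‖ / (‖y‖ : ℂ)) x ∧
      Laplacian.laplacian (fun y : Space => ψ ‖y‖ / (‖y‖ : ℂ)) x
        + k ^ 2 * (ψ ‖x‖ / (‖x‖ : ℂ)) = 0 := by
    intro ψ ψ₁ h0 h1 h2 hx0
    have e1 := contDiffAt_radial (contDiffOn_div_ofReal h0.contDiffOn) (c := 0) hx0
    have e2 := laplacian_radial_wave (t := k ^ 2) h0 h1 (by simpa using h2) (c := 0) hx0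
    simp only [sub_zero] at e1 e2
    exact ⟨e1, e2⟩
  cases o with
  | none =>
    have hx0 : x ≠ 0 := norm_pos_iff.1 ((S.rplus_pos 0).trans hx)
    exact radial (contDiff_exp_wave k _ _) (hasDerivAt_exp_wave k _ _)
      (hasDerivAt_wave_deriv k _ _) hx0
  | some i =>
    by_cases hi : i.val + 1 < N
    · have hxa : x ∈ annulus (S.below i) (S.rminus i) := by simpa [region, hi] using hx
      have hx0 : x ≠ 0 := norm_pos_iff.1 ((S.below_nonneg i).trans_lt hxa.1)
      simp only [regionFun, hi, if_true]
      exact radial (contDiff_gapProfile _ _ _ _ _) (hasDerivAt_gapProfile _ _ _ _ _)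
        (hasDerivAt_gapProfileDeriv _ _ _ _ _) hx0
    · simp only [regionFun, hi, if_false]
      have hc : ContDiffAt ℝ 2 (fun x : Space => trigSeries 1 (k ^ 2 * (‖x‖ : ℂ) ^ 2)) x :=
        (contDiff_trigSeries_norm_sq _).contDiffAt
      refine ⟨contDiffAt_const.mul hc, ?_⟩
      set A : ℂ := S.rminus i * f i Side.minus / genTrig 1 (k ^ 2) (S.rminus i)
      have := InnerProductSpace.laplacian_smul (𝕜 := ℂ) A hc
      have e : (A • fun x : Space => trigSeries 1 (k ^ 2 * (‖x‖ : ℂ) ^ 2))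
          = fun x : Space => A * trigSeries 1 (k ^ 2 * (‖x‖ : ℂ) ^ 2) := by
        funext y
        simp
      rw [e] at this
      rw [this, smul_eq_mul]
      linear_combination A * laplacian_trigSeries_norm_sq (k ^ 2) x

lemma tendsto_hostFun {o : Option (Fin N)} {R : ℝ} (hR : 0 < R) {θ : UnitSphere}
    (hev : ∀ᶠ x in 𝓝[S.host] (R • (θ : Space)), x ∈ S.region o) {ψ ψ₁ : ℝ → ℂ}
    (hψ : ∀ r, HasDerivAt ψ (ψ₁ r) r) (hψ₁ : Continuous ψ₁)
    (hfun : ∀ x : Space, x ≠ 0 → S.regionFun k f o x = ψ ‖x‖ / (‖x‖ : ℂ)) :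
    Tendsto (S.hostFun k f) (𝓝[S.host] (R • (θ : Space))) (𝓝 (ψ R / R)) ∧
    Tendsto (fun x => fderiv ℝ (S.hostFun k f) x (‖x‖⁻¹ • x)) (𝓝[S.host] (R • (θ : Space)))
      (𝓝 ((ψ₁ R - ψ R / R) / R)) := by
  have hn : ‖R • (θ : Space)‖ = R := norm_smul_unitSphere hR.le θ
  have hRc : (R : ℂ) ≠ 0 := by exact_mod_cast hR.ne'
  have hnorm : Tendsto (fun x : Space => ‖x‖) (𝓝[S.host] (R • (θ : Space))) (𝓝 R) := by
    have := (continuous_norm.tendsto (R • (θ : Space))).mono_left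
      (nhdsWithin_le_nhds (s := S.host))
    rwa [hn] at this
  have hpos : ∀ᶠ x in 𝓝[S.host] (R • (θ : Space)), x ≠ 0 := by
    filter_upwards [hnorm.eventually (lt_mem_nhds hR)] with x hx
    exact norm_pos_iff.1 hx
  have hcast : Tendsto (fun x : Space => (‖x‖ : ℂ)) (𝓝[S.host] (R • (θ : Space))) (𝓝 (R : ℂ)) :=
    (Complex.continuous_ofReal.tendsto R).comp hnorm
  have t1 : Tendsto (fun x : Space => ψ ‖x‖) (𝓝[S.host] (R • (θ : Space))) (𝓝 (ψ R)) :=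
    (hψ R).continuousAt.tendsto.comp hnorm
  have t2 : Tendsto (fun x : Space => ψ₁ ‖x‖) (𝓝[S.host] (R • (θ : Space))) (𝓝 (ψ₁ R)) :=
    (hψ₁.tendsto R).comp hnorm
  constructor
  · refine (t1.div hcast hRc).congr' ?_
    filter_upwards [hev, hpos] with x hx hx0
    rw [S.hostFun_eq hx, hfun x hx0]
    rfl
  · refine ((t2.sub (t1.div hcast hRc)).div hcast hRc).congr' ?_
    filter_upwards [hev, hpos] with x hx hx0
    have hx1 : 0 < ‖x‖ := norm_pos_iff.2 hx0
    have hxc : (‖x‖ : ℂ) ≠ 0 := by exact_mod_cast hx1.ne'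
    have he : S.hostFun k f =ᶠ[𝓝 x] fun y : Space => (fun r : ℝ => ψ r / (r : ℂ)) ‖y‖ := by
      filter_upwards [S.hostFun_eventuallyEq hx, isOpen_ne.mem_nhds hx0] with y hy hy0
      rw [hy, hfun y hy0]
    rw [he.fderiv_eq, fderiv_radial_self hx0 (hasDerivAt_div_ofReal hx1 (hψ _))]
    simp only [Pi.div_apply]
    field_simp

lemma hostFun_boundary (hk : S.Nonresonant k) (i : Fin N) (s : Side) (θ : UnitSphere) :
    Tendsto (S.hostFun k f) (𝓝[S.host] (S.radius i s • (θ : Space))) (𝓝 (f i s)) ∧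
    Tendsto (fun x => fderiv ℝ (S.hostFun k f) x (‖x‖⁻¹ • x))
      (𝓝[S.host] (S.radius i s • (θ : Space))) (𝓝 (S.dtnMap k f i s)) := by
  -- The ball is a degenerate gap with inner radius 0 and inner value 0, so away from the origin one
  -- formula serves both cases.
  have hgap : ∀ j : Fin N, ∀ x : Space, x ≠ 0 → S.regionFun k f (some j) x
      = gapProfile (k ^ 2) (S.below j) (S.rminus j) (belowValue f j) (f j Side.minus) ‖x‖
        / (‖x‖ : ℂ) := by
    intro j x hx
    have hxc : (‖x‖ : ℂ) ≠ 0 := by exact_mod_cast norm_ne_zero_iff.2 hx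
    by_cases hj : j.val + 1 < N
    · simp [regionFun, hj]
    · have hb : S.below j = 0 := by simp [below, hj]
      have := hk j
      rw [hb, sub_zero] at this
      simp only [regionFun, hj, if_false, gapProfile, hb, sub_zero]
      rw [genTrig.eq_def 1 (k ^ 2) ‖x‖]
      simp
      field_simp
  have hreg : ∀ j : Fin N, annulus (S.below j) (S.rminus j) ⊆ S.region (some j) := by
    intro j x hx
    simp only [region]
    split_ifs
    · exact hx
    · simpa using hx.2
  have hcont : ∀ t a b fa fb, Continuous (gapProfileDeriv t a b fa fb) := fun t a b fa fb =>
    continuous_iff_continuousAt.2 fun r => (hasDerivAt_gapProfileDeriv t a b fa fb r).continuousAt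
  cases s with
  | minus =>
    have hb := S.rminus_pos i
    have hbc : (S.rminus i : ℂ) ≠ 0 := by exact_mod_cast hb.ne'
    have := S.tendsto_hostFun (k := k) (f := f) hb
      ((S.eventually_minus i θ).mono fun x hx => hreg i hx)
      (hasDerivAt_gapProfile _ _ _ _ _) (hcont _ _ _ _ _) (hgap i)
    rw [gapProfile_outer _ _ (hk i), gapProfileDeriv_outer, mul_div_cancel_left₀ _ hbc] at this
    exact this
  | plus =>
    have ha := S.rplus_pos i
    have hac : (S.rplus i : ℂ) ≠ 0 := by exact_mod_cast ha.ne'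
    by_cases hi : 0 < i.val
    · set j : Fin N := ⟨i.val - 1, by omega⟩ with hj
      have hji : j.val + 1 = i.val := by simp only [hj]; omega
      have hkj := hk j
      have hrj := hreg j
      have hgj := hgap j
      rw [S.below_eq hji] at hkj hrj hgj
      rw [belowValue_eq f hji] at hgj
      have := S.tendsto_hostFun (k := k) (f := f) ha
        ((S.eventually_plus_succ hji θ).mono fun x hx => hrj hx)
        (hasDerivAt_gapProfile _ _ _ _ _) (hcont _ _ _ _ _) hgj
      rw [gapProfile_inner _ _ hkj, gapProfileDeriv_inner, mul_div_cancel_left₀ _ hac] at this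
      simp only [dtnMap, hi, dif_pos]
      exact this
    · have h0 : ((0 : Fin N) : ℕ) = 0 := by simp
      obtain rfl : i = 0 := Fin.ext (by omega)
      have := S.tendsto_hostFun (k := k) (f := f) (o := none) ha (S.eventually_plus_zero θ)
        (hasDerivAt_exp_wave k (S.rplus 0 * f 0 Side.plus) (S.rplus 0))
        (continuous_iff_continuousAt.2 fun r => (hasDerivAt_wave_deriv k _ _ r).continuousAt)
        (fun x _ => rfl)
      simp only [sub_self, Complex.ofReal_zero, mul_zero, Complex.exp_zero, mul_one] at this
      rw [mul_div_cancel_left₀ _ hac] at this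
      simp only [dtnMap, hi, dif_neg, not_false_eq_true]
      refine ⟨this.1, ?_⟩
      have e : (Complex.I * k - 1 / S.rplus 0) * f 0 Side.plus
          = (Complex.I * k * (S.rplus 0 * f 0 Side.plus) - f 0 Side.plus) / S.rplus 0 := by
        field_simp
      rw [e]
      exact this.2

lemma isExteriorSolution_hostFun (hk : S.Nonresonant k) :
    S.IsExteriorSolution k f (S.hostFun k f) := by
  refine ⟨fun x hx => ?_, fun x hx => ?_, fun i s θ => (S.hostFun_boundary hk i s θ).1, ?_⟩
  · obtain ⟨o, ho⟩ := S.exists_mem_region hx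
    exact ((S.regionFun_solution ho).1.congr_of_eventuallyEq
      (S.hostFun_eventuallyEq ho)).contDiffWithinAt
  · obtain ⟨o, ho⟩ := S.exists_mem_region hx
    rw [(InnerProductSpace.laplacian_congr_nhds (S.hostFun_eventuallyEq ho)).self_of_nhds,
      S.hostFun_eq ho]
    exact (S.regionFun_solution ho).2
  -- Outside the outermost sphere the solution is a spherical wave, hence the potential of a point
  -- mass at the origin; the weight cancels the factor -1/(4π) and the phase at the sphere.
  · refine ⟨S.rplus 0, Measure.dirac 0, fun _ => -(4 * Real.pi) * (S.rplus 0 * f 0 Side.plus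
      * Complex.exp (-(Complex.I * k * S.rplus 0))), inferInstance, integrable_const _, ?_, ?_⟩
    · rw [Measure.dirac_apply' _ Metric.isClosed_closedBall.measurableSet.compl]
      simp [(S.rplus_pos 0).le]
    · intro x hx
      rw [integral_dirac, sub_zero, S.hostFun_eq (o := none) hx]
      simp only [regionFun, outgoingGreen]
      have : (Real.pi : ℂ) ≠ 0 := by exact_mod_cast Real.pi_ne_zero
      have e : Complex.exp (Complex.I * k * (‖x‖ - S.rplus 0 : ℝ))
          = Complex.exp (Complex.I * k * ‖x‖) * Complex.exp (-(Complex.I * k * S.rplus 0)) := by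
        rw [← Complex.exp_add]
        congr 1
        push_cast
        ring
      rw [e]
      have hxc : (‖x‖ : ℂ) ≠ 0 := by exact_mod_cast ((S.rplus_pos 0).trans hx).ne'
      field_simp

/-- The Dirichlet-to-Neumann map in closed form. -/
theorem dtn_eq_dtnMap (hk : S.Nonresonant k) : S.dtn k f = S.dtnMap k f := by
  have hex : ∃ g : Fin N → Side → ℂ, ∃ w, S.IsExteriorSolution k f w ∧ S.HasNormalDerivatives w fun i s _ => g i s :=
    ⟨S.dtnMap k f, S.hostFun k f, S.isExteriorSolution_hostFun hk,
      fun i s θ => (S.hostFun_boundary hk i s θ).2⟩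
  -- The chosen solution need not be the explicit one. Its normal derivatives are constants whose
  -- integrals over the unit sphere are prescribed, so they agree with the closed form after
  -- division by 4π.
  obtain ⟨w, ⟨hw, hlap, hbv, hout⟩, hnd⟩ := Classical.epsilon_spec hex
  have hext := S.eventually_sphereMean_of_isOutgoing hw hout
  have hpi : (4 * Real.pi : ℂ) ≠ 0 := by exact_mod_cast (by positivity : (4 * Real.pi : ℝ) ≠ 0)
  funext i s
  refine mul_left_cancel₀ hpi ?_
  rw [← integral_surfaceMeasure_const]
  cases s with
  | plus => exact S.integral_normalDerivative_plus hk hw hlap hbv hnd hext i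
  | minus => exact S.integral_normalDerivative_minus hk hw hlap hbv hnd i

end NestedShells

namespace NestedShells

variable {N : ℕ} (S : NestedShells N)

/-! ### The capacitance matrix -/

/-- The boundary data that are `1` on the boundary of the `j`-th shell and `0` elsewhere. -/
def shellData (j : Fin N) : Fin N → Side → ℂ := fun i _ => if i = j then 1 else 0

lemma nonresonant_zero : S.Nonresonant 0 := by
  intro i
  rw [zero_pow two_ne_zero, genTrig_zero_left]
  have : (0 : ℝ) < S.rminus i - S.below i := sub_pos.2 (S.below_lt i)
  have h : ((S.rminus i - S.below i : ℝ) : ℂ) ≠ 0 := by exact_mod_cast this.ne'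
  simpa using h

/-- For k = 0 the product r²∂ᵣw is constant along a gap and equals the difference of the boundary
values times the capacity ab/(b - a) of the gap, up to the factor 4π. The exterior corresponds to b
= ∞. -/
lemma dtnMap_zero_plus (f : Fin N → Side → ℂ) (i : Fin N) :
    (S.rplus i : ℂ) ^ 2 * S.dtnMap 0 f i Side.plus
      = if h : 0 < i.val then
          (S.outerCoupling i : ℂ) * (f ⟨i.val - 1, by omega⟩ Side.minus - f i Side.plus)
        else -(S.outerCoupling i : ℂ) * f i Side.plus := by
  have ha : (S.rplus i : ℂ) ≠ 0 := by exact_mod_cast (S.rplus_pos i).ne'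
  by_cases h : 0 < i.val
  · have hlt : S.rplus i < S.rminus ⟨i.val - 1, by omega⟩ :=
      S.nested _ _ (by rw [Fin.lt_def]; simp only; omega)
    have hL : (S.rminus ⟨i.val - 1, by omega⟩ - S.rplus i : ℂ) ≠ 0 := by
      exact_mod_cast (sub_pos.2 hlt).ne'
    simp only [dtnMap, outerCoupling, h, dif_pos, gapInner, zero_pow two_ne_zero, genTrig_zero_left]
    push_cast
    simp only [pow_zero, pow_one, Nat.factorial]
    push_cast
    field_simp
    ring
  · simp only [dtnMap, outerCoupling, h, dif_neg, not_false_eq_true]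
    field_simp
    ring

lemma dtnMap_zero_minus (f : Fin N → Side → ℂ) (i : Fin N) :
    (S.rminus i : ℂ) ^ 2 * S.dtnMap 0 f i Side.minus
      = (S.innerCoupling i : ℂ) * (f i Side.minus - belowValue f i) := by
  have hb : (S.rminus i : ℂ) ≠ 0 := by exact_mod_cast (S.rminus_pos i).ne'
  have hL : (S.rminus i - S.below i : ℂ) ≠ 0 := by
    exact_mod_cast (sub_pos.2 (S.below_lt i)).ne'
  have hq : (S.innerCoupling i : ℂ) = S.rminus i * S.below i / (S.rminus i - S.below i) := by
    unfold innerCoupling below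
    split_ifs <;> simp
  rw [hq]
  simp only [dtnMap, gapOuter, zero_pow two_ne_zero, genTrig_zero_left]
  push_cast
  simp only [pow_zero, pow_one, Nat.factorial]
  push_cast
  field_simp
  ring

variable [NeZero N]

/-- The real part of the exterior solution for k = 0 serves; outside the outermost sphere that
solution is exactly a constant times 1/‖x‖. -/
lemma exists_isCapacitaryPotential (j : Fin N) :
    ∃ V, S.IsCapacitaryPotential j V ∧
      S.HasNormalDerivatives V fun i s _ => (S.dtnMap 0 (shellData j) i s).re := by
  have hk := S.nonresonant_zero
  obtain ⟨hw, hlap, hbv, -⟩ := S.isExteriorSolution_hostFun (f := shellData j) hk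
  have hat : ∀ x ∈ S.host, ContDiffAt ℝ 2 (S.hostFun 0 (shellData j)) x := fun x hx =>
    hw.contDiffAt (S.isOpen_host.mem_nhds hx)
  refine ⟨fun x => Complex.reCLM (S.hostFun 0 (shellData j) x), ⟨?_, ?_, ?_, ?_⟩, ?_⟩
  · exact Complex.reCLM.contDiff.comp_contDiffOn hw
  · intro x hx
    have h1 := (hat x hx).laplacian_CLM_comp_left (l := Complex.reCLM)
    have h2 := hlap x hx
    rw [zero_pow two_ne_zero, zero_mul, add_zero] at h2
    have h3 : Laplacian.laplacian (Complex.reCLM ∘ S.hostFun 0 (shellData j)) x = 0 := by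
      rw [h1, Function.comp, h2, map_zero]
    exact h3
  · intro i s θ
    have := (Complex.reCLM.continuous.tendsto _).comp (hbv i s θ)
    have e : Complex.reCLM (shellData j i s) = if i = j then 1 else 0 := by
      unfold shellData
      split_ifs <;> simp
    rw [e] at this
    exact this
  · refine IsBigO.of_bound (‖(S.rplus 0 * shellData j 0 Side.plus : ℂ)‖) ?_
    have hev : ∀ᶠ x : Space in Bornology.cobounded Space, S.rplus 0 < ‖x‖ :=
      tendsto_norm_cobounded_atTop.eventually_gt_atTop _
    filter_upwards [hev] with x hx
    refine (Complex.abs_re_le_norm _).trans ?_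
    rw [S.hostFun_eq (o := none) hx]
    simp only [regionFun, mul_zero, zero_mul, Complex.exp_zero, mul_one]
    rw [norm_div, norm_inv, Complex.norm_real, norm_norm, div_eq_mul_inv]
  · intro i s θ
    have := (Complex.reCLM.continuous.tendsto _).comp
      (S.hostFun_boundary (f := shellData j) hk i s θ).2
    refine this.congr' ?_
    filter_upwards [self_mem_nhdsWithin] with x hx
    have hd := ((hat x hx).differentiableAt (by norm_num)).hasFDerivAt
    have h2 := (Complex.reCLM.hasFDerivAt.comp x hd).fderiv
    have h3 : fderiv ℝ (fun x => Complex.reCLM (S.hostFun 0 (shellData j) x)) x = _ := h2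
    rw [h3]
    rfl

/-- For k = 0 the function ψ is affine, ψ = cr + d, and the mean of w tends to c. Decay forces c =
0, that is ψ' = 0, which is the relation ψ' = ikψ at k = 0. -/
lemma eventually_sphereMean_of_isBigO {w : Space → ℂ} (hw : ContDiffOn ℝ 2 w S.host)
    (hlap : ∀ x ∈ S.host, Laplacian.laplacian w x + 0 ^ 2 * w x = 0)
    (hO : w =O[Bornology.cobounded Space] fun x => ‖x‖⁻¹) :
    ∀ᶠ r : ℝ in atTop, sphereMean w r + (r : ℂ) * sphereMeanDeriv w r
      = Complex.I * 0 * ((r : ℂ) * sphereMean w r) := by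
  set a := S.rplus 0 with ha
  have ha0 : 0 ≤ a := (S.rplus_pos 0).le
  have hd1 : ∀ r ∈ Set.Ioi a, HasDerivAt (fun r : ℝ => (r : ℂ) * sphereMean w r)
      (sphereMean w r + (r : ℂ) * sphereMeanDeriv w r) r := fun r hr =>
    S.hasDerivAt_mean ha0 (b := r + 1) (fun x hx => S.exterior_subset_host hx.1) hw
      ⟨hr, by linarith⟩
  have hd2 : ∀ r ∈ Set.Ioi a, HasDerivAt (fun r : ℝ => sphereMean w r
      + (r : ℂ) * sphereMeanDeriv w r) 0 r := fun r hr => by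
    have := S.hasDerivAt_mean_deriv ha0 (b := r + 1) (fun x hx => S.exterior_subset_host hx.1) hw
      hlap (r := r) ⟨hr, by linarith⟩
    simpa using this
  obtain ⟨c, hc⟩ := isOpen_Ioi.exists_is_const_of_deriv_eq_zero isPreconnected_Ioi
    (fun r hr => (hd2 r hr).differentiableAt.differentiableWithinAt) fun r hr => (hd2 r hr).deriv
  have hd3 : ∀ r ∈ Set.Ioi a, HasDerivAt (fun r : ℝ => (r : ℂ) * sphereMean w r - c * r) 0 r := by
    intro r hr
    have h1 := hd1 r hr
    rw [hc r hr] at h1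
    have h2 := (Complex.ofRealCLM.hasDerivAt (x := r)).const_mul c
    refine (h1.sub h2).congr_deriv ?_
    simp
  obtain ⟨d, hd⟩ := isOpen_Ioi.exists_is_const_of_deriv_eq_zero isPreconnected_Ioi
    (fun r hr => (hd3 r hr).differentiableAt.differentiableWithinAt) fun r hr => (hd3 r hr).deriv
  obtain ⟨C, hC⟩ := hO.bound
  have hbound : ∀ᶠ r : ℝ in atTop, ‖sphereMean w r‖ ≤ C * r⁻¹ * surfaceMeasure.real Set.univ := by
    obtain ⟨ρ, hρ⟩ := (Filter.HasBasis.eventually_iff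
      (Metric.hasBasis_cobounded_compl_closedBall (0 : Space))).1 hC
    filter_upwards [eventually_gt_atTop ρ, eventually_gt_atTop 0] with r hr hr0
    refine norm_integral_le_of_norm_le_const (Eventually.of_forall fun θ => ?_)
    have hn := norm_smul_unitSphere hr0.le θ
    have := hρ.2 (x := r • (θ : Space)) (by simp [norm_smul_unitSphere hr0.le, hr])
    rwa [hn, norm_inv, Real.norm_of_nonneg hr0.le] at this
  have lim1 : Tendsto (sphereMean w) atTop (𝓝 0) := by
    refine squeeze_zero_norm' hbound ?_
    have := (tendsto_inv_atTop_zero (𝕜 := ℝ)).const_mul C |>.mul_const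
      (surfaceMeasure.real Set.univ)
    simpa using this
  have lim2 : Tendsto (sphereMean w) atTop (𝓝 c) := by
    have h1 : Tendsto (fun r : ℝ => c + d * ((r⁻¹ : ℝ) : ℂ)) atTop (𝓝 (c + d * ((0 : ℝ) : ℂ))) :=
      ((Complex.continuous_ofReal.tendsto 0).comp tendsto_inv_atTop_zero).const_mul d
        |>.const_add c
    simp only [Complex.ofReal_zero, mul_zero, add_zero] at h1
    refine h1.congr' ?_
    filter_upwards [eventually_gt_atTop a, eventually_gt_atTop 0] with r hr hr0
    have hrc : (r : ℂ) ≠ 0 := by exact_mod_cast hr0.ne'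
    have := hd r hr
    refine mul_left_cancel₀ hrc ?_
    push_cast
    field_simp
    linear_combination -this
  have hc0 : c = 0 := tendsto_nhds_unique lim2 lim1
  filter_upwards [eventually_gt_atTop a] with r hr
  rw [hc r hr, hc0]
  simp

/-- The capacitance matrix in terms of the Dirichlet-to-Neumann map for `k = 0`. -/
theorem capacitance_eq (i j : Fin N) :
    ((S.capacitance i j : ℝ) : ℂ) = -(4 * Real.pi * ((S.rplus i : ℂ) ^ 2
      * S.dtnMap 0 (shellData j) i Side.plus
      - (S.rminus i : ℂ) ^ 2 * S.dtnMap 0 (shellData j) i Side.minus)) := by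
  have hk := S.nonresonant_zero
  have hex : ∃ c : ℝ, ∃ V q, S.IsCapacitaryPotential j V ∧ S.HasNormalDerivatives V q ∧
      c = -(sphereIntegral (S.rplus i) (q i Side.plus)
        - sphereIntegral (S.rminus i) (q i Side.minus)) := by
    obtain ⟨V, hV, hq⟩ := S.exists_isCapacitaryPotential j
    exact ⟨_, V, _, hV, hq, rfl⟩
  obtain ⟨V, q, ⟨hw, hlap, hbv, hO⟩, hnd, hc⟩ := Classical.epsilon_spec hex
  have hcap : S.capacitance i j = -(sphereIntegral (S.rplus i) (q i Side.plus)
        - sphereIntegral (S.rminus i) (q i Side.minus)) := hc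
  have hat : ∀ x ∈ S.host, ContDiffAt ℝ 2 V x := fun x hx =>
    hw.contDiffAt (S.isOpen_host.mem_nhds hx)
  -- The potential is complexified so that the integral formulas for the normal derivatives apply.
  -- They hold for any potential that may have been chosen, so no uniqueness of potentials is
  -- needed.
  set w : Space → ℂ := fun x => Complex.ofRealCLM (V x) with hwdef
  have hw' : ContDiffOn ℝ 2 w S.host := Complex.ofRealCLM.contDiff.comp_contDiffOn hw
  have hlap' : ∀ x ∈ S.host, Laplacian.laplacian w x + 0 ^ 2 * w x = 0 := by
    intro x hx
    have h1 := (hat x hx).laplacian_CLM_comp_left (l := Complex.ofRealCLM)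
    rw [Function.comp, hlap x hx, map_zero] at h1
    rw [zero_pow two_ne_zero, zero_mul, add_zero]
    exact h1
  have hbv' : S.HasBoundaryValues w (shellData j) := by
    intro i s θ
    have := (Complex.ofRealCLM.continuous.tendsto _).comp (hbv i s θ)
    have e : Complex.ofRealCLM (if i = j then 1 else 0) = shellData j i s := by
      unfold shellData
      split_ifs <;> simp
    rw [e] at this
    exact this
  have hnd' : S.HasNormalDerivatives w fun i s θ => (q i s θ : ℂ) := by
    intro i s θ
    have := (Complex.ofRealCLM.continuous.tendsto _).comp (hnd i s θ)
    refine this.congr' ?_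
    filter_upwards [self_mem_nhdsWithin] with x hx
    have hd := ((hat x hx).differentiableAt (by norm_num)).hasFDerivAt
    have h2 : fderiv ℝ w x = _ := (Complex.ofRealCLM.hasFDerivAt.comp x hd).fderiv
    rw [h2]
    rfl
  have hO' : w =O[Bornology.cobounded Space] fun x => ‖x‖⁻¹ :=
    (IsBigO.of_norm_left (by simpa [hwdef] using hO.norm_left))
  have hext := S.eventually_sphereMean_of_isBigO hw' hlap' hO'
  have e1 := S.integral_normalDerivative_plus hk hw' hlap' hbv' hnd' hext i
  have e2 := S.integral_normalDerivative_minus hk hw' hlap' hbv' hnd' i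
  rw [integral_complex_ofReal] at e1 e2
  rw [hcap]
  simp only [sphereIntegral, smul_eq_mul]
  push_cast
  rw [e1, e2]
  ring

end NestedShells

namespace NestedShells

variable {N : ℕ} (S : NestedShells N)

/-! ### The Sobolev space on the shells -/

lemma measurableSet_shell (i : Fin N) : MeasurableSet (S.shell i) := (S.isOpen_shell i).measurableSet

theorem vol_eq (j : Fin N) : S.vol j = 4 * Real.pi / 3 * (S.rplus j ^ 3 - S.rminus j ^ 3) := by
  have hset : S.shell j = Metric.ball (0 : Space) (S.rplus j) \ Metric.closedBall 0 (S.rminus j) := by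
    ext x
    simp [shell, and_comm]
  have hsub : Metric.closedBall (0 : Space) (S.rminus j) ⊆ Metric.ball 0 (S.rplus j) :=
    Metric.closedBall_subset_ball (S.rminus_lt_rplus j)
  have hpi := Real.pi_pos.le
  unfold vol
  rw [hset, measureReal_sdiff hsub Metric.isClosed_closedBall.measurableSet
    measure_ball_lt_top.ne, measureReal_def, measureReal_def,
    EuclideanSpace.volume_ball_fin_three, EuclideanSpace.volume_closedBall_fin_three]
  have h1 := (S.rplus_pos j).le
  have h2 := (S.rminus_pos j).le
  rw [ENNReal.toReal_mul, ENNReal.toReal_mul, ENNReal.toReal_pow, ENNReal.toReal_pow,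
    ENNReal.toReal_ofReal h1, ENNReal.toReal_ofReal h2, ENNReal.toReal_ofReal (by positivity)]
  ring

lemma vol_pos (j : Fin N) : 0 < S.vol j := by
  rw [S.vol_eq]
  have := pow_lt_pow_left₀ (S.rminus_lt_rplus j) (S.rminus_pos j).le (n := 3) (by norm_num)
  have := Real.pi_pos
  have h : 0 < S.rplus j ^ 3 - S.rminus j ^ 3 := by linarith
  positivity

lemma isFiniteMeasure_shell (i : Fin N) : IsFiniteMeasure (volume.restrict (S.shell i)) :=
  ⟨by rw [Measure.restrict_apply_univ]; exact (S.volume_shell_ne_top i).lt_top⟩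

lemma isFiniteMeasure_resonators : IsFiniteMeasure (volume.restrict S.resonators) := by
  refine ⟨?_⟩
  rw [Measure.restrict_apply_univ]
  exact (measure_iUnion_le _).trans_lt
    (by rw [tsum_fintype]; exact ENNReal.sum_lt_top.2 fun i _ => (S.volume_shell_ne_top i).lt_top)

lemma ae_shell {p : Space → Prop} (h : ∀ᵐ x ∂volume.restrict S.resonators, p x) (i : Fin N) :
    ∀ᵐ x ∂volume.restrict (S.shell i), p x :=
  ae_restrict_of_ae_restrict_of_subset (S.shell_subset i) h

lemma ae_resonators {p : Space → Prop} (h : ∀ i, ∀ᵐ x ∂volume.restrict (S.shell i), p x) :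
    ∀ᵐ x ∂volume.restrict S.resonators, p x := by
  unfold resonators
  rw [ae_restrict_iUnion_eq]
  exact Filter.eventually_iSup.2 h

lemma integral_resonators {h : Space → ℂ} (hint : ∀ i, IntegrableOn h (S.shell i)) :
    ∫ x in S.resonators, h x = ∑ i, ∫ x in S.shell i, h x :=
  integral_iUnion_fintype S.measurableSet_shell (fun _ _ hij => S.disjoint_shell hij) hint

lemma memLp_fn (u : S.H1) (i : Fin N) : MemLp (S.fn u) 2 (volume.restrict (S.shell i)) :=
  (Lp.memLp u.1.fst).mono_measure (Measure.restrict_mono (S.shell_subset i) le_rfl)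

lemma memLp_grad (u : S.H1) (i : Fin N) (k : Fin 3) :
    MemLp (fun x => S.grad u x k) 2 (volume.restrict (S.shell i)) :=
  (memLp_component (Lp.memLp u.1.snd) k).mono_measure
    (Measure.restrict_mono (S.shell_subset i) le_rfl)

lemma memLp_shell_of_continuous {φ : Space → ℂ} (hφ : Continuous φ) (i : Fin N) {p : ENNReal} :
    MemLp φ p (volume.restrict (S.shell i)) := by
  have := S.isFiniteMeasure_shell i
  obtain ⟨C, hC⟩ := (isCompact_closedBall (0 : Space) (S.rplus i)).exists_bound_of_continuousOn
    hφ.continuousOn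
  refine MemLp.of_bound hφ.aestronglyMeasurable C ?_
  filter_upwards [ae_restrict_mem (S.measurableSet_shell i)] with x hx
  exact hC x (by simpa using hx.2.le)

lemma integrableOn_shell_of_continuous {φ : Space → ℂ} (hφ : Continuous φ) (i : Fin N) :
    IntegrableOn φ (S.shell i) :=
  memLp_one_iff_integrable.1 (S.memLp_shell_of_continuous hφ i)

lemma integrableOn_fn_mul (u : S.H1) {φ : Space → ℂ} (hφ : Continuous φ) (i : Fin N) :
    IntegrableOn (fun x => S.fn u x * φ x) (S.shell i) :=
  MemLp.integrable_mul (q := 2) (S.memLp_fn u i) (S.memLp_shell_of_continuous hφ i)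

lemma integrableOn_grad_mul (u : S.H1) {φ : Space → ℂ} (hφ : Continuous φ) (i : Fin N) (k : Fin 3) :
    IntegrableOn (fun x => S.grad u x k * φ x) (S.shell i) :=
  MemLp.integrable_mul (q := 2) (S.memLp_grad u i k) (S.memLp_shell_of_continuous hφ i)

lemma integrableOn_fn (u : S.H1) (i : Fin N) : IntegrableOn (S.fn u) (S.shell i) := by
  simpa using S.integrableOn_fn_mul u (φ := fun _ => 1) continuous_const i

lemma ae_fn_add (u v : S.H1) (i : Fin N) :
    ∀ᵐ x ∂volume.restrict (S.shell i), S.fn (u + v) x = S.fn u x + S.fn v x :=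
  S.ae_shell (Lp.coeFn_add u.1.fst v.1.fst) i

lemma ae_fn_smul (c : ℂ) (u : S.H1) (i : Fin N) :
    ∀ᵐ x ∂volume.restrict (S.shell i), S.fn (c • u) x = c * S.fn u x :=
  S.ae_shell (Lp.coeFn_smul c u.1.fst) i

lemma ae_grad_add (u v : S.H1) (i : Fin N) :
    ∀ᵐ x ∂volume.restrict (S.shell i), S.grad (u + v) x = S.grad u x + S.grad v x :=
  S.ae_shell (Lp.coeFn_add u.1.snd v.1.snd) i

lemma ae_grad_smul (c : ℂ) (u : S.H1) (i : Fin N) :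
    ∀ᵐ x ∂volume.restrict (S.shell i), S.grad (c • u) x = c • S.grad u x :=
  S.ae_shell (Lp.coeFn_smul c u.1.snd) i

/-- The element `u` of `H¹(D)` agrees with the differentiable function `φ i` on the `i`-th shell. -/
def Represents (u : S.H1) (φ : Fin N → Space → ℂ) : Prop :=
  ∀ i, ∀ᵐ x ∂volume.restrict (S.shell i), S.fn u x = φ i x ∧
    ∀ k, S.grad u x k = fderiv ℝ (φ i) x (EuclideanSpace.single k 1)

variable {S}

lemma Represents.add {u v : S.H1} {φ ψ : Fin N → Space → ℂ} (hu : S.Represents u φ)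
    (hv : S.Represents v ψ) (hφ : ∀ i, ∀ x ∈ S.shell i, DifferentiableAt ℝ (φ i) x)
    (hψ : ∀ i, ∀ x ∈ S.shell i, DifferentiableAt ℝ (ψ i) x) :
    S.Represents (u + v) fun i x => φ i x + ψ i x := by
  intro i
  filter_upwards [hu i, hv i, S.ae_fn_add u v i, S.ae_grad_add u v i,
    ae_restrict_mem (S.measurableSet_shell i)] with x h1 h2 h3 h4 hx
  refine ⟨by rw [h3, h1.1, h2.1], fun k => ?_⟩
  rw [h4, PiLp.add_apply, h1.2, h2.2, fderiv_fun_add (hφ i x hx) (hψ i x hx)]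
  rfl

lemma Represents.smul {u : S.H1} {φ : Fin N → Space → ℂ} (c : ℂ) (hu : S.Represents u φ)
    (hφ : ∀ i, ∀ x ∈ S.shell i, DifferentiableAt ℝ (φ i) x) :
    S.Represents (c • u) fun i x => c * φ i x := by
  intro i
  filter_upwards [hu i, S.ae_fn_smul c u i, S.ae_grad_smul c u i,
    ae_restrict_mem (S.measurableSet_shell i)] with x h1 h3 h4 hx
  refine ⟨by rw [h3, h1.1], fun k => ?_⟩
  rw [h4, PiLp.smul_apply, h1.2, fderiv_const_mul (hφ i x hx)]
  rfl

lemma Represents.congr {u : S.H1} {φ ψ : Fin N → Space → ℂ} (hu : S.Represents u φ)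
    (h : ∀ i, ∀ x ∈ S.shell i, φ i x = ψ i x) : S.Represents u ψ := by
  intro i
  filter_upwards [hu i, ae_restrict_mem (S.measurableSet_shell i)] with x h1 hx
  have he : φ i =ᶠ[𝓝 x] ψ i := by
    filter_upwards [(S.isOpen_shell i).mem_nhds hx] with y hy
    exact h i y hy
  exact ⟨h1.1.trans (h i x hx), fun k => by rw [h1.2 k, he.fderiv_eq]⟩

variable (S)

lemma sum_indicator_shell {E : Type*} [AddCommMonoid E] (h : Fin N → Space → E) {i : Fin N}
    {x : Space} (hx : x ∈ S.shell i) : ∑ j, (S.shell j).indicator (h j) x = h i x := by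
  rw [Finset.sum_eq_single i]
  · exact Set.indicator_of_mem hx _
  · intro j _ hj
    exact Set.indicator_of_notMem (fun hxj => Set.disjoint_left.1 (S.disjoint_shell hj) hxj hx) _
  · simp

lemma memLp_sum_indicator_shell {E : Type*} [NormedAddCommGroup E]
    {h : Fin N → Space → E} (hh : ∀ i, Continuous (h i)) (hs : ∀ i, AEStronglyMeasurable (h i)) :
    MemLp (fun x => ∑ i, (S.shell i).indicator (h i) x) 2 (volume.restrict S.resonators) := by
  have := S.isFiniteMeasure_resonators
  refine memLp_finsetSum _ fun i _ => ?_
  rw [memLp_indicator_iff_restrict (S.measurableSet_shell i)]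
  obtain ⟨C, hC⟩ := (isCompact_closedBall (0 : Space) (S.rplus i)).exists_bound_of_continuousOn
    (hh i).continuousOn
  refine MemLp.of_bound (hs i).restrict.restrict C ?_
  filter_upwards [ae_restrict_mem (S.measurableSet_shell i)] with x hx
  exact hC x (by simpa using hx.2.le)

/-- No boundary terms arise: the shells are disjoint open sets, so a compact support inside their
union meets each shell in a compact set. -/
lemma integral_mul_partial_shell {φ ψ : Space → ℂ} (hφ : ContDiff ℝ (⊤ : ℕ∞) φ)
    (hψ : ContDiff ℝ (⊤ : ℕ∞) ψ) (hc : HasCompactSupport ψ) (hs : tsupport ψ ⊆ S.resonators)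
    (i : Fin N) (e : Space) :
    ∫ x in S.shell i, φ x * fderiv ℝ ψ x e = -∫ x in S.shell i, fderiv ℝ φ x e * ψ x := by
  have i1 : IntegrableOn (fun x => φ x * fderiv ℝ ψ x e) (S.shell i) :=
    S.integrableOn_shell_of_continuous (hφ.continuous.mul (continuous_partial hψ _)) i
  have i2 : IntegrableOn (fun x => fderiv ℝ φ x e * ψ x) (S.shell i) :=
    S.integrableOn_shell_of_continuous ((continuous_partial hφ _).mul hψ.continuous) i
  have hsupp : tsupport (fun x => φ x * ψ x) ⊆ tsupport ψ := tsupport_mul_subset_right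
  rw [eq_neg_iff_add_eq_zero, ← integral_add i1 i2,
    ← S.integral_partial_shell i (hφ.mul hψ) hc.mul_left (hsupp.trans hs) e]
  refine integral_congr_ae (Eventually.of_forall fun x => ?_)
  have h3 : fderiv ℝ (fun x => φ x * ψ x) x = _ :=
    ((hφ.differentiable (by simp) x).hasFDerivAt.mul
      (hψ.differentiable (by simp) x).hasFDerivAt).fderiv
  simp only [h3]
  simp
  ring

lemma isWeakGradient_sum_indicator {φ : Fin N → Space → ℂ}
    {D : Fin N → Space → EuclideanSpace ℂ (Fin 3)} (hφ : ∀ i, ContDiff ℝ (⊤ : ℕ∞) (φ i))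
    (hD : ∀ i x k, D i x k = fderiv ℝ (φ i) x (EuclideanSpace.single k 1)) :
    IsWeakGradient S.resonators (fun x => ∑ i, (S.shell i).indicator (φ i) x)
      (fun x => ∑ i, (S.shell i).indicator (D i) x) := by
  intro ψ hψ hc hs k
  have e1 : ∀ i, Set.EqOn (fun x => (∑ i, (S.shell i).indicator (φ i) x)
        * fderiv ℝ ψ x (EuclideanSpace.single k 1))
      (fun x => φ i x * fderiv ℝ ψ x (EuclideanSpace.single k 1)) (S.shell i) := by
    intro i x hx
    simp only [S.sum_indicator_shell φ hx]
  have e2 : ∀ i, Set.EqOn (fun x => (∑ i, (S.shell i).indicator (D i) x) k * ψ x)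
      (fun x => fderiv ℝ (φ i) x (EuclideanSpace.single k 1) * ψ x) (S.shell i) := by
    intro i x hx
    simp only [S.sum_indicator_shell D hx, hD]
  have i1 : ∀ i, IntegrableOn (fun x => φ i x * fderiv ℝ ψ x (EuclideanSpace.single k 1))
      (S.shell i) := fun i =>
    S.integrableOn_shell_of_continuous ((hφ i).continuous.mul (continuous_partial hψ _)) i
  have i2 : ∀ i, IntegrableOn (fun x => fderiv ℝ (φ i) x (EuclideanSpace.single k 1) * ψ x)
      (S.shell i) := fun i =>
    S.integrableOn_shell_of_continuous ((continuous_partial (hφ i) _).mul hψ.continuous) i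
  rw [S.integral_resonators fun i => (i1 i).congr_fun (e1 i).symm (S.measurableSet_shell i),
    S.integral_resonators fun i => (i2 i).congr_fun (e2 i).symm (S.measurableSet_shell i),
    ← Finset.sum_neg_distrib]
  refine Finset.sum_congr rfl fun i _ => ?_
  rw [setIntegral_congr_fun (S.measurableSet_shell i) (e1 i),
    setIntegral_congr_fun (S.measurableSet_shell i) (e2 i)]
  exact S.integral_mul_partial_shell (hφ i) hψ hc hs i _

lemma exists_h1_of_isWeakGradient {f : Space → ℂ} {G : Space → EuclideanSpace ℂ (Fin 3)}
    (hf : MemLp f 2 (volume.restrict S.resonators)) (hG : MemLp G 2 (volume.restrict S.resonators))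
    (h : IsWeakGradient S.resonators f G) :
    ∃ u : S.H1, S.fn u =ᵐ[volume.restrict S.resonators] f ∧
      S.grad u =ᵐ[volume.restrict S.resonators] G := by
  have hcf := MemLp.coeFn_toLp hf
  have hcG := MemLp.coeFn_toLp hG
  refine ⟨⟨WithLp.toLp 2 (hf.toLp f, hG.toLp G), ?_⟩, hcf, hcG⟩
  intro ψ hψ hc hs k
  refine Eq.trans ?_ ((h ψ hψ hc hs k).trans (congrArg Neg.neg ?_))
  · refine integral_congr_ae ?_
    filter_upwards [hcf] with x hx
    exact congrArg (· * _) hx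
  · refine integral_congr_ae ?_
    filter_upwards [hcG] with x hx
    exact congrArg (fun v : EuclideanSpace ℂ (Fin 3) => v k * _) hx.symm

/-- Functions that are smooth on each shell belong to `H¹(D)`. -/
lemma exists_represents {φ : Fin N → Space → ℂ} (hφ : ∀ i, ContDiff ℝ (⊤ : ℕ∞) (φ i)) :
    ∃ u : S.H1, S.Represents u φ := by
  have hDc : ∀ i, Continuous fun x : Space => (WithLp.toLp 2 fun k =>
      fderiv ℝ (φ i) x (EuclideanSpace.single k 1) : EuclideanSpace ℂ (Fin 3)) := fun i =>
    (PiLp.continuous_toLp 2 _).comp (continuous_pi fun k => continuous_partial (hφ i) _)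
  have hc : ∀ i, Continuous (φ i) := fun i => (hφ i).continuous
  obtain ⟨u, h1, h2⟩ := S.exists_h1_of_isWeakGradient
    (S.memLp_sum_indicator_shell hc fun i => (hc i).aestronglyMeasurable)
    (S.memLp_sum_indicator_shell hDc fun i => (hDc i).aestronglyMeasurable)
    (S.isWeakGradient_sum_indicator hφ fun _ _ _ => rfl)
  refine ⟨u, fun i => ?_⟩
  filter_upwards [S.ae_shell h1 i, S.ae_shell h2 i,
    ae_restrict_mem (S.measurableSet_shell i)] with x h1 h2 hx
  refine ⟨h1.trans (S.sum_indicator_shell φ hx), fun k => ?_⟩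
  rw [h2, S.sum_indicator_shell _ hx]

/-- Functions that are smooth on each closed shell have the expected trace. -/
lemma Represents.isTrace {S : NestedShells N} {u : S.H1} {φ : Fin N → Space → ℂ}
    (hu : S.Represents u φ) (hφ : ∀ i, ContDiff ℝ (⊤ : ℕ∞) (φ i)) :
    S.IsTrace u fun i s θ => φ i (S.radius i s • (θ : Space)) := by
  refine ⟨fun i s => ?_, fun i ψ hψ k => ?_⟩
  · have hc : Continuous fun θ : UnitSphere => φ i (S.radius i s • (θ : Space)) :=
      (hφ i).continuous.comp (by fun_prop)
    obtain ⟨C, hC⟩ := isCompact_univ.exists_bound_of_continuousOn hc.continuousOn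
    exact MemLp.of_bound hc.aestronglyMeasurable C (Eventually.of_forall fun θ => hC θ trivial)
  · have h1 : ContDiff ℝ 1 fun x => φ i x * ψ x := ((hφ i).mul hψ).of_le (by exact_mod_cast le_top)
    have key := integral_partial_annulus (S.rminus_pos i) (S.rminus_lt_rplus i) h1 k
    refine Eq.trans ?_ key
    refine integral_congr_ae ?_
    filter_upwards [hu i] with x hx
    have d1 := (hφ i).differentiable (by simp) x
    have d2 := hψ.differentiable (by simp) x
    have h3 : fderiv ℝ (fun x => φ i x * ψ x) x = _ :=
      (d1.hasFDerivAt.mul d2.hasFDerivAt).fderiv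
    rw [hx.1, hx.2 k, h3]
    simp
    ring

/-! ### Uniqueness of weak gradients and bounded functionals on H¹(D) -/

lemma ae_eq_of_isWeakGradient {Ω : Set Space} (hΩ : IsOpen Ω)
    [IsFiniteMeasure (volume.restrict Ω)] {f g : Space → ℂ} {F G : Space → EuclideanSpace ℂ (Fin 3)}
    (hF : MemLp F 2 (volume.restrict Ω)) (hG : MemLp G 2 (volume.restrict Ω))
    (h1 : IsWeakGradient Ω f F) (h2 : IsWeakGradient Ω g G) (h : f =ᵐ[volume.restrict Ω] g) :
    F =ᵐ[volume.restrict Ω] G := by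
  have hcomp : ∀ k : Fin 3, ∀ᵐ x, x ∈ Ω → F x k - G x k = 0 := by
    intro k
    have hint : IntegrableOn (fun x => F x k - G x k) Ω :=
      MemLp.integrable (by norm_num) ((memLp_component hF k).sub (memLp_component hG k))
    -- Real test functions suffice for the fundamental lemma; both gradients pair with each of them
    -- to the same value because the underlying functions agree.
    refine hΩ.ae_eq_zero_of_integral_contDiff_smul_eq_zero
      (f := fun x => F x k - G x k) hint.locallyIntegrableOn ?_
    intro q hq hqc hqs
    have hψs : ContDiff ℝ (⊤ : ℕ∞) fun x => (q x : ℂ) := Complex.ofRealCLM.contDiff.comp hq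
    have hψc : HasCompactSupport fun x => (q x : ℂ) :=
      hqc.comp_left (g := fun y : ℝ => (y : ℂ)) (by simp)
    have hψt : tsupport (fun x => (q x : ℂ)) ⊆ Ω := by
      refine (closure_mono ?_).trans hqs
      intro x hx
      simpa using hx
    have e1 := h1 _ hψs hψc hψt k
    have e2 := h2 _ hψs hψc hψt k
    have e0 : ∫ x in Ω, f x * fderiv ℝ (fun x => (q x : ℂ)) x (EuclideanSpace.single k 1)
        = ∫ x in Ω, g x * fderiv ℝ (fun x => (q x : ℂ)) x (EuclideanSpace.single k 1) := by
      refine integral_congr_ae ?_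
      filter_upwards [h] with x hx
      rw [hx]
    rw [e0, e2, neg_inj] at e1
    rw [← setIntegral_eq_integral_of_forall_compl_eq_zero (s := Ω)
      (fun x hx => by rw [image_eq_zero_of_notMem_tsupport fun hx' => hx (hqs hx'), zero_smul])]
    have e3 : ∫ x in Ω, q x • (F x k - G x k) = ∫ x in Ω, (F x k * (q x : ℂ) - G x k * (q x : ℂ)) := by
      refine integral_congr_ae (Eventually.of_forall fun x => ?_)
      simp only [Complex.real_smul]
      ring
    rw [e3, integral_sub (integrable_mul_test (memLp_component hF k) hψs.continuous hψc)
      (integrable_mul_test (memLp_component hG k) hψs.continuous hψc), ← e1, sub_self]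
  filter_upwards [ae_restrict_of_ae (ae_all_iff.2 hcomp), ae_restrict_mem hΩ.measurableSet]
    with x hx hxr
  ext k
  exact sub_eq_zero.1 (hx k hxr)

/-- Elements of `H¹(D)` are determined by the underlying functions. -/
lemma ext_of_fn {u v : S.H1}
    (h : ∀ i, ∀ᵐ x ∂volume.restrict (S.shell i), S.fn u x = S.fn v x) : u = v := by
  have := S.isFiniteMeasure_resonators
  have hfn : u.1.fst = v.1.fst := Lp.ext (S.ae_resonators h)
  have hgr : u.1.snd = v.1.snd := Lp.ext (ae_eq_of_isWeakGradient S.isOpen_resonators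
    (Lp.memLp _) (Lp.memLp _) u.2 v.2 (S.ae_resonators h))
  exact Subtype.ext (WithLp.ofLp_injective 2 (Prod.ext hfn hgr))

/-- The constant in the bound for the norm in `H¹(D)` by supremum norms. -/
def normConst : ℝ :=
  3 * (measureUnivNNReal (volume.restrict S.resonators) : ℝ) ^ (2 : ENNReal).toReal⁻¹

/-- A bound for the norm in `H¹(D)` by the supremum norms of the function and its derivatives. -/
lemma norm_le_of_represents {u : S.H1} {φ : Fin N → Space → ℂ} {M : ℝ} (hM : 0 ≤ M)
    (hu : S.Represents u φ) (h1 : ∀ i, ∀ x ∈ S.shell i, ‖φ i x‖ ≤ M)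
    (h2 : ∀ i, ∀ x ∈ S.shell i, ∀ k, ‖fderiv ℝ (φ i) x (EuclideanSpace.single k 1)‖ ≤ M) :
    ‖u‖ ≤ S.normConst * M := by
  have := S.isFiniteMeasure_resonators
  set A : ℝ := (measureUnivNNReal (volume.restrict S.resonators) : ℝ) ^ (2 : ENNReal).toReal⁻¹ with hA
  have b1 : ‖u.1.fst‖ ≤ A * M := by
    refine Lp.norm_le_of_ae_bound hM (S.ae_resonators fun i => ?_)
    filter_upwards [hu i, ae_restrict_mem (S.measurableSet_shell i)] with x hx hxi
    have : u.1.fst x = φ i x := hx.1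
    rw [this]
    exact h1 i x hxi
  -- The factor 2 bounds √3 for the three components; together with the function itself it accounts
  -- for the 3 in `normConst`.
  have b2 : ‖u.1.snd‖ ≤ A * (2 * M) := by
    refine Lp.norm_le_of_ae_bound (by positivity) (S.ae_resonators fun i => ?_)
    filter_upwards [hu i, ae_restrict_mem (S.measurableSet_shell i)] with x hx hxi
    rw [EuclideanSpace.norm_eq]
    refine Real.sqrt_le_iff.2 ⟨by positivity, ?_⟩
    have hk : ∀ k : Fin 3, ‖u.1.snd x k‖ ^ 2 ≤ M ^ 2 := by
      intro k
      have : u.1.snd x k = fderiv ℝ (φ i) x (EuclideanSpace.single k 1) := hx.2 k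
      rw [this]
      exact pow_le_pow_left₀ (norm_nonneg _) (h2 i x hxi k) 2
    calc ∑ k : Fin 3, ‖u.1.snd x k‖ ^ 2 ≤ ∑ _k : Fin 3, M ^ 2 := Finset.sum_le_sum fun k _ => hk k
      _ = 3 * M ^ 2 := by simp
      _ ≤ (2 * M) ^ 2 := by nlinarith [sq_nonneg M]
  have b3 : ‖u‖ ≤ ‖u.1.fst‖ + ‖u.1.snd‖ := by
    have : ‖u‖ = ‖u.1‖ := rfl
    rw [this, WithLp.prod_norm_eq_of_L2]
    refine Real.sqrt_le_iff.2 ⟨by positivity, ?_⟩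
    nlinarith [norm_nonneg u.1.fst, norm_nonneg u.1.snd]
  calc ‖u‖ ≤ A * M + A * (2 * M) := b3.trans (add_le_add b1 b2)
    _ = S.normConst * M := by rw [normConst, ← hA]; ring

/-- The integral over the `i`-th shell is a bounded functional on `H¹(D)`. -/
lemma exists_norm_integral_le (i : Fin N) :
    ∃ C : ℝ, ∀ u : S.H1, ‖∫ x in S.shell i, S.fn u x‖ ≤ C * ‖u‖ := by
  have := S.isFiniteMeasure_resonators
  have := S.isFiniteMeasure_shell i
  set A : ENNReal := (volume.restrict (S.shell i)) Set.univ ^ (1 / (1 : ENNReal).toReal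
    - 1 / (2 : ENNReal).toReal) with hA
  have hAt : A ≠ ⊤ := by
    refine ENNReal.rpow_ne_top_of_nonneg (by norm_num) (measure_ne_top _ _)
  refine ⟨A.toReal, fun u => ?_⟩
  have h1 : ‖∫ x in S.shell i, S.fn u x‖ ≤ (eLpNorm (S.fn u) 1 (volume.restrict (S.shell i))).toReal := by
    refine (norm_integral_le_lintegral_norm _).trans ?_
    rw [eLpNorm_one_eq_lintegral_enorm]
    simp
  have h2 : eLpNorm (S.fn u) 1 (volume.restrict (S.shell i))
      ≤ eLpNorm (S.fn u) 2 (volume.restrict (S.shell i)) * A :=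
    eLpNorm_le_eLpNorm_mul_rpow_measure_univ (by norm_num) (S.memLp_fn u i).1
  have h3 : eLpNorm (S.fn u) 2 (volume.restrict (S.shell i))
      ≤ eLpNorm (S.fn u) 2 (volume.restrict S.resonators) :=
    eLpNorm_mono_measure _ (Measure.restrict_mono (S.shell_subset i) le_rfl)
  have h4 : eLpNorm (S.fn u) 2 (volume.restrict S.resonators) ≠ ⊤ := (Lp.memLp u.1.fst).2.ne
  have h5 : (eLpNorm (S.fn u) 2 (volume.restrict S.resonators)).toReal = ‖u.1.fst‖ :=
    (Lp.norm_def _).symm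
  have h6 : ‖u.1.fst‖ ≤ ‖u‖ := by
    have : ‖u‖ = ‖u.1‖ := rfl
    rw [this, WithLp.prod_norm_eq_of_L2]
    exact Real.le_sqrt_of_sq_le (by nlinarith [sq_nonneg ‖u.1.snd‖])
  refine h1.trans ((ENNReal.toReal_mono (ENNReal.mul_ne_top h4 hAt)
    (h2.trans (mul_le_mul_left h3 A))).trans ?_)
  rw [ENNReal.toReal_mul, h5, mul_comm]
  exact mul_le_mul_of_nonneg_left h6 ENNReal.toReal_nonneg

lemma integral_fn_add (u v : S.H1) (i : Fin N) :
    ∫ x in S.shell i, S.fn (u + v) x = (∫ x in S.shell i, S.fn u x) + ∫ x in S.shell i, S.fn v x := by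
  rw [← integral_add (S.integrableOn_fn u i) (S.integrableOn_fn v i)]
  exact integral_congr_ae (S.ae_fn_add u v i)

lemma integral_fn_smul (c : ℂ) (u : S.H1) (i : Fin N) :
    ∫ x in S.shell i, S.fn (c • u) x = c * ∫ x in S.shell i, S.fn u x := by
  rw [← integral_const_mul]
  exact integral_congr_ae (S.ae_fn_smul c u i)

/-- The integral over the `i`-th shell as a linear functional on `H¹(D)`. -/
def shellIntegral (i : Fin N) : S.H1 →ₗ[ℂ] ℂ where
  toFun u := ∫ x in S.shell i, S.fn u x
  map_add' u v := S.integral_fn_add u v i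
  map_smul' c u := S.integral_fn_smul c u i

lemma represents_chi (j : Fin N) : S.Represents (S.chi j) fun i _ => if i = j then 1 else 0 := by
  intro i
  have h1 := S.ae_shell (indicatorConstLp_coeFn (p := 2) (μ := volume.restrict S.resonators)
      (hs := (S.isOpen_shell j).measurableSet)
      (hμs := (((Measure.restrict_apply_le _ _).trans_lt (S.volume_shell_ne_top j).lt_top).ne))
      (c := (1 : ℂ))) i
  have h2 := S.ae_shell (Lp.coeFn_zero (EuclideanSpace ℂ (Fin 3)) 2
    (volume.restrict S.resonators)) i
  filter_upwards [h1, h2, ae_restrict_mem (S.measurableSet_shell i)] with x hx1 hx2 hx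
  refine ⟨?_, fun k => ?_⟩
  · have : S.fn (S.chi j) x = (S.shell j).indicator (fun _ => (1 : ℂ)) x := hx1
    rw [this]
    by_cases hij : i = j
    · subst hij
      simp [hx]
    · have : x ∉ S.shell j := fun hxj => Set.disjoint_left.1 (S.disjoint_shell hij) hx hxj
      simp [hij, this]
  · have : S.grad (S.chi j) x = 0 := hx2
    rw [this]
    simp

lemma shellIntegral_chi (i j : Fin N) :
    S.shellIntegral i (S.chi j) = if i = j then (S.vol j : ℂ) else 0 := by
  have : S.shellIntegral i (S.chi j) = ∫ _ in S.shell i, (if i = j then (1 : ℂ) else 0) := by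
    refine integral_congr_ae ?_
    filter_upwards [S.represents_chi j i] with x hx
    exact hx.1
  rw [this]
  split_ifs with h
  · subst h
    simp [vol]
  · simp

end NestedShells

lemma two_le_infty : (2 : WithTop ℕ∞) ≤ ((⊤ : ℕ∞) : WithTop ℕ∞) :=
  WithTop.coe_le_coe.2 (le_top : (2 : ℕ∞) ≤ ⊤)

/-! ### Radial solutions in a shell -/

/-- `r ↦ r e(r)` for the radial solution of `Δe + z e = n` with `e(a) = A` and `e'(a) = α`. -/
def radialProfile (z : ℂ) (a : ℝ) (A α n : ℂ) (r : ℝ) : ℂ :=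
  a * A * genTrig 0 z (r - a) + (A + a * α) * genTrig 1 z (r - a)
    + n * (a * genTrig 2 z (r - a) + genTrig 3 z (r - a))

/-- The derivative of `radialProfile`. -/
def radialProfileDeriv (z : ℂ) (a : ℝ) (A α n : ℂ) (r : ℝ) : ℂ :=
  -z * a * A * genTrig 1 z (r - a) + (A + a * α) * genTrig 0 z (r - a)
    + n * (a * genTrig 1 z (r - a) + genTrig 2 z (r - a))

/-- The radial solution of `Δe + z e = n` with `e(a) = A` and `e'(a) = α`. -/
def radialValue (z : ℂ) (a : ℝ) (A α n : ℂ) (r : ℝ) : ℂ := radialProfile z a A α n r / r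

/-- The derivative of `radialValue`. -/
def radialSlope (z : ℂ) (a : ℝ) (A α n : ℂ) (r : ℝ) : ℂ :=
  radialProfileDeriv z a A α n r / r - radialProfile z a A α n r / r ^ 2

section
variable (z : ℂ) (a : ℝ) (A α n : ℂ)

lemma hasDerivAt_radialProfile (r : ℝ) :
    HasDerivAt (radialProfile z a A α n) (radialProfileDeriv z a A α n r) r := by
  have h0 := hasDerivAt_genTrig_zero_shift z a r
  have h1 := hasDerivAt_genTrig_shift 0 z a r
  have h2 := hasDerivAt_genTrig_shift 1 z a r
  have h3 := hasDerivAt_genTrig_shift 2 z a r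
  have := ((h0.const_mul (a * A)).add (h1.const_mul (A + a * α))).add
    (((h2.const_mul (a : ℂ)).add h3).const_mul n)
  refine this.congr_deriv ?_
  unfold radialProfileDeriv
  ring

/-- The orders 2 and 3 are iterated primitives of the cosine and the sine, and the recurrences
contribute the inhomogeneity n(a + (r - a)) = nr. -/
lemma hasDerivAt_radialProfileDeriv (r : ℝ) :
    HasDerivAt (radialProfileDeriv z a A α n) (n * r - z * radialProfile z a A α n r) r := by
  have h0 := hasDerivAt_genTrig_zero_shift z a r
  have h1 := hasDerivAt_genTrig_shift 0 z a r
  have h2 := hasDerivAt_genTrig_shift 1 z a r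
  have := ((h1.const_mul (-z * a * A)).add (h0.const_mul (A + a * α))).add
    (((h1.const_mul (a : ℂ)).add h2).const_mul n)
  refine this.congr_deriv ?_
  have e0 := genTrig_recurrence 0 z (r - a)
  have e1 := genTrig_recurrence 1 z (r - a)
  simp only [Nat.factorial, pow_zero, pow_one] at e0 e1
  push_cast at e0 e1
  unfold radialProfile
  linear_combination n * a * e0 + n * e1

lemma contDiff_radialProfile : ContDiff ℝ (⊤ : ℕ∞) (radialProfile z a A α n) := by
  have h : ∀ m : ℕ, ContDiff ℝ (⊤ : ℕ∞) fun r : ℝ => genTrig m z (r - a) := fun m =>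
    (contDiff_genTrig_right m z).comp (contDiff_id.sub contDiff_const)
  unfold radialProfile
  exact ((contDiff_const.mul (h 0)).add (contDiff_const.mul (h 1))).add
    (contDiff_const.mul ((contDiff_const.mul (h 2)).add (h 3)))

lemma radialProfile_self : radialProfile z a A α n a = a * A := by
  simp [radialProfile, genTrig_zero_right, genTrig_succ_zero_right]

lemma radialProfileDeriv_self : radialProfileDeriv z a A α n a = A + a * α := by
  simp [radialProfileDeriv, genTrig_zero_right, genTrig_succ_zero_right]

variable {a}

lemma radialValue_self (ha : 0 < a) : radialValue z a A α n a = A := by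
  have : (a : ℂ) ≠ 0 := by exact_mod_cast ha.ne'
  rw [radialValue, radialProfile_self]
  field_simp

lemma radialSlope_self (ha : 0 < a) : radialSlope z a A α n a = α := by
  have : (a : ℂ) ≠ 0 := by exact_mod_cast ha.ne'
  rw [radialSlope, radialProfile_self, radialProfileDeriv_self]
  field_simp
  ring

variable (a)

lemma hasDerivAt_radialValue {r : ℝ} (hr : 0 < r) :
    HasDerivAt (radialValue z a A α n) (radialSlope z a A α n r) r :=
  hasDerivAt_div_ofReal hr (hasDerivAt_radialProfile z a A α n r)

lemma contDiffOn_radialValue : ContDiffOn ℝ (⊤ : ℕ∞) (radialValue z a A α n) (Set.Ioi 0) :=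
  contDiffOn_div_ofReal (contDiff_radialProfile z a A α n).contDiffOn

lemma laplacian_radialValue {x : Space} (hx : x ≠ 0) :
    Laplacian.laplacian (fun y : Space => radialValue z a A α n ‖y‖) x
      + z * radialValue z a A α n ‖x‖ = n := by
  have hx' : (‖x‖ : ℂ) ≠ 0 := by simpa using hx
  have h := laplacian_radial_div (c := (0 : Space)) hx
    ((contDiff_radialProfile z a A α n).contDiffOn.of_le two_le_infty)
    (fun r _ => hasDerivAt_radialProfile z a A α n r)
    (hasDerivAt_radialProfileDeriv z a A α n ‖x - 0‖)
  simp only [sub_zero] at h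
  unfold radialValue
  rw [h]
  field_simp
  ring

/-- A globally smooth function that agrees with a radial solution away from the origin. -/
lemma exists_contDiff_eq_radialValue {c : ℝ} (hc : 0 < c) : ∃ Φ : Space → ℂ,
    ContDiff ℝ (⊤ : ℕ∞) Φ ∧ ∀ x, c < ‖x‖ → Φ x = radialValue z a A α n ‖x‖ ∧
      Laplacian.laplacian Φ x + z * Φ x = n ∧
      fderiv ℝ Φ x (‖x‖⁻¹ • x) = radialSlope z a A α n ‖x‖ := by
  obtain ⟨Φ, h1, h2⟩ := exists_contDiff_eq_radial (contDiffOn_radialValue z a A α n) hc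
  refine ⟨Φ, h1, fun x hx => ?_⟩
  have hx0 : x ≠ 0 := norm_pos_iff.1 (hc.trans hx)
  have he : Φ =ᶠ[𝓝 x] fun y => radialValue z a A α n ‖y‖ := by
    filter_upwards [(isOpen_lt continuous_const continuous_norm).mem_nhds hx] with y hy
    exact h2 y hy
  refine ⟨h2 x hx, ?_, ?_⟩
  · rw [(InnerProductSpace.laplacian_congr_nhds he).eq_of_nhds, h2 x hx]
    exact laplacian_radialValue z a A α n hx0
  · rw [he.fderiv_eq]
    have := fderiv_radial_self hx0 (hasDerivAt_radialValue z a A α n (norm_pos_iff.2 hx0))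
    exact this

end

namespace NestedShells

variable {N : ℕ} {S : NestedShells N}

/-! ### Green's formulas -/

lemma integrable_trace_mul {g : UnitSphere → ℂ} (hg : MemLp g 2 surfaceMeasure)
    {h : UnitSphere → ℂ} (hh : Continuous h) :
    Integrable (fun θ => g θ * h θ) surfaceMeasure := by
  obtain ⟨C, hC⟩ := isCompact_univ.exists_bound_of_continuousOn hh.continuousOn
  exact MemLp.integrable_mul (q := 2) hg
    (MemLp.of_bound hh.aestronglyMeasurable C (Eventually.of_forall fun θ => hC θ trivial))

lemma continuous_normal_partial {φ : Space → ℂ} (hφ : ContDiff ℝ (⊤ : ℕ∞) φ) (R : ℝ) (e : Space) :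
    Continuous fun θ : UnitSphere => fderiv ℝ φ (R • (θ : Space)) e :=
  (continuous_partial hφ e).comp (by fun_prop)

lemma contDiff_partial {φ : Space → ℂ} (hφ : ContDiff ℝ (⊤ : ℕ∞) φ) (e : Space) :
    ContDiff ℝ (⊤ : ℕ∞) fun x => fderiv ℝ φ x e :=
  (hφ.fderiv_right (m := (⊤ : ℕ∞)) (by simp)).clm_apply contDiff_const

lemma sphereIntegral_normal {g : UnitSphere → ℂ} (hg : MemLp g 2 surfaceMeasure) {φ : Space → ℂ}
    (hφ : ContDiff ℝ (⊤ : ℕ∞) φ) (R : ℝ) :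
    sphereIntegral R (fun θ => g θ * fderiv ℝ φ (R • (θ : Space)) θ)
      = ∑ k : Fin 3, sphereIntegral R (fun θ =>
          g θ * fderiv ℝ φ (R • (θ : Space)) (EuclideanSpace.single k 1) * ((θ : Space) k : ℂ)) := by
  unfold sphereIntegral
  rw [← Finset.smul_sum, ← integral_finsetSum]
  · congr 2
    funext θ
    beta_reduce
    rw [fderiv_apply_eq_sum, Finset.mul_sum]
    exact Finset.sum_congr rfl fun k _ => by ring
  · intro k _
    have hc : Continuous fun θ : UnitSphere => fderiv ℝ φ (R • (θ : Space))
        (EuclideanSpace.single k 1) * (((θ : Space) k : ℝ) : ℂ) :=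
      (continuous_normal_partial hφ R _).mul (by fun_prop)
    simpa [mul_assoc] using integrable_trace_mul hg hc

lemma contDiff_laplacian_continuous {φ : Space → ℂ} (hφ : ContDiff ℝ (⊤ : ℕ∞) φ) :
    Continuous (Laplacian.laplacian φ) := by
  have : Laplacian.laplacian φ = fun x => ∑ k : Fin 3,
      fderiv ℝ (fun y => fderiv ℝ φ y (EuclideanSpace.single k 1)) x (EuclideanSpace.single k 1) := by
    funext x
    exact laplacian_eq_sum (hφ.contDiffAt.of_le two_le_infty)
  rw [this]
  exact continuous_finsetSum _ fun k _ => continuous_partial (contDiff_partial hφ _) _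

/-- Green's first formula in a shell. -/
lemma IsTrace.green {w : S.H1} {g : Fin N → Side → UnitSphere → ℂ} (hw : S.IsTrace w g)
    {φ : Space → ℂ} (hφ : ContDiff ℝ (⊤ : ℕ∞) φ) (i : Fin N) :
    ∫ x in S.shell i, (S.fn w x * Laplacian.laplacian φ x
        + ∑ k, S.grad w x k * fderiv ℝ φ x (EuclideanSpace.single k 1))
      = sphereIntegral (S.rplus i) (fun θ => g i Side.plus θ * fderiv ℝ φ (S.rplus i • (θ : Space)) θ)
        - sphereIntegral (S.rminus i)
          (fun θ => g i Side.minus θ * fderiv ℝ φ (S.rminus i • (θ : Space)) θ) := by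
  rw [sphereIntegral_normal (hw.1 i _) hφ, sphereIntegral_normal (hw.1 i _) hφ,
    ← Finset.sum_sub_distrib]
  -- The defining identity of the trace is applied to each partial derivative of φ in its own
  -- direction; the sum yields the Laplacian.
  have h := fun k => hw.2 i _ (contDiff_partial hφ (EuclideanSpace.single k 1)) k
  rw [← Finset.sum_congr rfl fun k _ => h k, ← integral_finsetSum]
  · refine integral_congr_ae (Eventually.of_forall fun x => ?_)
    simp only
    rw [laplacian_eq_sum (hφ.contDiffAt.of_le two_le_infty), Finset.sum_add_distrib,
      Finset.mul_sum]
  · intro k _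
    exact (S.integrableOn_fn_mul w (continuous_partial (contDiff_partial hφ _) _) i).add
      (S.integrableOn_grad_mul w (continuous_partial hφ _) i k)

lemma fderiv_conj {φ : Space → ℂ} (x e : Space) :
    fderiv ℝ (fun y => conj (φ y)) x e = conj (fderiv ℝ φ x e) := by
  have := ContinuousLinearEquiv.comp_fderiv (𝕜 := ℝ) Complex.conjCLE (f := φ) (x := x)
  exact congrArg (fun L : Space →L[ℝ] ℂ => L e) this

lemma laplacian_conj {φ : Space → ℂ} (hφ : ContDiff ℝ (⊤ : ℕ∞) φ) (x : Space) :
    Laplacian.laplacian (fun y => conj (φ y)) x = conj (Laplacian.laplacian φ x) := by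
  have h2 : ContDiff ℝ (⊤ : ℕ∞) fun y => conj (φ y) := Complex.conjCLE.contDiff.comp hφ
  rw [laplacian_eq_sum (h2.contDiffAt.of_le two_le_infty),
    laplacian_eq_sum (hφ.contDiffAt.of_le two_le_infty), map_sum]
  refine Finset.sum_congr rfl fun k _ => ?_
  simp only [fderiv_conj]

lemma conj_sphereIntegral (R : ℝ) (h : UnitSphere → ℂ) :
    conj (sphereIntegral R h) = sphereIntegral R fun θ => conj (h θ) := by
  unfold sphereIntegral
  rw [integral_conj, Complex.real_smul, Complex.real_smul, map_mul, Complex.conj_ofReal]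

lemma sphereIntegral_mul_const (R : ℝ) (h : UnitSphere → ℂ) (c : ℂ) :
    sphereIntegral R (fun θ => h θ * c) = sphereIntegral R h * c := by
  unfold sphereIntegral
  rw [integral_mul_const, smul_mul_assoc]

/-- Green's first formula with the conjugate of an element of `H¹(D)`. -/
lemma IsTrace.green_conj {w : S.H1} {g : Fin N → Side → UnitSphere → ℂ} (hw : S.IsTrace w g)
    {φ : Space → ℂ} (hφ : ContDiff ℝ (⊤ : ℕ∞) φ) (i : Fin N) :
    ∫ x in S.shell i, (conj (S.fn w x) * Laplacian.laplacian φ x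
        + ∑ k, conj (S.grad w x k) * fderiv ℝ φ x (EuclideanSpace.single k 1))
      = sphereIntegral (S.rplus i)
          (fun θ => conj (g i Side.plus θ) * fderiv ℝ φ (S.rplus i • (θ : Space)) θ)
        - sphereIntegral (S.rminus i)
          (fun θ => conj (g i Side.minus θ) * fderiv ℝ φ (S.rminus i • (θ : Space)) θ) := by
  have h2 : ContDiff ℝ (⊤ : ℕ∞) fun y => conj (φ y) := Complex.conjCLE.contDiff.comp hφ
  have h := congrArg conj (hw.green h2 i)
  rw [← integral_conj, map_sub, conj_sphereIntegral, conj_sphereIntegral] at h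
  simp only [map_add, map_mul, map_sum, laplacian_conj hφ, fderiv_conj, Complex.conj_conj] at h
  exact h

lemma inner_grad (w u : S.H1) (x : Space) : inner ℂ (S.grad w x) (S.grad u x)
    = ∑ k, conj (S.grad w x k) * S.grad u x k := by
  rw [PiLp.inner_apply]
  exact Finset.sum_congr rfl fun k _ => by rw [RCLike.inner_apply, mul_comm]

end NestedShells

/-! ### Functions orthogonal to the range of the Helmholtz operator -/

open scoped FourierTransform in
-- Every test function is the Fourier transform of a Schwartz function. Moving the transform onto h
-- makes the pairing vanish, and the fundamental lemma concludes.
lemma ae_eq_zero_of_fourier {h : Space → ℂ} (hh : Integrable h) (h0 : ∀ᵐ ξ, 𝓕 h ξ = 0) :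
    ∀ᵐ x, h x = 0 := by
  refine ae_eq_zero_of_integral_contDiff_smul_eq_zero hh.locallyIntegrable ?_
  intro g hg hc
  have h1 : ContDiff ℝ (⊤ : ℕ∞) fun x => (g x : ℂ) := Complex.ofRealCLM.contDiff.comp hg
  have h2 : HasCompactSupport fun x => (g x : ℂ) :=
    hc.comp_left (g := fun y : ℝ => (y : ℂ)) (by simp)
  set s : SchwartzMap Space ℂ := h2.toSchwartzMap h1 with hs
  have hinv : 𝓕 (𝓕⁻ s) = s := FourierTransform.fourier_fourierInv_eq s
  have hco : 𝓕 ((𝓕⁻ s : SchwartzMap Space ℂ) : Space → ℂ) = (s : Space → ℂ) := by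
    rw [← SchwartzMap.fourier_coe, hinv]
  have key := VectorFourier.integral_fourierIntegral_smul_eq_flip (L := innerₗ Space)
      Real.continuous_fourierChar continuous_inner hh ((𝓕⁻ s : SchwartzMap Space ℂ).integrable
        (μ := volume))
  have hz : ∫ ξ, (VectorFourier.fourierIntegral Real.fourierChar volume (innerₗ Space) h ξ)
      • ((𝓕⁻ s : SchwartzMap Space ℂ) ξ) = 0 := by
    refine integral_eq_zero_of_ae ?_
    filter_upwards [h0] with ξ hξ
    have : VectorFourier.fourierIntegral Real.fourierChar volume (innerₗ Space) h ξ = 0 := hξ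
    rw [this]
    simp
  rw [hz, flip_innerₗ] at key
  refine Eq.trans ?_ key.symm
  refine integral_congr_ae (Eventually.of_forall fun x => ?_)
  have : VectorFourier.fourierIntegral Real.fourierChar volume (innerₗ Space)
      ((𝓕⁻ s : SchwartzMap Space ℂ) : Space → ℂ) x = s x := congrFun hco x
  simp only [this]
  rw [smul_eq_mul, mul_comm, Complex.real_smul]
  rfl

/-- The plane wave with frequency `ξ`. -/
def planeWave (ξ x : Space) : ℂ := Complex.exp ((↑(-2 * Real.pi * inner ℝ x ξ) * Complex.I))

lemma hasFDerivAt_planeWave (ξ x : Space) : HasFDerivAt (planeWave ξ)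
    ((planeWave ξ x * (-2 * Real.pi * Complex.I)) •
      (Complex.ofRealCLM.comp (innerSL ℝ ξ))) x := by
  have h1 : HasFDerivAt (fun x : Space => ((-2 * Real.pi * inner ℝ x ξ : ℝ) : ℂ) * Complex.I)
      ((-2 * Real.pi * Complex.I) • (Complex.ofRealCLM.comp (innerSL ℝ ξ))) x := by
    have h : HasFDerivAt (fun x : Space => ((-2 * Real.pi * Complex.I) •
        (Complex.ofRealCLM.comp (innerSL ℝ ξ))) x)
        ((-2 * Real.pi * Complex.I) • (Complex.ofRealCLM.comp (innerSL ℝ ξ))) x :=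
      ContinuousLinearMap.hasFDerivAt _
    refine h.congr_of_eventuallyEq (Eventually.of_forall fun y => ?_)
    simp [real_inner_comm]
    ring
  have := h1.cexp
  rw [smul_smul] at this
  exact this

lemma contDiff_planeWave (ξ : Space) : ContDiff ℝ (⊤ : ℕ∞) (planeWave ξ) := by
  unfold planeWave
  refine Complex.contDiff_exp.comp (ContDiff.mul ?_ contDiff_const)
  exact Complex.ofRealCLM.contDiff.comp (contDiff_const.mul (contDiff_id.inner ℝ contDiff_const))

lemma fderiv_planeWave (ξ x : Space) (k : Fin 3) :
    fderiv ℝ (planeWave ξ) x (EuclideanSpace.single k 1)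
      = (-2 * Real.pi * Complex.I * ξ k) * planeWave ξ x := by
  rw [(hasFDerivAt_planeWave ξ x).fderiv]
  have : inner ℝ ξ (EuclideanSpace.single k 1) = ξ k := inner_single ξ k
  simp [this]
  ring

lemma laplacian_planeWave (ξ x : Space) :
    Laplacian.laplacian (planeWave ξ) x = -(4 * Real.pi ^ 2 * ‖ξ‖ ^ 2 : ℂ) * planeWave ξ x := by
  rw [laplacian_eq_sum ((contDiff_planeWave ξ).contDiffAt.of_le two_le_infty)]
  have hd : DifferentiableAt ℝ (planeWave ξ) x := (hasFDerivAt_planeWave ξ x).differentiableAt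
  have hk : ∀ k : Fin 3, fderiv ℝ (fun y => fderiv ℝ (planeWave ξ) y (EuclideanSpace.single k 1))
      x (EuclideanSpace.single k 1) = (-4 * Real.pi ^ 2 * planeWave ξ x) * (ξ k : ℂ) ^ 2 := by
    intro k
    simp_rw [fderiv_planeWave]
    rw [fderiv_const_mul hd, smul_apply, fderiv_planeWave, smul_eq_mul]
    linear_combination (4 * Real.pi ^ 2 * (ξ k : ℂ) ^ 2 * planeWave ξ x) * Complex.I_sq
  rw [Finset.sum_congr rfl fun k _ => hk k, ← Finset.mul_sum, sum_coord_sq]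
  ring

open scoped FourierTransform in
/-- An integrable function on `Ω` that is orthogonal to the range of `Δ + z` vanishes. -/
lemma ae_eq_zero_of_integral_helmholtz {Ω : Set Space} (hΩ : MeasurableSet Ω) {h : Space → ℂ}
    (hh : IntegrableOn h Ω) {z : ℂ} (H : ∀ φ : Space → ℂ, ContDiff ℝ (⊤ : ℕ∞) φ →
      ∫ x in Ω, h x * (Laplacian.laplacian φ x + z * φ x) = 0) :
    ∀ᵐ x ∂volume.restrict Ω, h x = 0 := by
  -- A plane wave is an eigenfunction of Δ + z with eigenvalue z - 4π²‖ξ‖², so whenever this is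
  -- nonzero h is orthogonal to the plane wave itself.
  have hpw : ∀ ξ : Space, (4 * Real.pi ^ 2 * ‖ξ‖ ^ 2 : ℂ) ≠ z → 𝓕 (Ω.indicator h) ξ = 0 := by
    intro ξ hξ
    have h1 := H _ (contDiff_planeWave ξ)
    have h2 : ∫ x in Ω, h x * (Laplacian.laplacian (planeWave ξ) x + z * planeWave ξ x)
        = (z - 4 * Real.pi ^ 2 * ‖ξ‖ ^ 2) * ∫ x in Ω, planeWave ξ x * h x := by
      rw [← integral_const_mul]
      refine integral_congr_ae (Eventually.of_forall fun x => ?_)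
      simp only [laplacian_planeWave]
      ring
    rw [h2, mul_eq_zero] at h1
    rw [Real.fourier_eq', ← h1.resolve_left (sub_ne_zero.2 hξ.symm), ← integral_indicator hΩ]
    refine integral_congr_ae (Eventually.of_forall fun x => ?_)
    by_cases hx : x ∈ Ω <;> simp [hx, planeWave]
  -- The excluded frequencies lie on one sphere, a null set; if z is not a nonnegative real number
  -- there are none.
  have hsph : ∀ᵐ ξ : Space, (4 * Real.pi ^ 2 * ‖ξ‖ ^ 2 : ℂ) ≠ z := by
    have h0 : volume (Metric.sphere (0 : Space) (Real.sqrt (z.re / (4 * Real.pi ^ 2)))) = 0 :=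
      Measure.addHaar_sphere volume _ _
    refine measure_mono_null ?_ h0
    intro ξ hξ
    simp only [ne_eq, Set.mem_compl_iff, Set.mem_ofPred_eq, not_not] at hξ
    have hre : 4 * Real.pi ^ 2 * ‖ξ‖ ^ 2 = z.re := by
      rw [← hξ]
      norm_cast
    have hpi := Real.pi_pos
    rw [mem_sphere_zero_iff_norm, ← hre, mul_div_cancel_left₀ _ (by positivity),
      Real.sqrt_sq (norm_nonneg _)]
  have := ae_eq_zero_of_fourier (hh.integrable_indicator hΩ) (hsph.mono fun ξ hξ => hpw ξ hξ)
  rw [ae_restrict_iff' hΩ]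
  filter_upwards [this] with x hx hxΩ
  rwa [Set.indicator_of_mem hxΩ] at hx

namespace NestedShells

variable {N : ℕ} {S : NestedShells N}

/-! ### Characterization of the auxiliary solutions -/

lemma memLp_conj_fn (w : S.H1) (i : Fin N) :
    MemLp (fun x => conj (S.fn w x)) 2 (volume.restrict (S.shell i)) := (S.memLp_fn w i).star

lemma integrableOn_conj_fn_mul (w : S.H1) {φ : Space → ℂ} (hφ : Continuous φ) (i : Fin N) :
    IntegrableOn (fun x => conj (S.fn w x) * φ x) (S.shell i) :=
  MemLp.integrable_mul (q := 2) (memLp_conj_fn w i) (S.memLp_shell_of_continuous hφ i)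

lemma integrableOn_conj_grad_mul (w : S.H1) {φ : Space → ℂ} (hφ : Continuous φ) (i : Fin N)
    (k : Fin 3) : IntegrableOn (fun x => conj (S.grad w x k) * φ x) (S.shell i) :=
  MemLp.integrable_mul (q := 2) (S.memLp_grad w i k).star (S.memLp_shell_of_continuous hφ i)

/-- The sesquilinear form on a shell for a radial solution. -/
lemma integral_form_radial {w : S.H1} {g : Fin N → Side → UnitSphere → ℂ} (hw : S.IsTrace w g)
    {u : S.H1} {i : Fin N} {z A α n : ℂ}
    (hu : ∀ᵐ x ∂volume.restrict (S.shell i),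
      S.fn u x = radialValue z (S.rminus i) A α n ‖x‖ ∧ ∀ k, S.grad u x k = fderiv ℝ
        (fun y : Space => radialValue z (S.rminus i) A α n ‖y‖) x (EuclideanSpace.single k 1)) :
    ∫ x in S.shell i, (inner ℂ (S.grad w x) (S.grad u x) - z * (S.fn u x * conj (S.fn w x)))
      = sphereIntegral (S.rplus i) (fun θ => conj (g i Side.plus θ))
          * radialSlope z (S.rminus i) A α n (S.rplus i)
        - sphereIntegral (S.rminus i) (fun θ => conj (g i Side.minus θ)) * α
        - n * ∫ x in S.shell i, conj (S.fn w x) := by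
  have hr := S.rminus_pos i
  have hR := S.rminus_lt_rplus i
  -- Green's formula needs a globally smooth function. Half of the inner radius as threshold makes Φ
  -- coincide with the radial solution in a neighbourhood of the closed shell.
  obtain ⟨Φ, hΦ, hΦr⟩ := exists_contDiff_eq_radialValue z (S.rminus i) A α n (half_pos hr)
  have hg := hw.green_conj hΦ i
  have hs : ∀ (R : ℝ), S.rminus i ≤ R → ∀ θ : UnitSphere, fderiv ℝ Φ (R • (θ : Space)) θ
      = radialSlope z (S.rminus i) A α n R := by
    intro R hRr θ
    have hR0 : 0 < R := hr.trans_le hRr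
    have hn := norm_smul_unitSphere hR0.le θ
    have := (hΦr (R • (θ : Space)) (by rw [hn]; linarith)).2.2
    rwa [hn, smul_smul, inv_mul_cancel₀ hR0.ne', one_smul] at this
  simp only [hs _ hR.le, hs _ le_rfl, radialSlope_self z A α n hr] at hg
  rw [sphereIntegral_mul_const, sphereIntegral_mul_const] at hg
  rw [← hg, ← integral_const_mul, ← integral_sub]
  · refine integral_congr_ae ?_
    filter_upwards [hu, ae_restrict_mem (S.measurableSet_shell i)] with x hx hxi
    have hxr : S.rminus i / 2 < ‖x‖ := by linarith [hxi.1]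
    obtain ⟨e1, e2, -⟩ := hΦr x hxr
    have he : Φ =ᶠ[𝓝 x] fun y => radialValue z (S.rminus i) A α n ‖y‖ := by
      filter_upwards [(isOpen_lt continuous_const continuous_norm).mem_nhds hxr] with y hy
      exact (hΦr y hy).1
    rw [inner_grad, he.fderiv_eq, hx.1, ← e1]
    simp only [hx.2]
    linear_combination (-conj (S.fn w x)) * e2
  · refine (integrableOn_conj_fn_mul w (contDiff_laplacian_continuous hΦ) i).add
      (integrable_finsetSum _ fun k _ => integrableOn_conj_grad_mul w (continuous_partial hΦ _) i k)
  · have := integrableOn_conj_fn_mul w (φ := fun _ => 1) continuous_const i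
    simp only [mul_one] at this
    exact this.const_mul n

lemma exists_represents_radial (S : NestedShells N) (z : ℂ) (A α n : Fin N → ℂ) : ∃ u : S.H1,
    S.Represents u (fun i x => radialValue z (S.rminus i) (A i) (α i) (n i) ‖x‖) ∧
    S.IsTrace u fun i s _ => radialValue z (S.rminus i) (A i) (α i) (n i) (S.radius i s) := by
  choose Φ hΦ hΦr using fun i =>
    exists_contDiff_eq_radialValue z (S.rminus i) (A i) (α i) (n i) (half_pos (S.rminus_pos i))
  obtain ⟨u, hu⟩ := S.exists_represents hΦ
  have hrad : ∀ i s, S.rminus i ≤ S.radius i s := by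
    rintro i (_ | _)
    · exact (S.rminus_lt_rplus i).le
    · exact le_rfl
  refine ⟨u, hu.congr fun i x hx => (hΦr i x (by linarith [hx.1, S.rminus_pos i])).1, ?_⟩
  have ht := hu.isTrace hΦ
  have he : (fun i s (θ : UnitSphere) => Φ i (S.radius i s • (θ : Space))) = fun i s _ =>
      radialValue z (S.rminus i) (A i) (α i) (n i) (S.radius i s) := by
    funext i s θ
    have hr := S.rminus_pos i
    have hn := norm_smul_unitSphere (hr.le.trans (hrad i s)) θ
    rw [(hΦr i (S.radius i s • (θ : Space)) (by rw [hn]; linarith [hrad i s])).1, hn]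
  rwa [he] at ht

/-- An element of `H¹(D)` that equals `φ` on the `i`-th shell and vanishes on the others. -/
lemma exists_represents_single (S : NestedShells N) (i : Fin N) {φ : Space → ℂ}
    (hφ : ContDiff ℝ (⊤ : ℕ∞) φ) :
    ∃ w : S.H1, S.Represents w (fun l x => if l = i then φ x else 0) ∧
      S.IsTrace w fun l s θ => if l = i then φ (S.radius l s • (θ : Space)) else 0 := by
  have h : ∀ l, ContDiff ℝ (⊤ : ℕ∞) fun x => if l = i then φ x else 0 := fun l => by
    split_ifs
    · exact hφ
    · exact contDiff_const
  obtain ⟨w, hw⟩ := S.exists_represents h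
  exact ⟨w, hw, hw.isTrace h⟩

/-- Green's formula turns the sesquilinear form on a shell into the very weak form of the
Helmholtz operator. -/
lemma IsTrace.integral_form {u : S.H1} {f : Fin N → Side → ℂ} (ht : S.IsTrace u fun i s _ => f i s)
    {φ : Space → ℂ} (hφ : ContDiff ℝ (⊤ : ℕ∞) φ) {i : Fin N} {w : S.H1}
    (hw : S.Represents w fun l x => if l = i then conj (φ x) else 0) (z : ℂ) :
    ∫ x in S.shell i, (inner ℂ (S.grad w x) (S.grad u x) - z * (S.fn u x * conj (S.fn w x)))
      = sphereIntegral (S.rplus i) (fun θ => fderiv ℝ φ (S.rplus i • (θ : Space)) θ) * f i Side.plus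
        - sphereIntegral (S.rminus i) (fun θ => fderiv ℝ φ (S.rminus i • (θ : Space)) θ)
          * f i Side.minus
        - ∫ x in S.shell i, S.fn u x * (Laplacian.laplacian φ x + z * φ x) := by
  have hg := ht.green hφ i
  simp only [mul_comm (f i _)] at hg
  rw [sphereIntegral_mul_const, sphereIntegral_mul_const] at hg
  have hL := contDiff_laplacian_continuous hφ
  rw [← hg, ← integral_sub]
  · refine integral_congr_ae ?_
    filter_upwards [hw i] with x hx
    rw [inner_grad, hx.1]
    simp only [hx.2, if_true, fderiv_conj, Complex.conj_conj]
    rw [Finset.sum_congr rfl fun k _ => mul_comm (S.grad u x k) _]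
    ring
  · exact (S.integrableOn_fn_mul u hL i).add
      (integrable_finsetSum _ fun k _ => S.integrableOn_grad_mul u (continuous_partial hφ _) i k)
  · exact S.integrableOn_fn_mul u (hL.add (continuous_const.mul hφ.continuous)) i

/-- Uniqueness for the Helmholtz equation with vanishing data on the inner sphere. -/
lemma eq_zero_of_integral_helmholtz {h : Space → ℂ} {i : Fin N} (hh : IntegrableOn h (S.shell i))
    {z p q : ℂ} (H : ∀ φ : Space → ℂ, ContDiff ℝ (⊤ : ℕ∞) φ →
      ∫ x in S.shell i, h x * (Laplacian.laplacian φ x + z * φ x)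
        = sphereIntegral (S.rplus i) (fun θ => fderiv ℝ φ (S.rplus i • (θ : Space)) θ) * p
          - sphereIntegral (S.rplus i) (fun θ => φ (S.rplus i • (θ : Space))) * q) :
    p = 0 ∧ q = 0 ∧ ∀ᵐ x ∂volume.restrict (S.shell i), h x = 0 := by
  -- The test function is the radial solution of the homogeneous equation with Cauchy data B, β on
  -- the outer sphere: the left side vanishes, and arbitrary data separate p from q.
  have hb : ∀ B β : ℂ, sphereIntegral (S.rplus i) (fun _ => β) * p
        - sphereIntegral (S.rplus i) (fun _ => B) * q = 0 := by
    intro B β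
    have hr := S.rminus_pos i
    have hR := S.rminus_lt_rplus i
    obtain ⟨Φ, hΦ, hΦr⟩ := exists_contDiff_eq_radialValue z (S.rplus i) B β 0 (half_pos hr)
    have h0 := H Φ hΦ
    have hnm := fun θ => norm_smul_unitSphere (hr.trans hR).le θ
    have s1 : ∀ θ : UnitSphere, Φ (S.rplus i • (θ : Space)) = B := fun θ => by
      rw [(hΦr (S.rplus i • (θ : Space)) (by rw [hnm]; linarith)).1, hnm,
        radialValue_self z _ _ _ (hr.trans hR)]
    have s2 : ∀ θ : UnitSphere, fderiv ℝ Φ (S.rplus i • (θ : Space)) θ = β := fun θ => by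
      have := (hΦr (S.rplus i • (θ : Space)) (by rw [hnm]; linarith)).2.2
      rwa [hnm, smul_smul, inv_mul_cancel₀ (hr.trans hR).ne', one_smul,
        radialSlope_self z _ _ _ (hr.trans hR)] at this
    simp only [s1, s2] at h0
    rw [← h0]
    refine integral_eq_zero_of_ae ?_
    filter_upwards [ae_restrict_mem (S.measurableSet_shell i)] with x hx
    rw [(hΦr x (by linarith [hx.1])).2.1]
    simp
  have hpos : sphereIntegral (S.rplus i) (fun _ : UnitSphere => (1 : ℂ)) ≠ 0 := by
    unfold sphereIntegral
    rw [integral_surfaceMeasure_const]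
    have := (S.rplus_pos i).ne'
    simp [this, Real.pi_ne_zero]
  have hzero : sphereIntegral (S.rplus i) (fun _ : UnitSphere => (0 : ℂ)) = 0 := by
    simp [sphereIntegral]
  have hp : p = 0 := by
    have := hb 0 1
    rw [hzero, zero_mul, sub_zero] at this
    exact (mul_eq_zero.1 this).resolve_left hpos
  have hq : q = 0 := by
    have := hb 1 0
    rw [hzero, zero_mul, zero_sub, neg_eq_zero] at this
    exact (mul_eq_zero.1 this).resolve_left hpos
  refine ⟨hp, hq, ae_eq_zero_of_integral_helmholtz (S.measurableSet_shell i) hh (z := z) fun φ hφ => ?_⟩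
  rw [H φ hφ, hp, hq, mul_zero, mul_zero, sub_zero]

variable [NeZero N]

/-- A sufficient condition for a piecewise radial function to be an auxiliary solution. -/
theorem isAuxiliarySolution_of_radial {v vr : ℝ} {ω : ℂ} {δ : ℝ} (hk : S.Nonresonant (ω / v))
    {j : Fin N} {u : S.H1} {n : Fin N → ℂ} {f : Fin N → Side → ℂ}
    (hu : S.Represents u fun i x => radialValue (ω ^ 2 / (vr : ℂ) ^ 2) (S.rminus i)
      (f i Side.minus) (δ * S.dtnMap (ω / v) f i Side.minus) (n i) ‖x‖)
    (ht : S.IsTrace u fun i s _ => f i s)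
    (hs : ∀ i, radialSlope (ω ^ 2 / (vr : ℂ) ^ 2) (S.rminus i) (f i Side.minus)
      (δ * S.dtnMap (ω / v) f i Side.minus) (n i) (S.rplus i)
        = δ * S.dtnMap (ω / v) f i Side.plus)
    (hn : ∀ i, n i = S.shellIntegral i u - if i = j then 1 else 0) :
    S.IsAuxiliarySolution v vr ω δ j u := by
  refine ⟨f, ht, fun w g hw => ?_⟩
  have hm : ∀ i, ∫ x in S.shell i, S.fn u x = n i + if i = j then 1 else 0 := fun i => by
    rw [hn i]
    simp [shellIntegral]
  unfold modifiedForm form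
  rw [S.dtn_eq_dtnMap hk, Finset.mul_sum, ← Finset.sum_sub_distrib, ← Finset.sum_add_distrib]
  have : ∀ i ∈ Finset.univ, (∫ x in S.shell i, (inner ℂ (S.grad w x) (S.grad u x)
        - ω ^ 2 / (vr : ℂ) ^ 2 * (S.fn u x * conj (S.fn w x))))
      - δ * (sphereIntegral (S.rplus i)
        (fun θ => conj (g i Side.plus θ) * S.dtnMap (ω / v) f i Side.plus)
      - sphereIntegral (S.rminus i)
        (fun θ => conj (g i Side.minus θ) * S.dtnMap (ω / v) f i Side.minus))
      + (∫ x in S.shell i, S.fn u x) * ∫ x in S.shell i, conj (S.fn w x)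
      = if i = j then ∫ x in S.shell i, conj (S.fn w x) else 0 := by
    intro i _
    rw [integral_form_radial hw (hu i), hs i, sphereIntegral_mul_const, sphereIntegral_mul_const,
      hm i]
    split_ifs
    · ring
    · ring
  rw [Finset.sum_congr rfl this]
  simp

/-- The equation for an auxiliary solution, tested with a function that lives on one shell. -/
lemma integral_form_of_isAuxiliarySolution {v vr : ℝ} {ω : ℂ} {δ : ℝ} (hk : S.Nonresonant (ω / v))
    {j : Fin N} {u : S.H1} {f : Fin N → Side → ℂ}
    (hu : ∀ (w : S.H1) (g : Fin N → Side → UnitSphere → ℂ), S.IsTrace w g →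
      S.modifiedForm v vr ω δ u f w g = ∫ x in S.shell j, conj (S.fn w x)) {i : Fin N}
    {φ : Space → ℂ} {w : S.H1} (hw : S.Represents w fun l x => if l = i then conj (φ x) else 0)
    (hwt : S.IsTrace w fun l s θ => if l = i then conj (φ (S.radius l s • (θ : Space))) else 0) :
    ∫ x in S.shell i, (inner ℂ (S.grad w x) (S.grad u x)
        - ω ^ 2 / (vr : ℂ) ^ 2 * (S.fn u x * conj (S.fn w x)))
      = sphereIntegral (S.rplus i) (fun θ => φ (S.rplus i • (θ : Space)))
          * (δ * S.dtnMap (ω / v) f i Side.plus)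
        - sphereIntegral (S.rminus i) (fun θ => φ (S.rminus i • (θ : Space)))
          * (δ * S.dtnMap (ω / v) f i Side.minus)
        - (S.shellIntegral i u - if i = j then 1 else 0) * ∫ x in S.shell i, φ x := by
  have h := hu w _ hwt
  unfold modifiedForm form at h
  rw [S.dtn_eq_dtnMap hk, Finset.mul_sum, ← Finset.sum_sub_distrib, ← Finset.sum_add_distrib,
    Finset.sum_eq_single i] at h
  · have e1 : ∀ l, ∫ x in S.shell l, conj (S.fn w x)
        = if l = i then ∫ x in S.shell i, φ x else 0 := by
      intro l
      split_ifs with hl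
      · subst hl
        refine integral_congr_ae ?_
        filter_upwards [hw l] with x hx
        rw [hx.1]
        simp
      · refine integral_eq_zero_of_ae ?_
        filter_upwards [hw l] with x hx
        rw [hx.1]
        simp [hl]
    rw [e1, e1] at h
    simp only [if_true, Complex.conj_conj, radius] at h
    rw [sphereIntegral_mul_const, sphereIntegral_mul_const] at h
    have e2 : (if j = i then ∫ x in S.shell i, φ x else 0)
        = (if i = j then 1 else 0) * ∫ x in S.shell i, φ x := by
      simp [eq_comm]
    rw [e2] at h
    have e3 : S.shellIntegral i u = ∫ x in S.shell i, S.fn u x := rfl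
    rw [e3]
    linear_combination h
  · intro l _ hl
    have e1 : ∫ x in S.shell l, (inner ℂ (S.grad w x) (S.grad u x)
        - ω ^ 2 / (vr : ℂ) ^ 2 * (S.fn u x * conj (S.fn w x))) = 0 := by
      refine integral_eq_zero_of_ae ?_
      filter_upwards [hw l] with x hx
      rw [inner_grad, hx.1]
      simp only [hx.2, hl]
      simp
    have e2 : ∫ x in S.shell l, conj (S.fn w x) = 0 := by
      refine integral_eq_zero_of_ae ?_
      filter_upwards [hw l] with x hx
      rw [hx.1]
      simp [hl]
    rw [e1, e2]
    simp [hl, sphereIntegral]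
  · simp

/-- Green's formula for the difference of an auxiliary solution and the radial function with the
same data on the inner spheres. -/
lemma integral_sub_radial {v vr : ℝ} {ω : ℂ} {δ : ℝ} (hk : S.Nonresonant (ω / v))
    {j : Fin N} {u U : S.H1} {f : Fin N → Side → ℂ} (ht : S.IsTrace u fun i s _ => f i s)
    (hu : ∀ (w : S.H1) (g : Fin N → Side → UnitSphere → ℂ), S.IsTrace w g →
      S.modifiedForm v vr ω δ u f w g = ∫ x in S.shell j, conj (S.fn w x))
    {z : ℂ} (hz : ω ^ 2 / (vr : ℂ) ^ 2 = z) {A α n : Fin N → ℂ} (hA : ∀ i, f i Side.minus = A i)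
    (hα : ∀ i, δ * S.dtnMap (ω / v) f i Side.minus = α i)
    (hn : ∀ i, (S.shellIntegral i u - if i = j then 1 else 0) = n i)
    (hU : S.Represents U fun i x => radialValue z (S.rminus i) (A i) (α i) (n i) ‖x‖)
    (hUt : S.IsTrace U fun i s _ => radialValue z (S.rminus i) (A i) (α i) (n i) (S.radius i s))
    (i : Fin N) {φ : Space → ℂ} (hφ : ContDiff ℝ (⊤ : ℕ∞) φ) :
    ∫ x in S.shell i, (S.fn u x - S.fn U x) * (Laplacian.laplacian φ x + z * φ x)
      = sphereIntegral (S.rplus i) (fun θ => fderiv ℝ φ (S.rplus i • (θ : Space)) θ)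
          * (f i Side.plus - radialValue z (S.rminus i) (A i) (α i) (n i) (S.rplus i))
        - sphereIntegral (S.rplus i) (fun θ => φ (S.rplus i • (θ : Space)))
          * (δ * S.dtnMap (ω / v) f i Side.plus
            - radialSlope z (S.rminus i) (A i) (α i) (n i) (S.rplus i)) := by
  have hφc : ContDiff ℝ (⊤ : ℕ∞) fun y => conj (φ y) := Complex.conjCLE.contDiff.comp hφ
  obtain ⟨w, hw, hwt⟩ := exists_represents_single S i hφc
  have hc : Continuous fun x => Laplacian.laplacian φ x + z * φ x :=
    (contDiff_laplacian_continuous hφ).add (continuous_const.mul hφ.continuous)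
  have e1 := integral_form_of_isAuxiliarySolution hk hu hw hwt
  rw [ht.integral_form hφ hw, hz, hn, hα, hA] at e1
  have e2 := integral_form_radial hwt (hU i)
  rw [hUt.integral_form hφ hw] at e2
  have e3 : ∫ x in S.shell i, conj (S.fn w x) = ∫ x in S.shell i, φ x := by
    refine integral_congr_ae ?_
    filter_upwards [hw i] with x hx
    rw [hx.1]
    simp
  simp only [if_true, Complex.conj_conj, radius] at e2
  rw [e3, radialValue_self z _ _ _ (S.rminus_pos i)] at e2
  simp only [sub_mul]
  rw [integral_sub (S.integrableOn_fn_mul u hc i) (S.integrableOn_fn_mul U hc i)]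
  linear_combination e2 - e1

/-- Every auxiliary solution is piecewise radial. -/
theorem radial_of_isAuxiliarySolution {v vr : ℝ} {ω : ℂ} {δ : ℝ} (hk : S.Nonresonant (ω / v))
    {j : Fin N} {u : S.H1} (h : S.IsAuxiliarySolution v vr ω δ j u) :
    ∃ (f : Fin N → Side → ℂ) (n : Fin N → ℂ),
      S.Represents u (fun i x => radialValue (ω ^ 2 / (vr : ℂ) ^ 2) (S.rminus i)
        (f i Side.minus) (δ * S.dtnMap (ω / v) f i Side.minus) (n i) ‖x‖) ∧
      (∀ i, radialValue (ω ^ 2 / (vr : ℂ) ^ 2) (S.rminus i) (f i Side.minus)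
        (δ * S.dtnMap (ω / v) f i Side.minus) (n i) (S.rplus i) = f i Side.plus) ∧
      (∀ i, radialSlope (ω ^ 2 / (vr : ℂ) ^ 2) (S.rminus i) (f i Side.minus)
        (δ * S.dtnMap (ω / v) f i Side.minus) (n i) (S.rplus i)
          = δ * S.dtnMap (ω / v) f i Side.plus) ∧
      ∀ i, n i = S.shellIntegral i u - if i = j then 1 else 0 := by
  obtain ⟨f, ht, hu⟩ := h
  obtain ⟨n, hn⟩ : ∃ n : Fin N → ℂ, ∀ i, (S.shellIntegral i u - if i = j then 1 else 0) = n i :=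
    ⟨_, fun _ => rfl⟩
  -- U is the radial solution with the value and the prescribed slope of u on the inner spheres and
  -- with the same source.
  obtain ⟨U, hU, hUt⟩ := exists_represents_radial S (ω ^ 2 / (vr : ℂ) ^ 2)
    (fun i => f i Side.minus) (fun i => δ * S.dtnMap (ω / v) f i Side.minus) n
  -- The inner boundary terms cancel, so only the outer sphere is left. This yields u = U in the
  -- shell and both matching conditions at the outer sphere simultaneously.
  have key := fun i => eq_zero_of_integral_helmholtz
    ((S.integrableOn_fn u i).sub (S.integrableOn_fn U i)) fun φ hφ =>
      integral_sub_radial hk ht hu rfl (fun _ => rfl) (fun _ => rfl) hn hU hUt i hφ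
  have huU : u = U := by
    refine S.ext_of_fn fun i => ?_
    filter_upwards [(key i).2.2] with x hx
    exact sub_eq_zero.1 hx
  rw [← huU] at hU
  exact ⟨f, n, hU, fun i => (sub_eq_zero.1 (key i).1).symm,
    fun i => (sub_eq_zero.1 (key i).2.1).symm, fun i => (hn i).symm⟩

end NestedShells

/-! ### Moments of the radial solutions -/

/-- The contribution of the value at `a` to the mean of a radial solution over a shell. -/
def valueMoment (z : ℂ) (a b : ℝ) : ℂ :=
  a * (b * genTrig 1 z (b - a) - genTrig 2 z (b - a))
    + (b * genTrig 2 z (b - a) - genTrig 3 z (b - a))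

/-- The contribution of the derivative at `a` to the mean of a radial solution over a shell. -/
def slopeMoment (z : ℂ) (a b : ℝ) : ℂ :=
  a * (b * genTrig 2 z (b - a) - genTrig 3 z (b - a))

/-- The contribution of the source term to the mean of a radial solution over a shell. -/
def sourceMoment (z : ℂ) (a b : ℝ) : ℂ :=
  a * (b * genTrig 3 z (b - a) - genTrig 4 z (b - a))
    + (b * genTrig 4 z (b - a) - genTrig 5 z (b - a))

/-- The constant 1 is the radial solution with value 1, slope 0 and source z, so its moment is the
integral of r² from a to b. -/
lemma valueMoment_add (z : ℂ) (a b : ℝ) :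
    valueMoment z a b + z * sourceMoment z a b = (b ^ 3 - a ^ 3) / 3 := by
  have e1 := genTrig_recurrence 1 z (b - a)
  have e2 := genTrig_recurrence 2 z (b - a)
  have e3 := genTrig_recurrence 3 z (b - a)
  simp only [Nat.factorial] at e1 e2 e3
  push_cast at e1 e2 e3
  unfold valueMoment sourceMoment
  linear_combination (a * b : ℂ) * e1 + (b - a : ℂ) * e2 - e3

lemma valueMoment_zero_ne {a b : ℝ} (ha : 0 < a) (hab : a < b) : valueMoment 0 a b ≠ 0 := by
  have h := valueMoment_add 0 a b
  rw [zero_mul, add_zero] at h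
  rw [h]
  have h3 : a ^ 3 < b ^ 3 := pow_lt_pow_left₀ hab ha.le (by norm_num)
  have : ((b ^ 3 - a ^ 3 : ℝ) : ℂ) ≠ 0 := by exact_mod_cast (sub_pos.2 h3).ne'
  push_cast at this
  exact div_ne_zero this (by norm_num)

section
variable (z : ℂ) (a : ℝ)

lemma radialValue_add (A α n A' α' n' : ℂ) (r : ℝ) :
    radialValue z a (A + A') (α + α') (n + n') r
      = radialValue z a A α n r + radialValue z a A' α' n' r := by
  unfold radialValue radialProfile
  ring

lemma radialValue_smul (c A α n : ℂ) (r : ℝ) :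
    radialValue z a (c * A) (c * α) (c * n) r = c * radialValue z a A α n r := by
  unfold radialValue radialProfile
  ring

lemma radialValue_const (c : ℂ) {r : ℝ} (hr : 0 < r) : radialValue z a c 0 (z * c) r = c := by
  have hr' : (r : ℂ) ≠ 0 := by exact_mod_cast hr.ne'
  have e0 := genTrig_recurrence 0 z (r - a)
  have e1 := genTrig_recurrence 1 z (r - a)
  simp only [Nat.factorial] at e0 e1
  push_cast at e0 e1
  unfold radialValue radialProfile
  rw [div_eq_iff hr']
  linear_combination (a * c : ℂ) * e0 + c * e1

/-- This is the divergence theorem for Δe = n - ze over the shell, divided by 4π. -/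
lemma radialSlope_flux {b : ℝ} (hb : 0 < b) (A α n : ℂ) :
    (b : ℂ) ^ 2 * radialSlope z a A α n b - a ^ 2 * α = n * ((b ^ 3 - a ^ 3) / 3)
      - z * (A * valueMoment z a b + α * slopeMoment z a b + n * sourceMoment z a b) := by
  have hb' : (b : ℂ) ≠ 0 := by exact_mod_cast hb.ne'
  have hs : (b : ℂ) ^ 2 * radialSlope z a A α n b
      = b * radialProfileDeriv z a A α n b - radialProfile z a A α n b := by
    unfold radialSlope
    field_simp
  rw [hs]
  have e0 := genTrig_recurrence 0 z (b - a)
  have e1 := genTrig_recurrence 1 z (b - a)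
  have e2 := genTrig_recurrence 2 z (b - a)
  have e3 := genTrig_recurrence 3 z (b - a)
  simp only [Nat.factorial] at e0 e1 e2 e3
  push_cast at e0 e1 e2 e3
  unfold radialProfileDeriv radialProfile valueMoment slopeMoment sourceMoment
  linear_combination ((b - a) * A + a * b * α : ℂ) * e0 + (a * b * n - A - a * α : ℂ) * e1
    + (b - a : ℂ) * n * e2 - n * e3

/-- Integration by parts, using that each order is a primitive of the previous one; this supplies
the antiderivatives behind the moments. -/
lemma hasDerivAt_genTrig_moment (m : ℕ) (r : ℝ) :
    HasDerivAt (fun r : ℝ => (r : ℂ) * genTrig (m + 1) z (r - a) - genTrig (m + 2) z (r - a))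
      (r * genTrig m z (r - a)) r := by
  have h1 : HasDerivAt (fun r : ℝ => (r : ℂ)) 1 r := Complex.ofRealCLM.hasDerivAt
  refine ((h1.mul (hasDerivAt_genTrig_shift m z a r)).sub
    (hasDerivAt_genTrig_shift (m + 1) z a r)).congr_deriv ?_
  ring

variable {a}

lemma integral_mul_radialProfile {b : ℝ} (A α n : ℂ) :
    ∫ r in a..b, (r : ℂ) * radialProfile z a A α n r
      = A * valueMoment z a b + α * slopeMoment z a b + n * sourceMoment z a b := by
  have hd : ∀ r ∈ Set.uIcc a b, HasDerivAt (fun r : ℝ =>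
      a * A * ((r : ℂ) * genTrig 1 z (r - a) - genTrig 2 z (r - a))
      + (A + a * α) * ((r : ℂ) * genTrig 2 z (r - a) - genTrig 3 z (r - a))
      + n * (a * ((r : ℂ) * genTrig 3 z (r - a) - genTrig 4 z (r - a))
        + ((r : ℂ) * genTrig 4 z (r - a) - genTrig 5 z (r - a))))
      ((r : ℂ) * radialProfile z a A α n r) r := by
    intro r _
    refine ((((hasDerivAt_genTrig_moment z a 0 r).const_mul (a * A : ℂ)).add
      ((hasDerivAt_genTrig_moment z a 1 r).const_mul (A + a * α))).add
      ((((hasDerivAt_genTrig_moment z a 2 r).const_mul (a : ℂ)).add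
        (hasDerivAt_genTrig_moment z a 3 r)).const_mul n)).congr_deriv ?_
    unfold radialProfile
    ring
  rw [intervalIntegral.integral_eq_sub_of_hasDerivAt hd
    ((Complex.continuous_ofReal.mul (contDiff_radialProfile z a A α n).continuous).intervalIntegrable
      _ _)]
  simp only [sub_self, genTrig_succ_zero_right]
  unfold valueMoment slopeMoment sourceMoment
  ring

lemma integral_radialValue {b : ℝ} (ha : 0 < a) (hab : a < b) (A α n : ℂ) :
    ∫ x in annulus a b, radialValue z a A α n ‖x‖
      = 4 * Real.pi * (A * valueMoment z a b + α * slopeMoment z a b + n * sourceMoment z a b) := by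
  obtain ⟨Φ, hΦ, hΦr⟩ := exists_contDiff_eq_radialValue z a A α n (half_pos ha)
  have hmeas : MeasurableSet (annulus a b) := (isOpen_annulus a b).measurableSet
  have hint : IntegrableOn (fun x : Space => radialValue z a A α n ‖x‖) (annulus a b) := by
    have h1 : IntegrableOn Φ (annulus a b) :=
      (hΦ.continuous.continuousOn.integrableOn_compact
        (isCompact_closedBall (0 : Space) b)).mono_set fun x hx => by simpa using hx.2.le
    refine h1.congr_fun (fun x hx => (hΦr x ?_).1) hmeas
    have := hx.1
    linarith
  rw [integral_annulus ha.le hint, ← integral_mul_radialProfile, ← intervalIntegral.integral_const_mul,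
    intervalIntegral.integral_of_le hab.le, integral_Ioc_eq_integral_Ioo]
  refine setIntegral_congr_fun measurableSet_Ioo fun r hr => ?_
  have hr0 : 0 < r := ha.trans hr.1
  have hr' : (r : ℂ) ≠ 0 := by exact_mod_cast hr0.ne'
  simp only [norm_smul_unitSphere hr0.le]
  rw [integral_surfaceMeasure_const, radialValue]
  push_cast
  field_simp

end

namespace NestedShells

variable {N : ℕ} (S : NestedShells N)

/-! ### The Neumann problem in the shells -/

/-- The source term of the solution in the `i`-th shell of the Neumann problem with data `β`. -/
def neumannSource (z : ℂ) (β : Fin N → Side → ℂ) (i : Fin N) : ℂ :=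
  4 * Real.pi * ((S.rplus i : ℂ) ^ 2 * β i Side.plus - (S.rminus i : ℂ) ^ 2 * β i Side.minus)
    / (S.vol i - z)

/-- The inner boundary value of the solution in the `i`-th shell of the Neumann problem with
data `β`. -/
def neumannValue (z : ℂ) (β : Fin N → Side → ℂ) (i : Fin N) : ℂ :=
  (S.neumannSource z β i / (4 * Real.pi) - β i Side.minus * slopeMoment z (S.rminus i) (S.rplus i)
    - S.neumannSource z β i * sourceMoment z (S.rminus i) (S.rplus i))
    / valueMoment z (S.rminus i) (S.rplus i)

/-- The radial solution of `Δe + z e = ∫ e` in the `i`-th shell with normal derivatives `β`. -/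
def neumannFun (z : ℂ) (β : Fin N → Side → ℂ) (i : Fin N) (r : ℝ) : ℂ :=
  radialValue z (S.rminus i) (S.neumannValue z β i) (β i Side.minus) (S.neumannSource z β i) r

/-- The boundary values in the resonators that are produced by the normal derivatives belonging to
the boundary values `f`. -/
def interaction (k z : ℂ) (f : Fin N → Side → ℂ) : Fin N → Side → ℂ :=
  fun i s => S.neumannFun z (S.dtnMap k f) i (S.radius i s)

/-- The parameter `z` is not resonant for the Neumann problem in any of the shells. -/
def Regular (z : ℂ) : Prop :=
  ∀ i, (S.vol i : ℂ) - z ≠ 0 ∧ valueMoment z (S.rminus i) (S.rplus i) ≠ 0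

lemma vol_eq_complex (i : Fin N) :
    (S.vol i : ℂ) = 4 * Real.pi * (((S.rplus i : ℂ) ^ 3 - (S.rminus i : ℂ) ^ 3) / 3) := by
  rw [S.vol_eq]
  push_cast
  ring

variable {S}

lemma shellIntegral_of_represents {u : S.H1} {z : ℂ} {A α n : Fin N → ℂ}
    (hu : S.Represents u fun i x => radialValue z (S.rminus i) (A i) (α i) (n i) ‖x‖) (i : Fin N) :
    S.shellIntegral i u = 4 * Real.pi * (A i * valueMoment z (S.rminus i) (S.rplus i)
      + α i * slopeMoment z (S.rminus i) (S.rplus i)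
      + n i * sourceMoment z (S.rminus i) (S.rplus i)) := by
  rw [← integral_radialValue z (S.rminus_pos i) (S.rminus_lt_rplus i)]
  refine integral_congr_ae ?_
  filter_upwards [hu i] with x hx
  exact hx.1

/-- The value at radius `r` in the `i`-th shell of the solution with boundary values `f`. -/
lemma radialValue_eq_add_neumannFun (z : ℂ) (δ : ℂ) (β : Fin N → Side → ℂ) (i : Fin N) (c : ℂ)
    {r : ℝ} (hr : 0 < r) :
    radialValue z (S.rminus i) (c + δ * S.neumannValue z β i) (δ * β i Side.minus)
      (z * c + δ * S.neumannSource z β i) r = c + δ * S.neumannFun z β i r := by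
  have h := radialValue_add z (S.rminus i) c 0 (z * c) (δ * S.neumannValue z β i)
    (δ * β i Side.minus) (δ * S.neumannSource z β i) r
  rw [zero_add] at h
  rw [h, radialValue_const z _ c hr, radialValue_smul, neumannFun]

lemma radius_pos (i : Fin N) (s : Side) : 0 < S.radius i s := by
  cases s
  · exact S.rplus_pos i
  · exact S.rminus_pos i

lemma neumannFun_rminus (z : ℂ) (β : Fin N → Side → ℂ) (i : Fin N) :
    S.neumannFun z β i (S.rminus i) = S.neumannValue z β i :=
  radialValue_self z _ _ _ (S.rminus_pos i)

/-- The moment of the Neumann solution. -/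
lemma neumann_moment {z : ℂ} (hz : S.Regular z) (β : Fin N → Side → ℂ) (i : Fin N) :
    4 * Real.pi * (S.neumannValue z β i * valueMoment z (S.rminus i) (S.rplus i)
      + β i Side.minus * slopeMoment z (S.rminus i) (S.rplus i)
      + S.neumannSource z β i * sourceMoment z (S.rminus i) (S.rplus i))
      = S.neumannSource z β i := by
  have hpi : (Real.pi : ℂ) ≠ 0 := by exact_mod_cast Real.pi_ne_zero
  have h1 := (hz i).2
  unfold neumannValue
  field_simp
  ring

variable [NeZero N]

/-- The auxiliary solutions in terms of a linear system for their boundary values. -/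
theorem isAuxiliarySolution_iff {v vr : ℝ} {ω : ℂ} {δ : ℝ} {k z : ℂ} (hkv : ω / v = k)
    (hzv : ω ^ 2 / (vr : ℂ) ^ 2 = z) (hk : S.Nonresonant k) (hz : S.Regular z) {j : Fin N}
    {u : S.H1} : S.IsAuxiliarySolution v vr ω δ j u ↔ ∃ f : Fin N → Side → ℂ,
      (∀ i s, f i s = (if i = j then 1 / ((S.vol j : ℂ) - z) else 0) + δ * S.interaction k z f i s) ∧
      S.Represents u fun i x => (if i = j then 1 / ((S.vol j : ℂ) - z) else 0)
        + δ * S.neumannFun z (S.dtnMap k f) i ‖x‖ := by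
  have hpi : (4 * Real.pi : ℂ) ≠ 0 := by
    simp
  have hc : ∀ i, ((S.vol i : ℂ) - z) * (if i = j then 1 / ((S.vol j : ℂ) - z) else 0)
      = if i = j then 1 else 0 := by
    intro i
    split_ifs with h
    · subst h
      exact mul_one_div_cancel (hz i).1
    · simp
  have hpos : ∀ i, ∀ x ∈ S.shell i, 0 < ‖x‖ := fun i x hx => (S.rminus_pos i).trans hx.1
  constructor
  · intro h
    obtain ⟨f, n, hu, hv, hs, hn⟩ := radial_of_isAuxiliarySolution (hkv ▸ hk) h
    rw [hkv, hzv] at hu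
    simp only [hkv, hzv] at hv hs
    -- The flux identity, with the integral of u over D_i replaced by n_i + δ_ij, reads (|D_i| -
    -- z)n_i = zδ_ij + δ times the flux of the Neumann data.
    have hn' : ∀ i, n i = z * (if i = j then 1 / ((S.vol j : ℂ) - z) else 0)
        + δ * S.neumannSource z (S.dtnMap k f) i := by
      intro i
      have h1 := radialSlope_flux z (S.rminus i) (S.rplus_pos i) (f i Side.minus)
        (δ * S.dtnMap k f i Side.minus) (n i)
      rw [hs] at h1
      have h2 := shellIntegral_of_represents hu i
      have h3 := S.vol_eq_complex i
      have h4 : δ * S.neumannSource z (S.dtnMap k f) i * (S.vol i - z) = δ * (4 * Real.pi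
          * ((S.rplus i : ℂ) ^ 2 * S.dtnMap k f i Side.plus
            - (S.rminus i : ℂ) ^ 2 * S.dtnMap k f i Side.minus)) := by
        unfold neumannSource
        rw [mul_assoc, div_mul_cancel₀ _ (hz i).1]
      refine mul_right_cancel₀ (hz i).1 ?_
      linear_combination (-4 * Real.pi : ℂ) * h1 - z * hn i - z * h2 - h4 + n i * h3 - z * hc i
    -- Once source and slope are known, the equation for the integral of u over the shell determines
    -- the inner value, because `valueMoment` does not vanish.
    have hA : ∀ i, f i Side.minus = (if i = j then 1 / ((S.vol j : ℂ) - z) else 0)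
        + δ * S.neumannValue z (S.dtnMap k f) i := by
      intro i
      have h2 := shellIntegral_of_represents hu i
      have h3 := S.vol_eq_complex i
      have h5 := valueMoment_add z (S.rminus i) (S.rplus i)
      have h6 := neumann_moment hz (S.dtnMap k f) i
      refine mul_left_cancel₀ hpi (mul_right_cancel₀ (hz i).2 ?_)
      linear_combination -h2 - δ * h6 + (1 - 4 * Real.pi * sourceMoment z (S.rminus i) (S.rplus i))
        * hn' i - hn i - 4 * Real.pi * (if i = j then 1 / ((S.vol j : ℂ) - z) else 0) * h5
        + (if i = j then 1 / ((S.vol j : ℂ) - z) else 0) * h3 - hc i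
    refine ⟨f, fun i s => ?_, hu.congr fun i x hx => ?_⟩
    · cases s
      · rw [← hv i, hA i, hn' i, radialValue_eq_add_neumannFun _ _ _ _ _ (S.rplus_pos i)]
        rfl
      · rw [hA i, ← neumannFun_rminus]
        rfl
    · rw [hA i, hn' i, radialValue_eq_add_neumannFun _ _ _ _ _ (hpos i x hx)]
  · rintro ⟨f, hf, hu⟩
    have hA : ∀ i, f i Side.minus = (if i = j then 1 / ((S.vol j : ℂ) - z) else 0)
        + δ * S.neumannValue z (S.dtnMap k f) i := by
      intro i
      rw [hf i Side.minus, ← neumannFun_rminus]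
      rfl
    obtain ⟨n, hn'⟩ : ∃ n : Fin N → ℂ, ∀ i, n i = z * (if i = j then 1 / ((S.vol j : ℂ) - z) else 0)
        + δ * S.neumannSource z (S.dtnMap k f) i := ⟨_, fun _ => rfl⟩
    have hval : ∀ i r, 0 < r → radialValue z (S.rminus i) (f i Side.minus)
        (δ * S.dtnMap k f i Side.minus) (n i) r = (if i = j then 1 / ((S.vol j : ℂ) - z) else 0)
          + δ * S.neumannFun z (S.dtnMap k f) i r := fun i r hr => by
      rw [hA i, hn' i, radialValue_eq_add_neumannFun _ _ _ _ _ hr]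
    have hu' : S.Represents u fun i x => radialValue z (S.rminus i) (f i Side.minus)
        (δ * S.dtnMap k f i Side.minus) (n i) ‖x‖ :=
      hu.congr fun i x hx => (hval i _ (hpos i x hx)).symm
    -- The trace is read off from the constructed radial element, which equals u because the two
    -- functions agree almost everywhere; the linear system identifies its values with f.
    have ht : S.IsTrace u fun i s _ => f i s := by
      obtain ⟨U, hU, hUt⟩ := exists_represents_radial S z (fun i => f i Side.minus)
        (fun i => δ * S.dtnMap k f i Side.minus) n
      have huU : u = U := by
        refine S.ext_of_fn fun i => ?_
        filter_upwards [hu' i, hU i] with x h1 h2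
        rw [h1.1, h2.1]
      rw [huU]
      have he : (fun (i : Fin N) (s : Side) (_ : UnitSphere) => f i s) = fun i s _ =>
          radialValue z (S.rminus i) (f i Side.minus) (δ * S.dtnMap k f i Side.minus) (n i)
            (S.radius i s) := by
        funext i s _
        rw [hval i _ (radius_pos i s), hf i s]
        rfl
      rw [he]
      exact hUt
    have hn : ∀ i, n i = S.shellIntegral i u - if i = j then 1 else 0 := by
      intro i
      have h2 := shellIntegral_of_represents hu' i
      have h3 := S.vol_eq_complex i
      have h5 := valueMoment_add z (S.rminus i) (S.rplus i)
      have h6 := neumann_moment hz (S.dtnMap k f) i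
      linear_combination -h2 - δ * h6 + (1 - 4 * Real.pi * sourceMoment z (S.rminus i) (S.rplus i))
        * hn' i - 4 * Real.pi * (if i = j then 1 / ((S.vol j : ℂ) - z) else 0) * h5
        + (if i = j then 1 / ((S.vol j : ℂ) - z) else 0) * h3 - hc i
        - 4 * Real.pi * valueMoment z (S.rminus i) (S.rplus i) * hA i
    refine isAuxiliarySolution_of_radial (n := n) (f := f) (hkv ▸ hk) ?_ ht ?_ hn
    · rw [hkv, hzv]
      exact hu'
    · intro i
      rw [hkv, hzv]
      have h1 := radialSlope_flux z (S.rminus i) (S.rplus_pos i) (f i Side.minus)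
        (δ * S.dtnMap k f i Side.minus) (n i)
      have h2 := shellIntegral_of_represents hu' i
      have h3 := S.vol_eq_complex i
      have h4 : δ * S.neumannSource z (S.dtnMap k f) i * (S.vol i - z) = δ * (4 * Real.pi
          * ((S.rplus i : ℂ) ^ 2 * S.dtnMap k f i Side.plus
            - (S.rminus i : ℂ) ^ 2 * S.dtnMap k f i Side.minus)) := by
        unfold neumannSource
        rw [mul_assoc, div_mul_cancel₀ _ (hz i).1]
      have hr : (S.rplus i : ℂ) ^ 2 ≠ 0 := by
        have := (S.rplus_pos i).ne'
        exact pow_ne_zero _ (by exact_mod_cast this)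
      refine mul_left_cancel₀ hpi (mul_left_cancel₀ hr ?_)
      linear_combination 4 * Real.pi * h1 - n i * h3 + (S.vol i - z) * hn' i
        + z * hn i + z * h2 + h4 + z * hc i

end NestedShells

instance : DecidableEq Side := fun s t => by
  cases s <;> cases t <;> first | exact isTrue rfl | exact isFalse (by simp)

instance : Fintype Side := ⟨{Side.plus, Side.minus}, fun s => by cases s <;> simp⟩

/-! ### Expansions modulo `|ω|² + |δ|` -/

/-- `F` and `G` agree up to `O(|ω|² + |δ|)` as `(ω, δ) → 0`. -/
def IsNear {E : Type*} [NormedAddCommGroup E] (F G : ℂ × ℝ → E) : Prop :=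
  (fun p => F p - G p) =O[𝓝 0] fun p => ‖p.1‖ ^ 2 + |p.2|

namespace IsNear

variable {E : Type*} [NormedAddCommGroup E] {F F' G G' H : ℂ × ℝ → E}

lemma refl (F : ℂ × ℝ → E) : IsNear F F := by
  simpa [IsNear] using isBigO_zero _ _

lemma trans (h : IsNear F G) (h' : IsNear G H) : IsNear F H := by
  refine (IsBigO.add h h').congr_left fun p => ?_
  abel

lemma sub (h : IsNear F F') (h' : IsNear G G') :
    IsNear (fun p => F p - G p) fun p => F' p - G' p := by
  refine (IsBigO.sub h h').congr_left fun p => ?_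
  beta_reduce
  abel

lemma sum {ι : Type*} (s : Finset ι) {F G : ι → ℂ × ℝ → E} (h : ∀ i ∈ s, IsNear (F i) (G i)) :
    IsNear (fun p => ∑ i ∈ s, F i p) fun p => ∑ i ∈ s, G i p := by
  refine (IsBigO.sum h).congr_left fun p => ?_
  rw [Finset.sum_apply, Finset.sum_sub_distrib]

lemma congr (h : IsNear F G) (hF : ∀ p, F p = F' p) (hG : ∀ p, G p = G' p) : IsNear F' G' := by
  have h1 : F = F' := funext hF
  have h2 : G = G' := funext hG
  rwa [← h1, ← h2]

lemma gauge_isBigO_one : (fun p : ℂ × ℝ => ‖p.1‖ ^ 2 + |p.2|) =O[𝓝 0] fun _ => (1 : ℝ) :=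
  ((continuous_fst.norm.pow 2).add continuous_snd.abs).continuousAt.isBigO_one ℝ

lemma isBigO_one (h : IsNear F G) (hG : G =O[𝓝 0] fun _ => (1 : ℝ)) :
    F =O[𝓝 0] fun _ => (1 : ℝ) := by
  refine ((IsBigO.trans h gauge_isBigO_one).add hG).congr_left fun p => ?_
  abel

lemma smul [NormedSpace ℂ E] {a a' : ℂ × ℝ → ℂ} (ha : IsNear a a') (h : IsNear F F')
    (ha' : a' =O[𝓝 0] fun _ => (1 : ℝ)) (hF' : F' =O[𝓝 0] fun _ => (1 : ℝ)) :
    IsNear (fun p => a p • F p) fun p => a' p • F' p := by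
  have h1 := IsBigO.smul ha (h.isBigO_one hF')
  have h2 := IsBigO.smul ha' h
  simp only [smul_eq_mul, mul_one, one_mul] at h1 h2
  refine (h1.add h2).congr_left fun p => ?_
  rw [sub_smul, smul_sub]
  abel

lemma mul {a a' b b' : ℂ × ℝ → ℂ} (ha : IsNear a a') (hb : IsNear b b')
    (ha' : a' =O[𝓝 0] fun _ => (1 : ℝ)) (hb' : b' =O[𝓝 0] fun _ => (1 : ℝ)) :
    IsNear (fun p => a p * b p) fun p => a' p * b' p := ha.smul hb ha' hb'

lemma const_mul {b b' : ℂ × ℝ → ℂ} (c : ℂ) (hb : IsNear b b') :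
    IsNear (fun p => c * b p) fun p => c * b' p := by
  refine (IsBigO.const_mul_left hb c).congr_left fun p => ?_
  ring

lemma const_isBigO (c : E) : (fun _ : ℂ × ℝ => c) =O[𝓝 0] fun _ => (1 : ℝ) :=
  isBigO_const_const c one_ne_zero _

/-- A parameter that enters only through a multiple of ω² may be frozen at 0 with an error O(|ω|²).
-/
lemma of_isBigO {h : ℂ → E} (hh : (fun t => h t - h 0) =O[𝓝 0] fun t => t) (c : ℂ) :
    IsNear (fun p => h (c * p.1 ^ 2)) fun _ => h 0 := by
  have ht : Tendsto (fun p : ℂ × ℝ => c * p.1 ^ 2) (𝓝 0) (𝓝 0) := by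
    have hc : Continuous fun p : ℂ × ℝ => c * p.1 ^ 2 := by fun_prop
    simpa using hc.tendsto 0
  refine (hh.comp_tendsto ht).trans (IsBigO.of_bound ‖c‖ (Eventually.of_forall fun p => ?_))
  simp only [Function.comp_apply, norm_mul, norm_pow, Real.norm_eq_abs]
  rw [abs_of_nonneg (by positivity : (0 : ℝ) ≤ ‖p.1‖ ^ 2 + |p.2|)]
  exact mul_le_mul_of_nonneg_left (le_add_of_nonneg_right (abs_nonneg _)) (norm_nonneg _)

lemma of_differentiableAt [NormedSpace ℂ E] {h : ℂ → E} (hh : DifferentiableAt ℂ h 0) (c : ℂ) :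
    IsNear (fun p => h (c * p.1 ^ 2)) fun _ => h 0 :=
  of_isBigO (by simpa using hh.isBigO_sub) c

/-- A bounded term with an explicit factor δ is absorbed by the error. -/
lemma of_delta_mul {F G R : ℂ × ℝ → ℂ} (h : ∀ᶠ p in 𝓝 0, F p = G p + p.2 * R p)
    (hR : R =O[𝓝 0] fun _ => (1 : ℝ)) : IsNear F G := by
  have hd : (fun p : ℂ × ℝ => (p.2 : ℂ)) =O[𝓝 0] fun p : ℂ × ℝ => ‖p.1‖ ^ 2 + |p.2| := by
    refine IsBigO.of_bound 1 (Eventually.of_forall fun p => ?_)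
    simp only [Complex.norm_real, Real.norm_eq_abs, one_mul]
    rw [abs_of_nonneg (by positivity : (0 : ℝ) ≤ ‖p.1‖ ^ 2 + |p.2|)]
    exact le_add_of_nonneg_left (by positivity)
  have := hd.mul hR
  simp only [mul_one] at this
  refine this.congr' (h.mono fun p hp => ?_) EventuallyEq.rfl
  simp only [hp]
  ring

end IsNear

namespace NestedShells

variable {N : ℕ}

/-! ### Linear maps on the boundary data -/

/-- The boundary data that are `1` on a single sphere. -/
def sphereData (q : Fin N × Side) : Fin N → Side → ℂ := Pi.single q.1 (Pi.single q.2 1)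

lemma linear_apply_eq_sum {E : Type*} [AddCommGroup E] [Module ℂ E]
    (L : (Fin N → Side → ℂ) →ₗ[ℂ] E) (f : Fin N → Side → ℂ) :
    L f = ∑ q : Fin N × Side, f q.1 q.2 • L (sphereData q) := by
  have hf : f = ∑ q : Fin N × Side, f q.1 q.2 • sphereData q := by
    funext i s
    rw [Finset.sum_apply, Finset.sum_apply, Finset.sum_eq_single (i, s)]
    · simp [sphereData]
    · rintro ⟨i', s'⟩ _ hne
      by_cases h : i' = i
      · subst h
        have hs : s' ≠ s := fun h => hne (by rw [h])
        simp [sphereData, hs.symm]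
      · have h' : i ≠ i' := fun h' => h h'.symm
        simp [sphereData, Pi.single_eq_of_ne h']
    · simp
  conv_lhs => rw [hf]
  rw [map_sum]
  exact Finset.sum_congr rfl fun q _ => by rw [map_smul]

/-- Since the data space has finite dimension, closeness of the operators need only be checked on
the data supported on a single sphere. -/
lemma isNear_linear_apply {E : Type*} [NormedAddCommGroup E] [NormedSpace ℂ E]
    {L : ℂ × ℝ → (Fin N → Side → ℂ) →ₗ[ℂ] E} {L' : (Fin N → Side → ℂ) →ₗ[ℂ] E}
    (h : ∀ q, IsNear (fun p => L p (sphereData q)) fun _ => L' (sphereData q))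
    {F F' : ℂ × ℝ → Fin N → Side → ℂ} (hF : ∀ i s, IsNear (fun p => F p i s) fun p => F' p i s)
    (hF' : ∀ i s, (fun p => F' p i s) =O[𝓝 0] fun _ => (1 : ℝ)) :
    IsNear (fun p => L p (F p)) fun p => L' (F' p) := by
  simp only [fun p => linear_apply_eq_sum (L p) (F p), fun p => linear_apply_eq_sum L' (F' p)]
  exact IsNear.sum _ fun q _ => (hF q.1 q.2).smul (h q) (hF' q.1 q.2) (IsNear.const_isBigO _)

lemma exists_eventually_norm_le {K : ℂ × ℝ → (Fin N → Side → ℂ) →ₗ[ℂ] (Fin N → Side → ℂ)}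
    (h : ∀ q, (fun p => K p (sphereData q)) =O[𝓝 0] fun _ => (1 : ℝ)) :
    ∃ C : ℝ, ∀ᶠ p in 𝓝 0, ∀ f, ‖K p f‖ ≤ C * ‖f‖ := by
  choose c hc using fun q => (h q).bound
  refine ⟨∑ q, c q, ?_⟩
  filter_upwards [eventually_all.2 hc] with p hp f
  rw [linear_apply_eq_sum, Finset.sum_mul]
  refine (norm_sum_le _ _).trans (Finset.sum_le_sum fun q _ => ?_)
  have h1 : ‖f q.1 q.2‖ ≤ ‖f‖ := (norm_le_pi_norm (f q.1) q.2).trans (norm_le_pi_norm f q.1)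
  have h2 : ‖K p (sphereData q)‖ ≤ c q := by simpa using hp q
  rw [norm_smul, mul_comm (c q)]
  exact mul_le_mul h1 h2 (norm_nonneg _) (norm_nonneg _)

/-- Unique solvability of `f = g + δ K f` for small `δ`, with a bound for the solution. -/
lemma eventually_existsUnique_fixed {K : ℂ × ℝ → (Fin N → Side → ℂ) →ₗ[ℂ] (Fin N → Side → ℂ)}
    (h : ∀ q, (fun p => K p (sphereData q)) =O[𝓝 0] fun _ => (1 : ℝ)) :
    ∀ᶠ p : ℂ × ℝ in 𝓝 0, (∀ g, ∃! f, f = g + (p.2 : ℂ) • K p f) ∧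
      ∀ f g, f = g + (p.2 : ℂ) • K p f → ‖f‖ ≤ 2 * ‖g‖ := by
  obtain ⟨C, hC⟩ := exists_eventually_norm_le h
  -- The bound 1/2 for the norm of δK is what produces the factor 2 in the estimate of the solution.
  have hsmall : ∀ᶠ p : ℂ × ℝ in 𝓝 0, |p.2| * C < 1 / 2 := by
    have hc : Continuous fun p : ℂ × ℝ => |p.2| * C := by fun_prop
    have := hc.tendsto 0
    simp only [Prod.snd_zero, abs_zero, zero_mul] at this
    exact this.eventually_lt_const (by norm_num)
  filter_upwards [hC, hsmall] with p hp hs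
  have hb : ∀ f, ‖(p.2 : ℂ) • K p f‖ ≤ 1 / 2 * ‖f‖ := by
    intro f
    rw [norm_smul, Complex.norm_real, Real.norm_eq_abs]
    calc |p.2| * ‖K p f‖ ≤ |p.2| * (C * ‖f‖) := mul_le_mul_of_nonneg_left (hp f) (abs_nonneg _)
      _ = |p.2| * C * ‖f‖ := by ring
      _ ≤ 1 / 2 * ‖f‖ := mul_le_mul_of_nonneg_right hs.le (norm_nonneg _)
  have hbound : ∀ f g, f = g + (p.2 : ℂ) • K p f → ‖f‖ ≤ 2 * ‖g‖ := by
    intro f g hf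
    have h1 : ‖f‖ ≤ ‖g‖ + ‖(p.2 : ℂ) • K p f‖ := by
      conv_lhs => rw [hf]
      exact norm_add_le _ _
    linarith [hb f]
  -- The estimate with g = 0 gives injectivity, and finite dimension turns it into surjectivity.
  have hinj : Function.Injective
      ((LinearMap.id : (Fin N → Side → ℂ) →ₗ[ℂ] (Fin N → Side → ℂ)) - (p.2 : ℂ) • K p) := by
    rw [injective_iff_map_eq_zero]
    intro f hf
    have h0 : f = 0 + (p.2 : ℂ) • K p f := by
      rw [zero_add]
      exact sub_eq_zero.1 hf
    have := hbound f 0 h0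
    rw [norm_zero, mul_zero] at this
    exact norm_le_zero_iff.1 this
  refine ⟨fun g => ?_, hbound⟩
  obtain ⟨f, hf⟩ := LinearMap.injective_iff_surjective.1 hinj g
  have he : ∀ f, (f = g + (p.2 : ℂ) • K p f) ↔
      ((LinearMap.id : (Fin N → Side → ℂ) →ₗ[ℂ] (Fin N → Side → ℂ)) - (p.2 : ℂ) • K p) f = g := by
    intro f
    rw [LinearMap.sub_apply, LinearMap.smul_apply, LinearMap.id_apply, sub_eq_iff_eq_add]
  refine ⟨f, (he f).2 hf, fun f' hf' => hinj ?_⟩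
  rw [(he f').1 hf', hf]

variable (S : NestedShells N)

lemma belowValue_add (f g : Fin N → Side → ℂ) (i : Fin N) :
    belowValue (f + g) i = belowValue f i + belowValue g i := by
  unfold belowValue
  split_ifs <;> simp

lemma belowValue_smul (c : ℂ) (f : Fin N → Side → ℂ) (i : Fin N) :
    belowValue (c • f) i = c * belowValue f i := by
  unfold belowValue
  split_ifs <;> simp

/-- The Dirichlet-to-Neumann map as a linear map. -/
def dtnLinear (k : ℂ) : (Fin N → Side → ℂ) →ₗ[ℂ] (Fin N → Side → ℂ) where
  toFun := S.dtnMap k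
  map_add' f g := by
    funext i s
    cases s
    · simp only [dtnMap, Pi.add_apply]
      split_ifs
      · unfold gapInner
        ring
      · ring
    · simp only [dtnMap, Pi.add_apply, belowValue_add]
      unfold gapOuter
      ring
  map_smul' c f := by
    funext i s
    cases s
    · simp only [dtnMap, Pi.smul_apply, smul_eq_mul, RingHom.id_apply]
      split_ifs
      · unfold gapInner
        ring
      · ring
    · simp only [dtnMap, Pi.smul_apply, belowValue_smul, smul_eq_mul, RingHom.id_apply]
      unfold gapOuter
      ring

lemma neumannSource_add (z : ℂ) (β γ : Fin N → Side → ℂ) (i : Fin N) :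
    S.neumannSource z (β + γ) i = S.neumannSource z β i + S.neumannSource z γ i := by
  simp only [neumannSource, Pi.add_apply]
  ring

lemma neumannSource_smul (z c : ℂ) (β : Fin N → Side → ℂ) (i : Fin N) :
    S.neumannSource z (c • β) i = c * S.neumannSource z β i := by
  simp only [neumannSource, Pi.smul_apply, smul_eq_mul]
  ring

lemma neumannFun_add (z : ℂ) (β γ : Fin N → Side → ℂ) (i : Fin N) (r : ℝ) :
    S.neumannFun z (β + γ) i r = S.neumannFun z β i r + S.neumannFun z γ i r := by
  have h : S.neumannValue z (β + γ) i = S.neumannValue z β i + S.neumannValue z γ i := by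
    simp only [neumannValue, neumannSource_add, Pi.add_apply]
    ring
  rw [neumannFun, h, neumannSource_add, Pi.add_apply, Pi.add_apply, radialValue_add]
  rfl

lemma neumannFun_smul (z c : ℂ) (β : Fin N → Side → ℂ) (i : Fin N) (r : ℝ) :
    S.neumannFun z (c • β) i r = c * S.neumannFun z β i r := by
  have h : S.neumannValue z (c • β) i = c * S.neumannValue z β i := by
    simp only [neumannValue, neumannSource_smul, Pi.smul_apply, smul_eq_mul]
    ring
  rw [neumannFun, h, neumannSource_smul, Pi.smul_apply, Pi.smul_apply, smul_eq_mul,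
    radialValue_smul]
  rfl

/-- The boundary values of the solutions of the Neumann problems, as a linear map. -/
def neumannTrace (z : ℂ) : (Fin N → Side → ℂ) →ₗ[ℂ] (Fin N → Side → ℂ) where
  toFun β i s := S.neumannFun z β i (S.radius i s)
  map_add' β γ := by
    funext i s
    exact S.neumannFun_add z β γ i _
  map_smul' c β := by
    funext i s
    exact S.neumannFun_smul z c β i _

lemma exists_represents_neumannFun (z : ℂ) (β : Fin N → Side → ℂ) :
    ∃ u : S.H1, S.Represents u fun i x => S.neumannFun z β i ‖x‖ := by
  obtain ⟨u, hu, -⟩ := exists_represents_radial S z (S.neumannValue z β)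
    (fun i => β i Side.minus) (S.neumannSource z β)
  exact ⟨u, hu⟩

variable {S} in
lemma Represents.unique {u u' : S.H1} {φ : Fin N → Space → ℂ} (h : S.Represents u φ)
    (h' : S.Represents u' φ) : u = u' := by
  refine S.ext_of_fn fun i => ?_
  filter_upwards [h i, h' i] with x h1 h2
  rw [h1.1, h2.1]

lemma hasDerivAt_neumannFun (z : ℂ) (β : Fin N → Side → ℂ) (i : Fin N) {r : ℝ} (hr : 0 < r) :
    HasDerivAt (S.neumannFun z β i) (radialSlope z (S.rminus i) (S.neumannValue z β i)
      (β i Side.minus) (S.neumannSource z β i) r) r :=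
  hasDerivAt_radialValue z _ _ _ _ hr

lemma differentiableAt_radial {p : ℝ → ℂ} {i : Fin N} (hp : ∀ r, 0 < r → DifferentiableAt ℝ p r)
    {x : Space} (hx : x ∈ S.shell i) : DifferentiableAt ℝ (fun y : Space => p ‖y‖) x := by
  have hx0 : 0 < ‖x‖ := (S.rminus_pos i).trans hx.1
  have h := (hasFDerivAt_radial (c := 0) (norm_pos_iff.1 hx0)
    (p' := deriv p ‖x - 0‖) (by rw [sub_zero]; exact (hp _ hx0).hasDerivAt)).differentiableAt
  simpa using h

lemma differentiableAt_neumannFun (z : ℂ) (β : Fin N → Side → ℂ) (i : Fin N) {x : Space}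
    (hx : x ∈ S.shell i) : DifferentiableAt ℝ (fun y : Space => S.neumannFun z β i ‖y‖) x :=
  S.differentiableAt_radial (fun _ hr => (S.hasDerivAt_neumannFun z β i hr).differentiableAt) hx

/-- The solutions of the Neumann problems as elements of `H¹(D)`. -/
def neumannElement (z : ℂ) : (Fin N → Side → ℂ) →ₗ[ℂ] S.H1 where
  toFun β := Classical.choose (S.exists_represents_neumannFun z β)
  -- The elements are merely chosen; linearity follows because an element of H¹(D) is determined by
  -- the function it represents.
  map_add' β γ := by
    have h := (Classical.choose_spec (S.exists_represents_neumannFun z β)).add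
      (Classical.choose_spec (S.exists_represents_neumannFun z γ))
      (fun i x hx => S.differentiableAt_neumannFun z β i hx)
      (fun i x hx => S.differentiableAt_neumannFun z γ i hx)
    refine (Classical.choose_spec (S.exists_represents_neumannFun z (β + γ))).unique
      (h.congr fun i x _ => (S.neumannFun_add z β γ i _).symm)
  map_smul' c β := by
    have h := (Classical.choose_spec (S.exists_represents_neumannFun z β)).smul c
      (fun i x hx => S.differentiableAt_neumannFun z β i hx)
    refine (Classical.choose_spec (S.exists_represents_neumannFun z (c • β))).unique
      (h.congr fun i x _ => (S.neumannFun_smul z c β i _).symm)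

lemma represents_neumannElement (z : ℂ) (β : Fin N → Side → ℂ) :
    S.Represents (S.neumannElement z β) fun i x => S.neumannFun z β i ‖x‖ :=
  Classical.choose_spec (S.exists_represents_neumannFun z β)

end NestedShells

/-! ### Dependence of the Neumann problem on the spectral parameter -/

section
variable {a b : ℝ}

/-- The principal filter of the interval encodes uniformity in the radius; joint continuity on a
compact product gives the bound. -/
lemma genTrig_shift_isBigO_one (m : ℕ) : (fun q : ℂ × ℝ => genTrig m q.1 (q.2 - a))
    =O[𝓝 0 ×ˢ 𝓟 (Set.Icc a b)] fun _ => (1 : ℂ) := by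
  have hc : Continuous fun q : ℂ × ℝ => genTrig m q.1 (q.2 - a) :=
    (contDiff_genTrig (n := 0) m).continuous.comp
      (continuous_fst.prodMk (continuous_snd.sub continuous_const))
  obtain ⟨C, hC⟩ := ((isCompact_closedBall (0 : ℂ) 1).prod
    (isCompact_Icc (a := a) (b := b))).exists_bound_of_continuousOn hc.continuousOn
  refine IsBigO.of_bound C ?_
  rw [eventually_prod_principal_iff]
  filter_upwards [Metric.closedBall_mem_nhds (0 : ℂ) one_pos] with z hz r hr
  simpa using hC (z, r) ⟨hz, hr⟩

lemma inv_isBigO_one (ha : 0 < a) : (fun q : ℂ × ℝ => (q.2 : ℂ)⁻¹)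
    =O[𝓝 0 ×ˢ 𝓟 (Set.Icc a b)] fun _ => (1 : ℂ) := by
  refine IsBigO.of_bound a⁻¹ ?_
  rw [eventually_prod_principal_iff]
  refine Eventually.of_forall fun z r hr => ?_
  have h0 : 0 < r := ha.trans_le hr.1
  simp only [norm_inv, Complex.norm_real, Real.norm_eq_abs, abs_of_pos h0, norm_one, mul_one]
  exact inv_anti₀ ha hr.1

variable {A n : ℂ → ℂ}

/-- The difference splits into the variation of the coefficients A, n and the variation of the
trigonometric functions; for the latter the recurrence exhibits an explicit factor z. -/
lemma radialProfile_sub_isBigO (hA : (fun z => A z - A 0) =O[𝓝 0] fun z => z)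
    (hn : (fun z => n z - n 0) =O[𝓝 0] fun z => z) (α : ℂ) :
    (fun q : ℂ × ℝ => radialProfile q.1 a (A q.1) α (n q.1) q.2
      - radialProfile 0 a (A 0) α (n 0) q.2) =O[𝓝 0 ×ˢ 𝓟 (Set.Icc a b)] fun q => q.1 := by
  have c := fun m => genTrig_shift_isBigO_one (a := a) (b := b) m
  have hA' := hA.comp_tendsto (tendsto_fst (f := 𝓝 (0 : ℂ)) (g := 𝓟 (Set.Icc a b)))
  have hn' := hn.comp_tendsto (tendsto_fst (f := 𝓝 (0 : ℂ)) (g := 𝓟 (Set.Icc a b)))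
  have hz : (fun q : ℂ × ℝ => q.1) =O[𝓝 0 ×ˢ 𝓟 (Set.Icc a b)] fun q => q.1 := isBigO_refl _ _
  have h1 := hA'.mul (((c 0).const_mul_left (a : ℂ)).add (c 1))
  have h2 := hn'.mul (((c 2).const_mul_left (a : ℂ)).add (c 3))
  have h3 := hz.mul ((((c 2).const_mul_left (a * A 0)).add ((c 3).const_mul_left (A 0 + a * α))).add
    ((((c 4).const_mul_left (a : ℂ)).add (c 5)).const_mul_left (n 0)))
  refine ((h1.add h2).sub h3).congr (fun q => ?_) fun q => mul_one _
  have e0 := genTrig_recurrence 0 q.1 (q.2 - a)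
  have e1 := genTrig_recurrence 1 q.1 (q.2 - a)
  have e2 := genTrig_recurrence 2 q.1 (q.2 - a)
  have e3 := genTrig_recurrence 3 q.1 (q.2 - a)
  rw [← genTrig_zero_left] at e0 e1 e2 e3
  simp only [Function.comp_apply, radialProfile]
  linear_combination (-a * A 0 : ℂ) * e0 - (A 0 + a * α : ℂ) * e1 - n 0 * a * e2 - n 0 * e3

lemma radialProfileDeriv_sub_isBigO (hA : (fun z => A z - A 0) =O[𝓝 0] fun z => z)
    (hn : (fun z => n z - n 0) =O[𝓝 0] fun z => z) (α : ℂ) :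
    (fun q : ℂ × ℝ => radialProfileDeriv q.1 a (A q.1) α (n q.1) q.2
      - radialProfileDeriv 0 a (A 0) α (n 0) q.2) =O[𝓝 0 ×ˢ 𝓟 (Set.Icc a b)] fun q => q.1 := by
  have c := fun m => genTrig_shift_isBigO_one (a := a) (b := b) m
  have hfst := tendsto_fst (f := 𝓝 (0 : ℂ)) (g := 𝓟 (Set.Icc a b))
  have hA' := hA.comp_tendsto hfst
  have hn' := hn.comp_tendsto hfst
  have hz : (fun q : ℂ × ℝ => q.1) =O[𝓝 0 ×ˢ 𝓟 (Set.Icc a b)] fun q => q.1 := isBigO_refl _ _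
  have hz1 : (fun q : ℂ × ℝ => q.1) =O[𝓝 0 ×ˢ 𝓟 (Set.Icc a b)] fun _ => (1 : ℂ) :=
    hfst.isBigO_one ℂ
  have hzc : (fun q : ℂ × ℝ => q.1 * genTrig 1 q.1 (q.2 - a))
      =O[𝓝 0 ×ˢ 𝓟 (Set.Icc a b)] fun _ => (1 : ℂ) :=
    (hz1.mul (c 1)).congr_right fun _ => mul_one _
  have h1 := hA'.mul ((hzc.const_mul_left (-a : ℂ)).add (c 0))
  have h2 := hn'.mul (((c 1).const_mul_left (a : ℂ)).add (c 2))
  have h3 := hz.mul ((((c 1).const_mul_left (a * A 0)).add ((c 2).const_mul_left (A 0 + a * α))).add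
    ((((c 3).const_mul_left (a : ℂ)).add (c 4)).const_mul_left (n 0)))
  refine ((h1.add h2).sub h3).congr (fun q => ?_) fun q => mul_one _
  have e0 := genTrig_recurrence 0 q.1 (q.2 - a)
  have e1 := genTrig_recurrence 1 q.1 (q.2 - a)
  have e2 := genTrig_recurrence 2 q.1 (q.2 - a)
  rw [← genTrig_zero_left] at e0 e1 e2
  simp only [Function.comp_apply, radialProfileDeriv]
  linear_combination (-(A 0 + a * α) : ℂ) * e0 - n 0 * a * e1 - n 0 * e2

lemma radialValue_sub_isBigO (ha : 0 < a) (hA : (fun z => A z - A 0) =O[𝓝 0] fun z => z)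
    (hn : (fun z => n z - n 0) =O[𝓝 0] fun z => z) (α : ℂ) :
    (fun q : ℂ × ℝ => radialValue q.1 a (A q.1) α (n q.1) q.2
      - radialValue 0 a (A 0) α (n 0) q.2) =O[𝓝 0 ×ˢ 𝓟 (Set.Icc a b)] fun q => q.1 := by
  refine ((radialProfile_sub_isBigO hA hn α).mul (inv_isBigO_one ha)).congr (fun q => ?_)
    fun q => mul_one _
  unfold radialValue
  ring

lemma radialSlope_sub_isBigO (ha : 0 < a) (hA : (fun z => A z - A 0) =O[𝓝 0] fun z => z)
    (hn : (fun z => n z - n 0) =O[𝓝 0] fun z => z) (α : ℂ) :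
    (fun q : ℂ × ℝ => radialSlope q.1 a (A q.1) α (n q.1) q.2
      - radialSlope 0 a (A 0) α (n 0) q.2) =O[𝓝 0 ×ˢ 𝓟 (Set.Icc a b)] fun q => q.1 := by
  have hi := inv_isBigO_one (b := b) ha
  have h1 := (radialProfileDeriv_sub_isBigO hA hn α).mul hi
  have h2 := (radialProfile_sub_isBigO hA hn α).mul (hi.mul hi)
  have h2' := h2.congr_right (g₂ := fun q => q.1 * 1) fun q => by rw [mul_one (1 : ℂ)]
  refine (h1.sub h2').congr (fun q => ?_) fun q => mul_one _
  unfold radialSlope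
  ring

lemma differentiable_moments (a b : ℝ) : Differentiable ℂ (fun z => valueMoment z a b) ∧
    Differentiable ℂ (fun z => slopeMoment z a b) ∧
    Differentiable ℂ (fun z => sourceMoment z a b) := by
  have h := fun m => differentiable_genTrig_left m (b - a)
  unfold valueMoment slopeMoment sourceMoment
  have hs : ∀ m l, Differentiable ℂ fun z => (b : ℂ) * genTrig m z (b - a) - genTrig l z (b - a) :=
    fun m l => ((h m).const_mul _).sub (h l)
  exact ⟨((hs 1 2).const_mul _).add (hs 2 3), (hs 2 3).const_mul _,
    ((hs 3 4).const_mul _).add (hs 4 5)⟩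

end

namespace NestedShells

variable {N : ℕ} (S : NestedShells N)

lemma vol_ne_zero (i : Fin N) : (S.vol i : ℂ) ≠ 0 := by exact_mod_cast (S.vol_pos i).ne'

lemma differentiableAt_neumannSource (β : Fin N → Side → ℂ) (i : Fin N) :
    DifferentiableAt ℂ (fun z => S.neumannSource z β i) 0 := by
  unfold neumannSource
  refine (differentiableAt_const _).div ((differentiableAt_const _).sub differentiableAt_id) ?_
  simpa using S.vol_ne_zero i

lemma differentiableAt_neumannValue (β : Fin N → Side → ℂ) (i : Fin N) :
    DifferentiableAt ℂ (fun z => S.neumannValue z β i) 0 := by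
  obtain ⟨h1, h2, h3⟩ := differentiable_moments (S.rminus i) (S.rplus i)
  have h4 := S.differentiableAt_neumannSource β i
  unfold neumannValue
  exact (((h4.div_const _).sub ((h2 0).const_mul _)).sub (h4.mul (h3 0))).div (h1 0)
    (valueMoment_zero_ne (S.rminus_pos i) (S.rminus_lt_rplus i))

/-- The derivative of `neumannFun`. -/
def neumannSlope (z : ℂ) (β : Fin N → Side → ℂ) (i : Fin N) (r : ℝ) : ℂ :=
  radialSlope z (S.rminus i) (S.neumannValue z β i) (β i Side.minus) (S.neumannSource z β i) r

lemma neumannValue_sub_isBigO (β : Fin N → Side → ℂ) (i : Fin N) :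
    (fun z => S.neumannValue z β i - S.neumannValue 0 β i) =O[𝓝 0] fun z => z := by
  simpa using (S.differentiableAt_neumannValue β i).isBigO_sub

lemma neumannSource_sub_isBigO (β : Fin N → Side → ℂ) (i : Fin N) :
    (fun z => S.neumannSource z β i - S.neumannSource 0 β i) =O[𝓝 0] fun z => z := by
  simpa using (S.differentiableAt_neumannSource β i).isBigO_sub

lemma neumannFun_sub_isBigO (β : Fin N → Side → ℂ) (i : Fin N) :
    (fun q : ℂ × ℝ => S.neumannFun q.1 β i q.2 - S.neumannFun 0 β i q.2)
      =O[𝓝 0 ×ˢ 𝓟 (Set.Icc (S.rminus i) (S.rplus i))] fun q => q.1 := by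
  have h := radialValue_sub_isBigO (A := fun z => S.neumannValue z β i)
    (n := fun z => S.neumannSource z β i) (b := S.rplus i) (S.rminus_pos i)
    (S.neumannValue_sub_isBigO β i) (S.neumannSource_sub_isBigO β i) (β i Side.minus)
  unfold neumannFun
  exact h

lemma neumannSlope_sub_isBigO (β : Fin N → Side → ℂ) (i : Fin N) :
    (fun q : ℂ × ℝ => S.neumannSlope q.1 β i q.2 - S.neumannSlope 0 β i q.2)
      =O[𝓝 0 ×ˢ 𝓟 (Set.Icc (S.rminus i) (S.rplus i))] fun q => q.1 := by
  have h := radialSlope_sub_isBigO (A := fun z => S.neumannValue z β i)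
    (n := fun z => S.neumannSource z β i) (b := S.rplus i) (S.rminus_pos i)
    (S.neumannValue_sub_isBigO β i) (S.neumannSource_sub_isBigO β i) (β i Side.minus)
  unfold neumannSlope
  exact h

lemma radius_mem_Icc (i : Fin N) (s : Side) :
    S.radius i s ∈ Set.Icc (S.rminus i) (S.rplus i) := by
  have := (S.rminus_lt_rplus i).le
  cases s
  · exact ⟨this, le_rfl⟩
  · exact ⟨le_rfl, this⟩

lemma neumannTrace_sub_isBigO (β : Fin N → Side → ℂ) :
    (fun z => S.neumannTrace z β - S.neumannTrace 0 β) =O[𝓝 0] fun z => z := by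
  refine isBigO_pi.2 fun i => isBigO_pi.2 fun s => ?_
  obtain ⟨C, hC⟩ := (S.neumannFun_sub_isBigO β i).bound
  rw [eventually_prod_principal_iff] at hC
  exact IsBigO.of_bound C (hC.mono fun z hz => hz _ (S.radius_mem_Icc i s))

lemma represents_neumannElement_sub (z : ℂ) (β : Fin N → Side → ℂ) :
    S.Represents (S.neumannElement z β - S.neumannElement 0 β)
      fun i x => S.neumannFun z β i ‖x‖ + -1 * S.neumannFun 0 β i ‖x‖ := by
  have hrep := (S.represents_neumannElement z β).add
    ((S.represents_neumannElement 0 β).smul (-1)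
      fun i x hx => S.differentiableAt_neumannFun 0 β i hx)
    (fun i x hx => S.differentiableAt_neumannFun z β i hx)
    (fun i x hx => (S.differentiableAt_neumannFun 0 β i hx).const_mul (-1))
  rwa [neg_one_smul, ← sub_eq_add_neg] at hrep

lemma norm_fderiv_neumannFun_sub_le (z : ℂ) (β : Fin N → Side → ℂ) (i : Fin N) {x : Space}
    (hx : x ∈ S.shell i) (k : Fin 3) :
    ‖fderiv ℝ (fun y : Space => S.neumannFun z β i ‖y‖ + -1 * S.neumannFun 0 β i ‖y‖) x
        (EuclideanSpace.single k 1)‖ ≤ ‖S.neumannSlope z β i ‖x‖ - S.neumannSlope 0 β i ‖x‖‖ := by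
  have hx0 : 0 < ‖x‖ := (S.rminus_pos i).trans hx.1
  have hder : HasDerivAt (fun r => S.neumannFun z β i r + -1 * S.neumannFun 0 β i r)
      (S.neumannSlope z β i ‖x - 0‖ - S.neumannSlope 0 β i ‖x - 0‖) ‖x - 0‖ := by
    have hx0' : 0 < ‖x - 0‖ := by rwa [sub_zero]
    refine ((S.hasDerivAt_neumannFun z β i hx0').add
      ((S.hasDerivAt_neumannFun 0 β i hx0').const_mul (-1))).congr_deriv ?_
    unfold neumannSlope
    ring
  have hf := fderiv_radial_single (norm_pos_iff.1 hx0) hder k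
  simp only [sub_zero] at hf
  rw [hf, norm_div, norm_mul, Complex.norm_real, Complex.norm_real, norm_norm]
  exact div_le_of_le_mul₀ (norm_nonneg _) (norm_nonneg _)
    (mul_le_mul_of_nonneg_left (PiLp.norm_apply_le x k) (norm_nonneg _))

lemma norm_neumannElement_sub_le (z : ℂ) (β : Fin N → Side → ℂ) {M : ℝ} (hM : 0 ≤ M)
    (h1 : ∀ i, ∀ r ∈ Set.Icc (S.rminus i) (S.rplus i),
      ‖S.neumannFun z β i r - S.neumannFun 0 β i r‖ ≤ M)
    (h2 : ∀ i, ∀ r ∈ Set.Icc (S.rminus i) (S.rplus i),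
      ‖S.neumannSlope z β i r - S.neumannSlope 0 β i r‖ ≤ M) :
    ‖S.neumannElement z β - S.neumannElement 0 β‖ ≤ S.normConst * M := by
  have hv : ∀ i, ∀ x ∈ S.shell i, ‖S.neumannFun z β i ‖x‖ + -1 * S.neumannFun 0 β i ‖x‖‖ ≤ M := by
    intro i x hx
    rw [neg_one_mul, ← sub_eq_add_neg]
    exact h1 i ‖x‖ ⟨hx.1.le, hx.2.le⟩
  have hd : ∀ i, ∀ x ∈ S.shell i, ∀ k, ‖fderiv ℝ (fun y : Space => S.neumannFun z β i ‖y‖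
      + -1 * S.neumannFun 0 β i ‖y‖) x (EuclideanSpace.single k 1)‖ ≤ M := fun i x hx k =>
    (S.norm_fderiv_neumannFun_sub_le z β i hx k).trans (h2 i ‖x‖ ⟨hx.1.le, hx.2.le⟩)
  have hr := S.represents_neumannElement_sub z β
  generalize S.neumannElement z β - S.neumannElement 0 β = u at hr ⊢
  exact S.norm_le_of_represents hM hr hv hd

/-- The differences of values and slopes are O(z) uniformly in the radius, so the supremum bound for
the H¹ norm applies. The sum over the shells serves as a common constant. -/
lemma neumannElement_sub_isBigO (β : Fin N → Side → ℂ) :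
    (fun z => S.neumannElement z β - S.neumannElement 0 β) =O[𝓝 0] fun z => z := by
  choose c hc using fun i => (S.neumannFun_sub_isBigO β i).bound
  choose d hd using fun i => (S.neumannSlope_sub_isBigO β i).bound
  simp only [eventually_prod_principal_iff] at hc hd
  have hle : ∀ i, c i ≤ ∑ i, (|c i| + |d i|) ∧ d i ≤ ∑ i, (|c i| + |d i|) := by
    intro i
    have : |c i| + |d i| ≤ ∑ i, (|c i| + |d i|) :=
      Finset.single_le_sum (f := fun i => |c i| + |d i|) (s := Finset.univ)
        (fun i _ => by positivity) (Finset.mem_univ i)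
    constructor
    · linarith [le_abs_self (c i), abs_nonneg (d i)]
    · linarith [le_abs_self (d i), abs_nonneg (c i)]
  have hev := (eventually_all.2 hc).and (eventually_all.2 hd)
  generalize (∑ i, (|c i| + |d i|)) = K at hle
  refine IsBigO.of_bound (S.normConst * |K|) (hev.mono fun z hz => ?_)
  obtain ⟨h1, h2⟩ := hz
  have hb : ‖S.neumannElement z β - S.neumannElement 0 β‖ ≤ S.normConst * (|K| * ‖z‖) :=
    S.norm_neumannElement_sub_le z β (by positivity)
      (fun i r hr => (h1 i r hr).trans
        (mul_le_mul_of_nonneg_right ((hle i).1.trans (le_abs_self K)) (norm_nonneg _)))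
      fun i r hr => (h2 i r hr).trans
        (mul_le_mul_of_nonneg_right ((hle i).2.trans (le_abs_self K)) (norm_nonneg _))
  exact hb.trans_eq (mul_assoc _ _ _).symm

lemma eventually_regular : ∀ᶠ z in 𝓝 0, S.Regular z := by
  refine eventually_all.2 fun i => ?_
  have h1 : ContinuousAt (fun z : ℂ => (S.vol i : ℂ) - z) 0 := by fun_prop
  have h2 := ((differentiable_moments (S.rminus i) (S.rplus i)).1 0).continuousAt
  exact (h1.eventually_ne (by simpa using S.vol_ne_zero i)).and
    (h2.eventually_ne (valueMoment_zero_ne (S.rminus_pos i) (S.rminus_lt_rplus i)))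

lemma eventually_nonresonant : ∀ᶠ k in 𝓝 0, S.Nonresonant k := by
  refine eventually_all.2 fun i => ?_
  have h : ContinuousAt (fun k : ℂ => genTrig 1 (k ^ 2) (S.rminus i - S.below i)) 0 :=
    ((differentiable_genTrig_left 1 (S.rminus i - S.below i)).continuous.comp
      (continuous_pow 2)).continuousAt
  exact h.eventually_ne (S.nonresonant_zero i)

end NestedShells

namespace NestedShells

variable {N : ℕ} (S : NestedShells N)

/-! ### Expansion of the Dirichlet-to-Neumann map -/

/-- The term of first order in the wave number of the Dirichlet-to-Neumann map: it is caused by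
the radiation from the outermost sphere. -/
def radiation (f : Fin N → Side → ℂ) (i : Fin N) : Side → ℂ
  | Side.plus => if 0 < i.val then 0 else Complex.I * f i Side.plus
  | Side.minus => 0

/-- The gap formulas involve the wave number only through k² = cω², so they have no term of first
order in ω. -/
lemma gap_isNear {L : ℝ} (hL : 0 < L) (c : ℂ) :
    IsNear (fun p => (genTrig 1 (c * p.1 ^ 2) L)⁻¹) (fun _ => (genTrig 1 0 L)⁻¹) ∧
    IsNear (fun p => genTrig 0 (c * p.1 ^ 2) L / genTrig 1 (c * p.1 ^ 2) L)
      (fun _ => genTrig 0 0 L / genTrig 1 0 L) := by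
  have h0 : genTrig 1 0 L ≠ 0 := by
    rw [genTrig_zero_left]
    have : (L : ℂ) ≠ 0 := by exact_mod_cast hL.ne'
    simpa using this
  have d0 := differentiable_genTrig_left 0 L 0
  have d1 := differentiable_genTrig_left 1 L 0
  exact ⟨IsNear.of_differentiableAt (d1.fun_inv h0) c,
    IsNear.of_differentiableAt (h := fun t => genTrig 0 t L / genTrig 1 t L) (d0.fun_div d1 h0) c⟩

lemma gapInner_isNear {a b : ℝ} (hab : a < b) (c : ℂ) {F G : ℂ × ℝ → ℂ} {f g : ℂ}
    (hF : IsNear F fun _ => f) (hG : IsNear G fun _ => g) :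
    IsNear (fun p => gapInner (c * p.1 ^ 2) a b (F p) (G p)) fun _ => gapInner 0 a b f g := by
  obtain ⟨h1, h2⟩ := gap_isNear (sub_pos.2 hab) c
  have k := fun c : ℂ => IsNear.const_isBigO c
  have e1 := (hG.mul h1 (k _) (k _)).const_mul (b : ℂ)
  have e2 := (hF.mul h2 (k _) (k _)).const_mul (a : ℂ)
  have h := (((e1.sub e2).sub hF).const_mul (a : ℂ)⁻¹)
  refine h.congr (fun p => ?_) fun p => ?_ <;> (unfold gapInner; ring)

lemma gapOuter_isNear {a b : ℝ} (hab : a < b) (c : ℂ) {F G : ℂ × ℝ → ℂ} {f g : ℂ}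
    (hF : IsNear F fun _ => f) (hG : IsNear G fun _ => g) :
    IsNear (fun p => gapOuter (c * p.1 ^ 2) a b (F p) (G p)) fun _ => gapOuter 0 a b f g := by
  obtain ⟨h1, h2⟩ := gap_isNear (sub_pos.2 hab) c
  have k := fun c : ℂ => IsNear.const_isBigO c
  have e1 := hG.mul h2 (k _) (k _)
  have e2 := (hF.mul h1 (k _) (k _)).const_mul (a : ℂ)
  have h := ((((e1.const_mul (b : ℂ)).sub e2).sub hG).const_mul (b : ℂ)⁻¹)
  refine h.congr (fun p => ?_) fun p => ?_ <;> (unfold gapOuter; ring)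

/-- Bounded components are even in k. The only linear dependence on ω is the summand ik for the
exterior, which `radiation` records. -/
lemma dtnMap_isNear (v : ℝ) {F : ℂ × ℝ → Fin N → Side → ℂ} {g : Fin N → Side → ℂ}
    (hF : ∀ i s, IsNear (fun p => F p i s) fun _ => g i s) (i : Fin N) (s : Side) :
    IsNear (fun p => S.dtnMap (p.1 / v) (F p) i s)
      fun p => (S.dtnMap 0 g + p.1 • ((1 / v : ℂ) • radiation g)) i s := by
  have hk : ∀ p : ℂ × ℝ, (p.1 / v) ^ 2 = (1 / (v : ℂ) ^ 2) * p.1 ^ 2 := fun p => by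
    rw [div_pow]
    ring
  cases s
  · by_cases h : 0 < i.val
    · simp only [dtnMap, radiation, h, dif_pos, if_true, hk, Pi.add_apply, Pi.smul_apply,
        smul_zero, add_zero, zero_pow two_ne_zero]
      exact gapInner_isNear (S.nested _ _ (by rw [Fin.lt_def]; simp only; omega)) _
        (hF _ _) (hF _ _)
    · simp only [dtnMap, radiation, h, dif_neg, if_false, not_false_eq_true, Pi.add_apply,
        Pi.smul_apply, smul_eq_mul]
      have h1 : (fun p : ℂ × ℝ => Complex.I * (p.1 / v) - 1 / S.rplus i)
          =O[𝓝 0] fun _ => (1 : ℝ) := by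
        have : Continuous fun p : ℂ × ℝ => Complex.I * (p.1 / v) - 1 / S.rplus i := by fun_prop
        exact this.continuousAt.isBigO_one ℝ
      refine ((IsNear.refl _).mul (hF i Side.plus) h1 (IsNear.const_isBigO _)).congr
        (fun _ => rfl) fun p => ?_
      ring
  · simp only [dtnMap, radiation, hk, Pi.add_apply, Pi.smul_apply, smul_zero, add_zero,
      zero_pow two_ne_zero]
    refine gapOuter_isNear (S.below_lt i) _ ?_ (hF _ _)
    unfold belowValue
    split_ifs
    · exact hF _ _
    · exact IsNear.refl _

end NestedShells

lemma affine_isBigO_one {E : Type*} [NormedAddCommGroup E] [NormedSpace ℂ E] (x y : E) :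
    (fun p : ℂ × ℝ => x + p.1 • y) =O[𝓝 0] fun _ => (1 : ℝ) := by
  have : Continuous fun p : ℂ × ℝ => x + p.1 • y := by fun_prop
  exact this.continuousAt.isBigO_one ℝ

namespace NestedShells

variable {N : ℕ} (S : NestedShells N)

/-! ### Solution of the linear system -/

/-- The operator that maps the boundary values to those produced by their normal derivatives. -/
def interactionMap (v : ℝ) (c : ℂ) (p : ℂ × ℝ) : (Fin N → Side → ℂ) →ₗ[ℂ] (Fin N → Side → ℂ) :=
  (S.neumannTrace (c * p.1 ^ 2)).comp (S.dtnLinear (p.1 / v))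

/-- The boundary values for vanishing coupling. -/
def incident (c : ℂ) (j : Fin N) (p : ℂ × ℝ) : Fin N → Side → ℂ :=
  fun i _ => if i = j then 1 / ((S.vol j : ℂ) - c * p.1 ^ 2) else 0

lemma isBigO_neumannTrace_affine (c : ℂ) {F : ℂ × ℝ → Fin N → Side → ℂ} {β₀ β₁ : Fin N → Side → ℂ}
    (hF : ∀ i s, IsNear (fun p => F p i s) fun p => (β₀ + p.1 • β₁) i s) :
    (fun p => S.neumannTrace (c * p.1 ^ 2) (F p)) =O[𝓝 0] fun _ => (1 : ℝ) := by
  have h := isNear_linear_apply (L := fun p => S.neumannTrace (c * p.1 ^ 2))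
    (L' := S.neumannTrace 0)
    (fun q => IsNear.of_isBigO (S.neumannTrace_sub_isBigO (sphereData q)) c) hF
    (fun i s => affine_isBigO_one (β₀ i s) (β₁ i s))
  refine h.isBigO_one ((affine_isBigO_one (S.neumannTrace 0 β₀) (S.neumannTrace 0 β₁)).congr_left
    fun p => ?_)
  rw [map_add, map_smul]

lemma interactionMap_isBigO_one (v : ℝ) (c : ℂ) (q : Fin N × Side) :
    (fun p => S.interactionMap v c p (sphereData q)) =O[𝓝 0] fun _ => (1 : ℝ) :=
  S.isBigO_neumannTrace_affine c fun i s =>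
    S.dtnMap_isNear v (F := fun _ => sphereData q) (fun _ _ => IsNear.refl _) i s

lemma incident_isNear (c : ℂ) (j i : Fin N) (s : Side) :
    IsNear (fun p => S.incident c j p i s) fun _ => ((1 / (S.vol j : ℂ)) • shellData j) i s := by
  unfold incident shellData
  by_cases h : i = j
  · have hd : DifferentiableAt ℂ (fun z : ℂ => 1 / ((S.vol j : ℂ) - z)) 0 := by
      refine (differentiableAt_const _).fun_div ((differentiableAt_const _).sub differentiableAt_id) ?_
      simpa using S.vol_ne_zero j
    simpa [h] using IsNear.of_differentiableAt hd c
  · simpa [h] using IsNear.refl _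

/-- The pointwise description of a solution becomes an equation in H¹(D), where the expansion takes
place. -/
lemma represents_iff {z C δ : ℂ} {j : Fin N} {β : Fin N → Side → ℂ} {u : S.H1} :
    (S.Represents u fun i x => (if i = j then C else 0) + δ * S.neumannFun z β i ‖x‖) ↔
      u = C • S.chi j + δ • S.neumannElement z β := by
  have h : S.Represents (C • S.chi j + δ • S.neumannElement z β)
      fun i x => (if i = j then C else 0) + δ * S.neumannFun z β i ‖x‖ := by
    have h1 := ((S.represents_chi j).smul C fun _ _ _ => differentiableAt_const _).add
      ((S.represents_neumannElement z β).smul δ fun i x hx => S.differentiableAt_neumannFun z β i hx)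
      (fun _ _ _ => differentiableAt_const _)
      (fun i x hx => (S.differentiableAt_neumannFun z β i hx).const_mul δ)
    refine h1.congr fun i x _ => ?_
    simp
  constructor
  · intro hu
    exact hu.unique h
  · rintro rfl
    exact h

lemma eventually_wellPosed (v : ℝ) (c : ℂ) : ∀ᶠ p : ℂ × ℝ in 𝓝 0,
    S.Nonresonant (p.1 / v) ∧ S.Regular (c * p.1 ^ 2) := by
  have h1 : Tendsto (fun p : ℂ × ℝ => p.1 / (v : ℂ)) (𝓝 0) (𝓝 0) := by
    have hc : Continuous fun p : ℂ × ℝ => p.1 / (v : ℂ) := by fun_prop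
    simpa using hc.tendsto 0
  have h2 : Tendsto (fun p : ℂ × ℝ => c * p.1 ^ 2) (𝓝 0) (𝓝 0) := by
    have hc : Continuous fun p : ℂ × ℝ => c * p.1 ^ 2 := by fun_prop
    simpa using hc.tendsto 0
  exact (h1.eventually S.eventually_nonresonant).and (h2.eventually S.eventually_regular)

/-- The boundary values of the auxiliary solutions to leading order. -/
lemma isNear_of_fixed {v : ℝ} {c : ℂ} {j : Fin N} {F : ℂ × ℝ → Fin N → Side → ℂ}
    (hF : ∀ᶠ p : ℂ × ℝ in 𝓝 0, F p = S.incident c j p + (p.2 : ℂ) • S.interactionMap v c p (F p))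
    (i : Fin N) (s : Side) :
    IsNear (fun p => F p i s) fun _ => ((1 / (S.vol j : ℂ)) • shellData j) i s := by
  have hinc : (fun p => S.incident c j p) =O[𝓝 0] fun _ => (1 : ℝ) :=
    isBigO_pi.2 fun i => isBigO_pi.2 fun s =>
      (S.incident_isNear c j i s).isBigO_one (IsNear.const_isBigO _)
  -- An a priori bound comes first: the fixed-point estimate bounds F by the incident data, hence
  -- δKF is O(δ) and F is close to the incident data.
  have hFb : F =O[𝓝 0] fun _ => (1 : ℝ) := by
    refine IsBigO.trans (IsBigO.of_bound 2 ?_) hinc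
    filter_upwards [hF, eventually_existsUnique_fixed (S.interactionMap_isBigO_one v c)]
      with p hp hfix
    exact hfix.2 _ _ hp
  obtain ⟨C, hC⟩ := exists_eventually_norm_le (S.interactionMap_isBigO_one v c)
  have hK : (fun p => S.interactionMap v c p (F p)) =O[𝓝 0] fun _ => (1 : ℝ) :=
    IsBigO.trans (IsBigO.of_bound C (hC.mono fun p hp => hp (F p))) hFb
  have hKi : (fun p => S.interactionMap v c p (F p) i s) =O[𝓝 0] fun _ => (1 : ℝ) :=
    isBigO_pi.1 (isBigO_pi.1 hK i) s
  exact (IsNear.of_delta_mul (hF.mono fun p hp => congrFun (congrFun hp i) s) hKi).trans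
    (S.incident_isNear c j i s)

variable [NeZero N]

variable {S} in
lemma isAuxiliarySolution_iff_eq {v vr : ℝ} {p : ℂ × ℝ} (hk : S.Nonresonant (p.1 / v))
    (hz : S.Regular (1 / (vr : ℂ) ^ 2 * p.1 ^ 2)) {j : Fin N} {u : S.H1} :
    S.IsAuxiliarySolution v vr p.1 p.2 j u ↔ ∃ f : Fin N → Side → ℂ,
      f = S.incident (1 / (vr : ℂ) ^ 2) j p
        + (p.2 : ℂ) • S.interactionMap v (1 / (vr : ℂ) ^ 2) p f ∧
      u = (1 / ((S.vol j : ℂ) - 1 / (vr : ℂ) ^ 2 * p.1 ^ 2)) • S.chi j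
        + (p.2 : ℂ) • S.neumannElement (1 / (vr : ℂ) ^ 2 * p.1 ^ 2) (S.dtnMap (p.1 / v) f) := by
  rw [isAuxiliarySolution_iff rfl (by ring : p.1 ^ 2 / (vr : ℂ) ^ 2 = 1 / (vr : ℂ) ^ 2 * p.1 ^ 2)
    hk hz]
  refine exists_congr fun f => and_congr ?_ S.represents_iff
  constructor
  · intro h
    funext i s
    exact h i s
  · intro h i s
    exact congrFun (congrFun h i) s

/-- The auxiliary solutions are well defined for small `ω` and `δ`. -/
theorem eventually_existsUnique_auxiliarySolution (v vr : ℝ) : ∀ᶠ p : ℂ × ℝ in 𝓝 0, ∀ j,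
    ∃! u : S.H1, S.IsAuxiliarySolution v vr p.1 p.2 j u := by
  filter_upwards [S.eventually_wellPosed v (1 / (vr : ℂ) ^ 2),
    eventually_existsUnique_fixed (S.interactionMap_isBigO_one v (1 / (vr : ℂ) ^ 2))]
    with p hp hfix j
  obtain ⟨f, hf, huniq⟩ := hfix.1 (S.incident (1 / (vr : ℂ) ^ 2) j p)
  refine ⟨_, (isAuxiliarySolution_iff_eq hp.1 hp.2).2 ⟨f, hf, rfl⟩, fun u hu => ?_⟩
  obtain ⟨f', hf', rfl⟩ := (isAuxiliarySolution_iff_eq hp.1 hp.2).1 hu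
  rw [huniq f' hf']

end NestedShells

namespace NestedShells

variable {N : ℕ} (S : NestedShells N)

/-! ### The coefficients of the expansions -/

/-- Both describe the capacity of the same gap, seen from its two sides; this is the symmetry of the
capacitance matrix. -/
lemma outerCoupling_eq_innerCoupling {i j : Fin N} (h : i.val + 1 = j.val) :
    S.outerCoupling j = S.innerCoupling i := by
  have h0 : 0 < j.val := by omega
  have hN : i.val + 1 < N := by have := j.2; omega
  have e1 : (⟨j.val - 1, by omega⟩ : Fin N) = i := Fin.ext (by simp only; omega)
  have e2 : (⟨i.val + 1, hN⟩ : Fin N) = j := Fin.ext h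
  simp only [outerCoupling, innerCoupling, h0, hN, dif_pos, e1, e2]

/-- A potential that is constant on the shells sends flux only through gaps adjacent to the j-th
shell, whence the tridiagonal form. Combined with `capacitance_eq` it identifies `deltaCoeff` with
-𝒞_ij/(|D_i|²|D_j|). -/
lemma flux_shellData (i j : Fin N) :
    4 * Real.pi * ((S.rplus i : ℂ) ^ 2 * S.dtnMap 0 (shellData j) i Side.plus
      - (S.rminus i : ℂ) ^ 2 * S.dtnMap 0 (shellData j) i Side.minus)
      = (S.vol i : ℂ) ^ 2 * S.vol j * S.deltaCoeff i j := by
  rw [dtnMap_zero_plus, dtnMap_zero_minus]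
  have hi := S.vol_ne_zero i
  have hj := S.vol_ne_zero j
  have hp : (if h : 0 < i.val then (S.outerCoupling i : ℂ)
        * (shellData j ⟨i.val - 1, by omega⟩ Side.minus - shellData j i Side.plus)
      else -(S.outerCoupling i : ℂ) * shellData j i Side.plus)
      = (S.outerCoupling i : ℂ) * ((if i.val = j.val + 1 then 1 else 0) - if i = j then 1 else 0) := by
    by_cases h : 0 < i.val
    · have e : ((⟨i.val - 1, by omega⟩ : Fin N) = j) ↔ i.val = j.val + 1 := by
        rw [Fin.ext_iff]
        simp only
        omega
      simp only [h, dif_pos, shellData, e]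
    · have e : i.val ≠ j.val + 1 := by omega
      simp only [h, dif_neg, shellData, e, if_false, not_false_eq_true]
      ring
  have hm : belowValue (shellData j) i = if i.val + 1 = j.val then 1 else 0 := by
    by_cases h : i.val + 1 < N
    · have e : ((⟨i.val + 1, h⟩ : Fin N) = j) ↔ i.val + 1 = j.val := by rw [Fin.ext_iff]
      simp only [belowValue, h, dif_pos, shellData, e]
    · have e : i.val + 1 ≠ j.val := by have := j.2; omega
      simp [belowValue, h, e]
  rw [hp, hm]
  unfold shellData deltaCoeff
  by_cases h1 : i.val + 1 = j.val
  · have e1 : i.val ≠ j.val + 1 := by omega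
    have e2 : i ≠ j := fun h => by rw [h] at h1; omega
    simp only [h1, e1, e2, if_true, if_false, S.outerCoupling_eq_innerCoupling h1]
    push_cast
    field_simp
    ring
  by_cases h2 : i = j
  · subst h2
    simp only [h1, if_true, if_false, Nat.left_eq_add, one_ne_zero]
    push_cast
    field_simp
    ring
  by_cases h3 : i.val = j.val + 1
  · simp only [h2, h3, if_true, if_false, S.outerCoupling_eq_innerCoupling h3.symm]
    have h1' : j.val + 1 + 1 ≠ j.val := by omega
    simp only [h1', if_false]
    push_cast
    field_simp
    ring
  · simp [h1, h2, h3]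

/-- The inner value of the Neumann solution is fixed so that its integral equals the source term,
which at z = 0 is the flux of the data divided by the volume. -/
lemma shellIntegral_neumannElement_zero (β : Fin N → Side → ℂ) (i : Fin N) :
    S.shellIntegral i (S.neumannElement 0 β) = S.neumannSource 0 β i :=
  (shellIntegral_of_represents (S.represents_neumannElement 0 β) i).trans
    (neumann_moment S.eventually_regular.self_of_nhds β i)

/-- The boundary values of the `j`-th auxiliary solution to leading order. -/
def leadingData (j : Fin N) : Fin N → Side → ℂ := (1 / (S.vol j : ℂ)) • shellData j

lemma shellIntegral_neumannElement_dtn (i j : Fin N) :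
    S.shellIntegral i (S.neumannElement 0 (S.dtnMap 0 (S.leadingData j)))
      = S.deltaCoeff i j * S.vol i := by
  have hi := S.vol_ne_zero i
  have hj := S.vol_ne_zero j
  have hlin : S.dtnMap 0 (S.leadingData j) = (1 / (S.vol j : ℂ)) • S.dtnMap 0 (shellData j) :=
    (S.dtnLinear 0).map_smul _ _
  rw [shellIntegral_neumannElement_zero, hlin, neumannSource_smul, neumannSource, flux_shellData,
    sub_zero]
  field_simp

/-- The coefficient of `χ_{D_j}` in the term of order `ω δ`. -/
def radiationCoeff (v : ℝ) (j : Fin N) : ℂ := if j.val = 0 then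
  4 * Real.pi * (S.rplus j : ℂ) ^ 2 * Complex.I / ((S.vol j : ℂ) ^ 3 * v) else 0

lemma shellIntegral_neumannElement_radiation (v : ℝ) (i j : Fin N) :
    S.shellIntegral i (S.neumannElement 0 ((1 / (v : ℂ)) • radiation (S.leadingData j)))
      = if i = j then S.radiationCoeff v j * S.vol j else 0 := by
  have hj := S.vol_ne_zero j
  rw [shellIntegral_neumannElement_zero, neumannSource_smul, neumannSource, sub_zero]
  simp only [radiation, leadingData, shellData, radiationCoeff, Pi.smul_apply, smul_eq_mul]
  by_cases h : i = j
  · subst h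
    by_cases h0 : i.val = 0
    · simp only [h0, lt_irrefl, if_true, if_false]
      field_simp
      ring
    · have h0' : 0 < i.val := by omega
      simp [h0, h0']
  · simp [h]

/-- The zero-mean corrector of order `δ`. -/
def deltaCorrector (j : Fin N) : S.H1 :=
  S.neumannElement 0 (S.dtnMap 0 (S.leadingData j)) - ∑ i, (S.deltaCoeff i j : ℂ) • S.chi i

/-- The zero-mean corrector of order `ω δ`. -/
def radiationCorrector (v : ℝ) (j : Fin N) : S.H1 :=
  S.neumannElement 0 ((1 / (v : ℂ)) • radiation (S.leadingData j))
    - S.radiationCoeff v j • S.chi j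

lemma shellIntegral_sum_chi (a : Fin N → ℂ) (i : Fin N) :
    S.shellIntegral i (∑ l, a l • S.chi l) = a i * S.vol i := by
  rw [map_sum, Finset.sum_eq_single i]
  · rw [map_smul, shellIntegral_chi, if_pos rfl, smul_eq_mul]
  · intro l _ hl
    rw [map_smul, shellIntegral_chi, if_neg hl.symm, smul_zero]
  · simp

lemma shellIntegral_deltaCorrector (i j : Fin N) : S.shellIntegral i (S.deltaCorrector j) = 0 := by
  rw [deltaCorrector, map_sub, shellIntegral_neumannElement_dtn, shellIntegral_sum_chi, sub_self]

lemma shellIntegral_radiationCorrector (v : ℝ) (i j : Fin N) :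
    S.shellIntegral i (S.radiationCorrector v j) = 0 := by
  rw [radiationCorrector, map_sub, shellIntegral_neumannElement_radiation, map_smul,
    shellIntegral_chi]
  split_ifs <;> simp

lemma linear_apply_three_terms {E : Type*} [AddCommGroup E] [Module ℂ E] (L : E →ₗ[ℂ] ℂ)
    (a d w b : ℂ) (χ x c c' : E) (hc : L c = 0) (hc' : L c' = 0) :
    L (a • χ + d • (x + c) + w • (b • χ + c')) = a * L χ + d * L x + w * (b * L χ) := by
  simp [hc, hc']

lemma shellIntegral_auxExpansion (v vr : ℝ) (i j : Fin N) {c01 c11 : S.H1}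
    (h01 : S.shellIntegral i c01 = 0) (h11 : S.shellIntegral i c11 = 0) (ω : ℂ) (δ : ℝ) :
    S.shellIntegral i (S.auxExpansion v vr j c01 c11 ω δ)
      = (if i = j then 1 + ω ^ 2 / ((vr : ℂ) ^ 2 * S.vol j) else 0)
        + δ * (S.deltaCoeff i j * S.vol i)
        + ω * δ * (if i = j then S.radiationCoeff v j * S.vol j else 0) := by
  have hj := S.vol_ne_zero j
  refine (linear_apply_three_terms (S.shellIntegral i) _ _ _ _ (S.chi j) _ _ _ h01 h11).trans ?_
  rw [shellIntegral_sum_chi, shellIntegral_chi]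
  by_cases h : i = j
  · simp only [h, if_true]
    have e : (1 / (S.vol j : ℂ) + ω ^ 2 / ((vr : ℂ) ^ 2 * S.vol j ^ 2)) * S.vol j
        = 1 + ω ^ 2 / ((vr : ℂ) ^ 2 * S.vol j) := by
      by_cases hv : (vr : ℂ) = 0
      · simp [hv, hj]
      · field_simp
    rw [e]
    rfl
  · simp [h]

variable [NeZero N]

/-- With 𝒞_ij = -|D_i|²|D_j| times `deltaCoeff`, the conjugation by V⁻¹ leaves |D_i| times
`deltaCoeff`. The right side is exactly what integration of `auxExpansion` gives. -/
lemma momentExpansion_apply (v vr : ℝ) (ω : ℂ) (δ : ℝ) (i j : Fin N) :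
    S.momentExpansion v vr ω δ i j
      = (if i = j then 1 + ω ^ 2 / ((vr : ℂ) ^ 2 * S.vol j) else 0)
        + δ * (S.deltaCoeff i j * S.vol i)
        + ω * δ * (if i = j then S.radiationCoeff v j * S.vol j else 0) := by
  have hi := S.vol_ne_zero i
  have hj := S.vol_ne_zero j
  have hinv : S.volMatrix⁻¹ = Matrix.diagonal fun i => (S.vol i : ℂ)⁻¹ := by
    refine Matrix.inv_eq_left_inv ?_
    rw [volMatrix, Matrix.diagonal_mul_diagonal, ← Matrix.diagonal_one]
    congr 1
    funext l
    exact inv_mul_cancel₀ (S.vol_ne_zero l)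
  have hcap : ((S.capacitance i j : ℝ) : ℂ) = -((S.vol i : ℂ) ^ 2 * S.vol j * S.deltaCoeff i j) := by
    rw [capacitance_eq, flux_shellData]
  unfold momentExpansion
  rw [hinv]
  simp only [Matrix.add_apply, Matrix.sub_apply, Matrix.smul_apply, Matrix.mul_diagonal,
    Matrix.diagonal_mul, Matrix.map_apply, hcap, Matrix.diagonal_mul_diagonal, smul_eq_mul,
    Matrix.one_apply, Matrix.diagonal_apply, radiationCoeff]
  by_cases h : i = j
  · subst h
    by_cases h0 : i = 0
    · subst h0
      simp only [if_true, Pi.single_eq_same, Fin.val_zero]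
      field_simp
      ring
    · have h0' : i.val ≠ 0 := fun h => h0 (Fin.ext (by simpa using h))
      simp only [if_true, h0', if_false, Pi.single_eq_of_ne h0]
      field_simp
      ring
  · simp only [h, if_false]
    field_simp
    ring

end NestedShells

/-! ### Remainder estimates and assembly of the expansions -/

lemma sub_expansion_eq {E : Type*} [AddCommGroup E] [Module ℂ E] (a a' d w b : ℂ)
    (χ y x e₀ e₁ : E) :
    (a • χ + d • y) - (a' • χ + d • (x + (e₀ - x)) + (w * d) • (b • χ + (e₁ - b • χ)))
      = (a - a') • χ + d • (y - (e₀ + w • e₁)) := by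
  module

/-- The factor δ is itself O(|ω|² + |δ|), so an error of this order in the Neumann solution becomes
quadratic. -/
lemma isBigO_smul_add_delta_smul {E : Type*} [NormedAddCommGroup E] [NormedSpace ℂ E] (χ : E)
    {a : ℂ × ℝ → ℂ} (ha : a =O[𝓝 0] fun p => (‖p.1‖ ^ 2 + |p.2|) ^ 2) {y y' : ℂ × ℝ → E}
    (hy : IsNear y y') : (fun p => a p • χ + (p.2 : ℂ) • (y p - y' p))
      =O[𝓝 0] fun p => (‖p.1‖ ^ 2 + |p.2|) ^ 2 := by
  have h1 : (fun p => a p • χ) =O[𝓝 0] fun p : ℂ × ℝ => (‖p.1‖ ^ 2 + |p.2|) ^ 2 := by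
    have := ha.smul (isBigO_const_const χ (one_ne_zero (α := ℝ)) (𝓝 0))
    simpa using this
  have hd : (fun p : ℂ × ℝ => (p.2 : ℂ)) =O[𝓝 0] fun p : ℂ × ℝ => ‖p.1‖ ^ 2 + |p.2| := by
    refine IsBigO.of_bound 1 (Eventually.of_forall fun p => ?_)
    simp only [Complex.norm_real, Real.norm_eq_abs, one_mul]
    rw [abs_of_nonneg (by positivity : (0 : ℝ) ≤ ‖p.1‖ ^ 2 + |p.2|)]
    exact le_add_of_nonneg_left (by positivity)
  refine h1.add ((hd.smul hy).congr_right fun p => ?_)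
  rw [smul_eq_mul]
  exact (sq _).symm

lemma isBigO_sub_expansion {E : Type*} [NormedAddCommGroup E] [NormedSpace ℂ E] {χ x e₀ e₁ : E}
    {a a' : ℂ × ℝ → ℂ} {b : ℂ} {u y : ℂ × ℝ → E}
    (hu : ∀ᶠ p : ℂ × ℝ in 𝓝 0, u p = a p • χ + (p.2 : ℂ) • y p)
    (ha : (fun p => a p - a' p) =O[𝓝 0] fun p => (‖p.1‖ ^ 2 + |p.2|) ^ 2)
    (hy : IsNear y fun p => e₀ + p.1 • e₁) :
    (fun p => u p - (a' p • χ + (p.2 : ℂ) • (x + (e₀ - x))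
      + (p.1 * p.2) • (b • χ + (e₁ - b • χ)))) =O[𝓝 0] fun p => (‖p.1‖ ^ 2 + |p.2|) ^ 2 := by
  refine (isBigO_smul_add_delta_smul χ ha hy).congr' (hu.mono fun p hp => ?_) EventuallyEq.rfl
  beta_reduce
  rw [hp, sub_expansion_eq]

/-- With ζ = cω² the remainder is exactly ζ²/(V²(V - ζ)), and |ω|⁴ is dominated by the squared
gauge. -/
lemma inv_sub_isBigO {V : ℂ} (hV : V ≠ 0) (c : ℂ) :
    (fun p : ℂ × ℝ => 1 / (V - c * p.1 ^ 2) - (1 / V + c * p.1 ^ 2 / V ^ 2))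
      =O[𝓝 0] fun p => (‖p.1‖ ^ 2 + |p.2|) ^ 2 := by
  have hc : ContinuousAt (fun p : ℂ × ℝ => V - c * p.1 ^ 2) 0 := by fun_prop
  have hne : ∀ᶠ p : ℂ × ℝ in 𝓝 0, V - c * p.1 ^ 2 ≠ 0 := hc.eventually_ne (by simpa using hV)
  have hinv : (fun p : ℂ × ℝ => (c ^ 2 / V ^ 2) * (V - c * p.1 ^ 2)⁻¹) =O[𝓝 0] fun _ => (1 : ℝ) :=
    (continuousAt_const.mul (hc.inv₀ (by simpa using hV))).isBigO_one ℝ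
  have hp : (fun p : ℂ × ℝ => p.1 ^ 4) =O[𝓝 0] fun p => (‖p.1‖ ^ 2 + |p.2|) ^ 2 := by
    refine IsBigO.of_bound 1 (Eventually.of_forall fun p => ?_)
    rw [one_mul, norm_pow, Real.norm_of_nonneg (by positivity)]
    have h : ‖p.1‖ ^ 2 ≤ ‖p.1‖ ^ 2 + |p.2| := le_add_of_nonneg_right (abs_nonneg _)
    calc ‖p.1‖ ^ 4 = (‖p.1‖ ^ 2) ^ 2 := by ring
      _ ≤ _ := pow_le_pow_left₀ (by positivity) h 2
  refine (hinv.mul hp).congr' ?_ (Eventually.of_forall fun p => one_mul _)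
  filter_upwards [hne] with p hp
  field_simp
  ring

namespace NestedShells

variable {N : ℕ} (S : NestedShells N)

/-- The expansion of the Neumann solution that belongs to boundary values close to
`leadingData`. -/
lemma neumannElement_isNear {v : ℝ} (c : ℂ) {j : Fin N} {F : ℂ × ℝ → Fin N → Side → ℂ}
    (hF : ∀ i s, IsNear (fun p => F p i s) fun _ => S.leadingData j i s) :
    IsNear (fun p => S.neumannElement (c * p.1 ^ 2) (S.dtnMap (p.1 / v) (F p)))
      fun p => S.neumannElement 0 (S.dtnMap 0 (S.leadingData j))
        + p.1 • S.neumannElement 0 ((1 / (v : ℂ)) • radiation (S.leadingData j)) := by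
  have h := isNear_linear_apply (L := fun p => S.neumannElement (c * p.1 ^ 2))
    (L' := S.neumannElement 0)
    (fun q => IsNear.of_isBigO (S.neumannElement_sub_isBigO (sphereData q)) c)
    (S.dtnMap_isNear v hF) (fun i s => affine_isBigO_one _ _)
  refine h.congr (fun _ => rfl) fun p => ?_
  exact (map_add _ _ _).trans (congrArg _ (map_smul _ _ _))

variable [NeZero N]

/-- The expansion of the auxiliary solutions in `H¹(D)`. -/
theorem isBigO_sub_auxExpansion {v vr : ℝ} {j : Fin N} {u : ℂ × ℝ → S.H1}
    (hu : ∀ᶠ p : ℂ × ℝ in 𝓝 0, S.IsAuxiliarySolution v vr p.1 p.2 j (u p)) :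
    (fun p : ℂ × ℝ => u p - S.auxExpansion v vr j (S.deltaCorrector j) (S.radiationCorrector v j)
      p.1 p.2) =O[𝓝 0] fun p => (‖p.1‖ ^ 2 + |p.2|) ^ 2 := by
  have hex : ∀ᶠ p : ℂ × ℝ in 𝓝 0, ∃ f : Fin N → Side → ℂ,
      f = S.incident (1 / (vr : ℂ) ^ 2) j p
        + (p.2 : ℂ) • S.interactionMap v (1 / (vr : ℂ) ^ 2) p f ∧
      u p = (1 / ((S.vol j : ℂ) - 1 / (vr : ℂ) ^ 2 * p.1 ^ 2)) • S.chi j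
        + (p.2 : ℂ) • S.neumannElement (1 / (vr : ℂ) ^ 2 * p.1 ^ 2) (S.dtnMap (p.1 / v) f) :=
    (hu.and (S.eventually_wellPosed v (1 / (vr : ℂ) ^ 2))).mono fun p hp =>
      (isAuxiliarySolution_iff_eq hp.2.1 hp.2.2).1 hp.1
  -- The boundary values are selected as one function of (ω, δ), so that asymptotic statements about
  -- them make sense.
  refine hex.choice.elim fun F hF => ?_
  have hnear := S.neumannElement_isNear (v := v) (1 / (vr : ℂ) ^ 2)
    (S.isNear_of_fixed (hF.mono fun p hp => hp.1))
  have ha : (fun p : ℂ × ℝ => 1 / ((S.vol j : ℂ) - 1 / (vr : ℂ) ^ 2 * p.1 ^ 2)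
      - (1 / (S.vol j : ℂ) + p.1 ^ 2 / ((vr : ℂ) ^ 2 * (S.vol j : ℂ) ^ 2)))
      =O[𝓝 0] fun p => (‖p.1‖ ^ 2 + |p.2|) ^ 2 := by
    refine (inv_sub_isBigO (S.vol_ne_zero j) (1 / (vr : ℂ) ^ 2)).congr_left fun p => ?_
    rw [div_mul_eq_div_div (p.1 ^ 2)]
    ring
  exact isBigO_sub_expansion (hF.mono fun p hp => hp.2) ha hnear

/-- The expansion of the moments of the auxiliary solutions. -/
theorem isBigO_sub_momentExpansion {v vr : ℝ} {u : Fin N → ℂ × ℝ → S.H1} {i j : Fin N}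
    (hu : ∀ᶠ p : ℂ × ℝ in 𝓝 0, S.IsAuxiliarySolution v vr p.1 p.2 j (u j p)) :
    (fun p : ℂ × ℝ => S.momentMatrix (fun j => u j p) i j - S.momentExpansion v vr p.1 p.2 i j)
      =O[𝓝 0] fun p => (‖p.1‖ ^ 2 + |p.2|) ^ 2 := by
  refine (S.exists_norm_integral_le i).elim fun C hC => ?_
  -- A bounded functional preserves the order of the remainder, and the zero-mean correctors drop
  -- out of the integrated expansion.
  have h1 : (fun p : ℂ × ℝ => S.shellIntegral i (u j p - S.auxExpansion v vr j (S.deltaCorrector j)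
      (S.radiationCorrector v j) p.1 p.2)) =O[𝓝 0] fun p => (‖p.1‖ ^ 2 + |p.2|) ^ 2 :=
    IsBigO.trans (IsBigO.of_bound C (Eventually.of_forall fun p => hC _))
      (S.isBigO_sub_auxExpansion hu)
  refine h1.congr_left fun p => ?_
  rw [momentExpansion_apply, ← S.shellIntegral_auxExpansion v vr i j
    (S.shellIntegral_deltaCorrector i j) (S.shellIntegral_radiationCorrector v i j)]
  exact map_sub _ _ _

end NestedShells

end

theorem mainTheorem9 {N : ℕ} [NeZero N] (S : NestedShells N) (v vr : ℝ) (hv : 0 < v)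
    (hvr : 0 < vr) :
    -- the volumes of the resonators
    (∀ j, S.vol j = 4 * Real.pi / 3 * (S.rplus j ^ 3 - S.rminus j ^ 3)) ∧
    -- the auxiliary solutions are well defined for small `ω ∈ ℂ` and `δ ∈ ℝ`
    (∀ᶠ p : ℂ × ℝ in 𝓝 0, ∀ j, ∃! u : S.H1, S.IsAuxiliarySolution v vr p.1 p.2 j u) ∧
    ∀ u : Fin N → ℂ × ℝ → S.H1,
      (∀ᶠ p : ℂ × ℝ in 𝓝 0, ∀ j, S.IsAuxiliarySolution v vr p.1 p.2 j (u j p)) →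
      -- their asymptotic expansion in `H¹(D)`
      (∃ c01 c11 : Fin N → S.H1,
        (∀ j i, ∫ x in S.shell i, S.fn (c01 j) x = 0) ∧
        (∀ j i, ∫ x in S.shell i, S.fn (c11 j) x = 0) ∧
        ∀ j, (fun p : ℂ × ℝ => u j p - S.auxExpansion v vr j (c01 j) (c11 j) p.1 p.2)
          =O[𝓝 0] fun p => (‖p.1‖ ^ 2 + |p.2|) ^ 2) ∧
      -- the asymptotic expansion of the matrix `U`
      (∀ i j, (fun p : ℂ × ℝ => S.momentMatrix (fun j => u j p) i j
          - S.momentExpansion v vr p.1 p.2 i j)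
          =O[𝓝 0] fun p => (‖p.1‖ ^ 2 + |p.2|) ^ 2) := by
  refine ⟨S.vol_eq, S.eventually_existsUnique_auxiliarySolution v vr, fun u hu => ⟨?_, ?_⟩⟩
  · exact ⟨S.deltaCorrector, S.radiationCorrector v,
      fun j i => S.shellIntegral_deltaCorrector i j,
      fun j i => S.shellIntegral_radiationCorrector v i j,
      fun j => S.isBigO_sub_auxExpansion (hu.mono fun p hp => hp j)⟩
  · exact fun i j => S.isBigO_sub_momentExpansion (hu.mono fun p hp => hp j)
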